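/- Let $\mathcal M=\mathbb R$ or $\mathcal M=\mathbb T=\mathbb R/2\pi\mathbb Z$, let $s<0$ and $T>0$. Let $H^s(\mathcal M)$ be the $L^2$-based Sobolev space of real-valued distributions $f$ on $\mathcal M$ with $\langle\xi\rangle^s\widehat f\in L^2(\widehat{\mathcal M})$, where $\langle\xi\rangle=(1+|\xi|^2)^{1/2}$, $\widehat{\mathbb R}=\mathbb R$ with Lebesgue measure and $\widehat{\mathbb T}=\mathbb Z$ with counting measure; write $H^\infty(\mathcal M)=\bigcap_{k\ge 0}H^k(\mathcal M)$ (for $\mathcal M=\mathbb T$ this is $C^\infty(\mathbb T)$). Consider the BBM equation $$\partial_t u-\partial_{xxt}u+\partial_x u+\tfrac12\partial_x(u^2)=0,\qquad u|_{t=0}=u_0,$$ for real-valued $u$ on $[0,T]\times\mathcal M$. For every $u_0\in H^\infty(\mathcal M)$ it has exactly one smooth solution, that is, one classical solution $u\in C([0,T];H^\infty(\mathcal M))$, so that the solution map $u_0\mapsto u$ is defined on $H^\infty(\mathcal M)$ with values in $C([0,T];H^s(\mathcal M))$. The solution map $\Phi\colon u_0\in H^s(\mathcal M)\mapsto u\in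 C([0,T];H^s(\mathcal M))$ is discontinuous everywhere in $H^s(\mathcal M)$, however it is defined at non-smooth data: there exist maps $\Phi\colon H^s(\mathcal M)\to C([0,T];H^s(\mathcal M))$ which send every $u_0\in H^\infty(\mathcal M)$ to the smooth solution with initial datum $u_0$, and every such map is discontinuous at every point of $H^s(\mathcal M)$. -/

import Mathlib

open MeasureTheory Set Filter Topology TemperedDistribution
open scoped SchwartzMap ContDiff ComplexConjugate ENNReal

noncomputable section

/-! ### The Sobolev space `H^s(ℝ)` of real-valued tempered distributions -/

/-- The real tempered distributions `f` on `ℝ` with `⟨D⟩^s f ∈ L²(ℝ)`; `f` is real when it takes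
real values on real test functions. -/
def sobolevLineSubmodule (s : ℝ) : Submodule ℝ 𝓢'(ℝ, ℂ) where
  carrier := {f | MemSobolev s 2 f ∧ ∀ φ : 𝓢(ℝ, ℂ), (∀ x, (φ x).im = 0) → (f φ).im = 0}
  add_mem' := by
    rintro f g ⟨hf, hf'⟩ ⟨hg, hg'⟩
    refine ⟨hf.add hg, fun φ hφ => ?_⟩
    have h : (f + g) φ = f φ + g φ := rfl
    rw [h, Complex.add_im, hf' φ hφ, hg' φ hφ, add_zero]
  zero_mem' := ⟨memSobolev_fun_zero ℝ ℂ s 2, fun φ _ => rfl⟩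
  smul_mem' := by
    rintro c f ⟨hf, hf'⟩
    refine ⟨?_, fun φ hφ => ?_⟩
    · have h : c • f = (c : ℂ) • f := by
        ext φ
        change c • f φ = (c : ℂ) • f φ
        simp
      rw [h]
      exact hf.smul _
    · have h : (c • f) φ = c • f φ := rfl
      rw [h, Complex.smul_im, hf' φ hφ, smul_zero]

/-- The space `H^s(ℝ)`. It is a type of its own, so that its topology is that of the Sobolev norm
below and not the one inherited from `𝓢'`. -/
def SobolevLine (s : ℝ) : Type := sobolevLineSubmodule s

instance (s : ℝ) : AddCommGroup (SobolevLine s) :=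
  inferInstanceAs (AddCommGroup (sobolevLineSubmodule s))

instance (s : ℝ) : Module ℝ (SobolevLine s) :=
  inferInstanceAs (Module ℝ (sobolevLineSubmodule s))

/-- The tempered distribution underlying an element of `H^s(ℝ)`. -/
def SobolevLine.toDistribution {s : ℝ} (f : SobolevLine s) : 𝓢'(ℝ, ℂ) := f.1

theorem Lp_toTemperedDistribution_injective :
    Function.Injective (fun g : Lp ℂ 2 (volume : Measure ℝ) => (g : 𝓢'(ℝ, ℂ))) := by
  intro g h hgh
  have := LinearMap.ker_eq_bot.mp
    (Lp.ker_toTemperedDistributionCLM_eq_bot (E := ℝ) (F := ℂ) (p := 2) (μ := volume))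
  exact this hgh

/-- The function `⟨D⟩^s f ∈ L²(ℝ)`, for `f ∈ H^s(ℝ)`. -/
def SobolevLine.besselL2 {s : ℝ} (f : SobolevLine s) : Lp ℂ 2 (volume : Measure ℝ) :=
  f.2.1.choose

theorem SobolevLine.besselL2_spec {s : ℝ} (f : SobolevLine s) :
    besselPotential ℝ ℂ s f.toDistribution = (f.besselL2 : 𝓢'(ℝ, ℂ)) :=
  f.2.1.choose_spec

/-- The map `f ↦ ⟨D⟩^s f` from `H^s(ℝ)` to `L²(ℝ)`. -/
def SobolevLine.toL2 (s : ℝ) : SobolevLine s →ₗ[ℝ] Lp ℂ 2 (volume : Measure ℝ) where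
  toFun f := f.besselL2
  map_add' f g := by
    apply Lp_toTemperedDistribution_injective
    have h : (f + g).toDistribution = f.toDistribution + g.toDistribution := rfl
    have h1 := (f + g).besselL2_spec
    rw [h, map_add, f.besselL2_spec, g.besselL2_spec] at h1
    simp only [← Lp.toTemperedDistributionCLM_apply] at h1 ⊢
    rw [map_add, h1]
  map_smul' c f := by
    apply Lp_toTemperedDistribution_injective
    have h : (c • f).toDistribution = (c : ℂ) • f.toDistribution := by
      ext φ
      change c • f.toDistribution φ = (c : ℂ) • f.toDistribution φ
      simp
    have h1 := (c • f).besselL2_spec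
    have h2 : (RingHom.id ℝ) c • f.besselL2 = (c : ℂ) • f.besselL2 := by
      ext1
      filter_upwards [Lp.coeFn_smul c f.besselL2, Lp.coeFn_smul (c : ℂ) f.besselL2] with x h3 h4
      rw [RingHom.id_apply, h3, h4]
      simp
    rw [h, map_smul, f.besselL2_spec] at h1
    simp only [← Lp.toTemperedDistributionCLM_apply] at h1 ⊢
    rw [h2, map_smul, h1]

theorem SobolevLine.toL2_spec {s : ℝ} (f : SobolevLine s) :
    besselPotential ℝ ℂ s f.toDistribution = (SobolevLine.toL2 s f : 𝓢'(ℝ, ℂ)) :=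
  f.besselL2_spec

theorem SobolevLine.toL2_injective (s : ℝ) : Function.Injective (SobolevLine.toL2 s) := by
  intro f g hfg
  have h : besselPotential ℝ ℂ s f.toDistribution = besselPotential ℝ ℂ s g.toDistribution := by
    rw [f.toL2_spec, g.toL2_spec, hfg]
  have h' := congrArg (besselPotential ℝ ℂ (-s)) h
  simp only [besselPotential_besselPotential_apply, add_neg_cancel, besselPotential_zero,
    ContinuousLinearMap.coe_id', id_eq] at h'
  exact Subtype.ext h'

/-- `H^s(ℝ)` with the norm `‖f‖ = ‖⟨D⟩^s f‖_{L²}`. Mathlib's `⟨D⟩^s` has the symbol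
`(1 + |ξ|²)^(s/2)` with respect to the characters `e^{2πixξ}`; with respect to `e^{ixξ}` this is
`(1 + |ξ/2π|²)^(s/2)`, which gives an equivalent norm. -/
instance (s : ℝ) : NormedAddCommGroup (SobolevLine s) :=
  NormedAddCommGroup.induced (SobolevLine s) (Lp ℂ 2 (volume : Measure ℝ)) (SobolevLine.toL2 s)
    (SobolevLine.toL2_injective s)

/-- `f ∈ H^s(ℝ)` is the distribution given by the function `g`. -/
def SobolevLine.Represents {s : ℝ} (f : SobolevLine s) (g : ℝ → ℝ) : Prop :=
  ∀ φ : 𝓢(ℝ, ℂ), f.toDistribution φ = ∫ x, φ x * (g x : ℂ)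

/-! ### The Sobolev space `H^s(𝕋)` of real-valued distributions, `𝕋 = ℝ / 2πℤ` -/

/-- A distribution on `𝕋` is identified with the sequence `a` of its Fourier coefficients. It is
real when `a (-n)` is the conjugate of `a n`, and it belongs to `H^s` when `⟨n⟩^s a n` is square
summable. -/
def sobolevTorusSubmodule (s : ℝ) : Submodule ℝ (ℤ → ℂ) where
  carrier := {a | (∀ n, a (-n) = conj (a n)) ∧
    Memℓp (fun n : ℤ => ((1 + (n : ℝ) ^ 2) ^ (s / 2)) • a n) 2}
  add_mem' := by
    rintro a b ⟨ha, ha'⟩ ⟨hb, hb'⟩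
    refine ⟨fun n => by simp [ha n, hb n], ?_⟩
    have := ha'.add hb'
    convert this using 1
    ext n
    simp
  zero_mem' := by
    refine ⟨fun n => by simp, ?_⟩
    have : (fun n : ℤ => ((1 + (n : ℝ) ^ 2) ^ (s / 2)) • (0 : ℤ → ℂ) n) = 0 := by
      ext n
      simp
    rw [this]
    exact zero_memℓp
  smul_mem' := by
    rintro c a ⟨ha, ha'⟩
    refine ⟨fun n => by simp [ha n], ?_⟩
    have := ha'.const_smul c
    convert this using 1
    ext n
    simp only [Pi.smul_apply]
    rw [smul_comm]

/-- The space `H^s(𝕋)`, a type of its own with the topology of the Sobolev norm below. -/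
def SobolevTorus (s : ℝ) : Type := sobolevTorusSubmodule s

instance (s : ℝ) : AddCommGroup (SobolevTorus s) :=
  inferInstanceAs (AddCommGroup (sobolevTorusSubmodule s))

instance (s : ℝ) : Module ℝ (SobolevTorus s) :=
  inferInstanceAs (Module ℝ (sobolevTorusSubmodule s))

/-- The Fourier coefficients of an element of `H^s(𝕋)`. -/
def SobolevTorus.coeff {s : ℝ} (f : SobolevTorus s) : ℤ → ℂ := f.1

/-- The map `f ↦ (⟨n⟩^s f̂(n))_n` from `H^s(𝕋)` to `ℓ²(ℤ)`. -/
def SobolevTorus.toL2 (s : ℝ) : SobolevTorus s →ₗ[ℝ] lp (fun _ : ℤ => ℂ) 2 where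
  toFun f := ⟨fun n => ((1 + (n : ℝ) ^ 2) ^ (s / 2)) • f.coeff n, f.2.2⟩
  map_add' f g := by
    apply Subtype.ext
    funext n
    exact smul_add ((1 + (n : ℝ) ^ 2) ^ (s / 2)) (f.coeff n) (g.coeff n)
  map_smul' c f := by
    apply Subtype.ext
    funext n
    exact smul_comm ((1 + (n : ℝ) ^ 2) ^ (s / 2)) c (f.coeff n)

theorem SobolevTorus.toL2_injective (s : ℝ) : Function.Injective (SobolevTorus.toL2 s) := by
  intro f g hfg
  apply Subtype.ext
  funext n
  have h : ((1 + (n : ℝ) ^ 2) ^ (s / 2)) • f.coeff n = ((1 + (n : ℝ) ^ 2) ^ (s / 2)) • g.coeff n :=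
    congrFun (congrArg Subtype.val hfg) n
  have hpos : ((1 + (n : ℝ) ^ 2) ^ (s / 2)) ≠ 0 := by positivity
  exact smul_right_injective ℂ hpos h

/-- `H^s(𝕋)` with the norm `‖f‖ = ‖⟨n⟩^s f̂(n)‖_{ℓ²}`, where `⟨n⟩ = (1 + n²)^(1/2)`. -/
instance (s : ℝ) : NormedAddCommGroup (SobolevTorus s) :=
  NormedAddCommGroup.induced (SobolevTorus s) (lp (fun _ : ℤ => ℂ) 2) (SobolevTorus.toL2 s)
    (SobolevTorus.toL2_injective s)

/-- `f ∈ H^s(𝕋)` is the distribution given by the `2π`-periodic function `g`. -/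
def SobolevTorus.Represents {s : ℝ} (f : SobolevTorus s) (g : ℝ → ℝ) : Prop :=
  ∀ n : ℤ, f.coeff n =
    (1 / (2 * Real.pi) : ℂ) * ∫ x in (0 : ℝ)..(2 * Real.pi),
      Complex.exp (-(Complex.I * n * x)) * (g x : ℂ)

/-! ### Smooth data and smooth solutions of the BBM equation -/

/-- `v` is smooth and all its derivatives are in `L²(μ)`. -/
def IsSmoothL2 (μ : Measure ℝ) (v : ℝ → ℝ) : Prop :=
  ContDiff ℝ ∞ v ∧ ∀ k : ℕ, MemLp (iteratedDeriv k v) 2 μ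

/-- `u = u(t, x)` satisfies `∂ₜu - ∂ₓₓₜu + ∂ₓu + ½ ∂ₓ(u²) = 0` at all `t ∈ [0,T]`, `x ∈ ℝ`, in the
classical sense (time derivatives are one-sided at `0` and `T`). -/
def SolvesBBM (T : ℝ) (u : ℝ → ℝ → ℝ) : Prop :=
  ∀ t ∈ Icc 0 T, ∀ x : ℝ, ∃ ut uxxt : ℝ,
    HasDerivWithinAt (fun τ => u τ x) ut (Icc 0 T) t ∧
    HasDerivWithinAt (fun τ => iteratedDeriv 2 (u τ) x) uxxt (Icc 0 T) t ∧
    ut - uxxt + deriv (u t) x + (1 / 2) * deriv (fun y => u t y ^ 2) x = 0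

/-- A smooth solution on `[0,T]`: `u(t)` is smooth in `x`, the map `t ↦ ∂ₓᵏ u(t)` is continuous
from `[0,T]` to `L²(μ)` for all `k`, and the BBM equation holds. -/
structure IsSmoothBBMSolution (μ : Measure ℝ) (T : ℝ) (u : ℝ → ℝ → ℝ) : Prop where
  smooth : ∀ t ∈ Icc 0 T, IsSmoothL2 μ (u t)
  continuous : ∀ k : ℕ, ∀ t₀ ∈ Icc 0 T,
    Tendsto (fun t => eLpNorm (fun x => iteratedDeriv k (u t) x - iteratedDeriv k (u t₀) x) 2 μ)
      (𝓝[Icc 0 T] t₀) (𝓝 0)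
  solves : SolvesBBM T u

/-- Smooth data on `ℝ`: the functions in `H^∞(ℝ)`. -/
def SmoothDatumLine (v : ℝ → ℝ) : Prop := IsSmoothL2 volume v

/-- Smooth data on `𝕋`: the functions in `C^∞(𝕋)`, as `2π`-periodic functions on `ℝ`. -/
def SmoothDatumTorus (v : ℝ → ℝ) : Prop :=
  Function.Periodic v (2 * Real.pi) ∧ IsSmoothL2 (volume.restrict (Ioc 0 (2 * Real.pi))) v

/-- Smooth solutions of the BBM equation on `[0,T] × ℝ`, in `C([0,T]; H^∞(ℝ))`. -/
def SmoothSolutionLine (T : ℝ) (u : ℝ → ℝ → ℝ) : Prop := IsSmoothBBMSolution volume T u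

/-- Smooth solutions of the BBM equation on `[0,T] × 𝕋`, as `2π`-periodic functions of `x ∈ ℝ`,
in `C([0,T]; C^∞(𝕋))`. -/
def SmoothSolutionTorus (T : ℝ) (u : ℝ → ℝ → ℝ) : Prop :=
  (∀ t ∈ Icc 0 T, Function.Periodic (u t) (2 * Real.pi)) ∧
    IsSmoothBBMSolution (volume.restrict (Ioc 0 (2 * Real.pi))) T u

/-- `Φ : H^s(ℝ) → C([0,T]; H^s(ℝ))` is a solution map of the BBM equation: it sends each smooth
datum to the smooth solution with that datum. Nothing is asked of its values at other data. -/
def IsSolutionMapLine {s T : ℝ} (Φ : SobolevLine s → C(Icc (0 : ℝ) T, SobolevLine s)) : Prop :=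
  ∀ u : ℝ → ℝ → ℝ, SmoothSolutionLine T u → ∀ f : SobolevLine s, f.Represents (u 0) →
    ∀ t : Icc (0 : ℝ) T, (Φ f t).Represents (u t)

/-- `Φ : H^s(𝕋) → C([0,T]; H^s(𝕋))` is a solution map of the BBM equation: it sends each smooth
datum to the smooth solution with that datum. Nothing is asked of its values at other data. -/
def IsSolutionMapTorus {s T : ℝ} (Φ : SobolevTorus s → C(Icc (0 : ℝ) T, SobolevTorus s)) : Prop :=
  ∀ u : ℝ → ℝ → ℝ, SmoothSolutionTorus T u → ∀ f : SobolevTorus s, f.Represents (u 0) →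
    ∀ t : Icc (0 : ℝ) T, (Φ f t).Represents (u t)

end

/-! The equation is `∂ₜu = P(u + u²/2)` with `P = -∂(1 - ∂²)⁻¹`. Since `P` is bounded on the bounded
continuous functions in `L²`, this is an ordinary differential equation with a locally Lipschitz
vector field. The `H¹` norm is conserved and controls the norm of that space, so solutions are
global, and since `P` gains a derivative they stay smooth (`exists_solution`). Classical smooth
solutions and solutions of the evolution equation are the same thing
(`isSmoothBBMSolution_of_hasDerivWithinAt`, `exists_hasDerivWithinAt_of_isSmoothBBMSolution`),
whence existence and uniqueness for smooth data, and a solution map which may be given the value `0`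
wherever no such solution exists.

Discontinuity comes from the interaction of two high frequencies that produces a low one. Take
oscillating `h n` that are bounded and tend to `0` in `H^s`, `s < 0`, while `(h n)²` has a
nontrivial weak limit. Near a given `f` choose a smooth `v`, and start from `v + κ h n`. At time `t
= A/κ²` the first Picard iterate contains `t P(κ² (h n)²/2)`, whose low frequencies have size `A`.
The terms of the iterate that are at most linear in `κ` contribute `O(A/κ)`, and the remainder of
the Picard expansion is `O(κ³t²) = O(A²/κ)`. Fixing `A` large, then `κ` large, then `n` large, the
datum is as close to `f` in `H^s` as desired, yet the solution is arbitrarily large in `H^s` at some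
time of `[0,T]` (`IsSolobevModel.exists_norm_gt` is the statement `IsSobolevModel.exists_norm_gt`
below). All these data are smooth, so every extension of the solution map is unbounded near every
point, hence continuous nowhere.

The argument is run once, for an abstract domain (`IsBBMDomain`) and an abstract negative Sobolev
space (`IsSobolevModel`). The circle uses `h n = cos((n+1)x) + cos((n+2)x)`, whose square always
contains `cos x`; the line uses a bump function times `cos(2πnx)`, whose square tends weakly to half
the square of the bump. -/

open scoped NNReal BoundedContinuousFunction

noncomputable section

namespace BBM

/-! ### The phase space: bounded continuous functions in `L²` -/

section

/-- A common description of the real line (`μ = volume`, `p = 0`) and of the circle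
(`μ = volume` on a period, `p = 2π`): functions are `p`-periodic functions on `ℝ`, and they are
integrated against `μ`. -/
class IsBBMDomain (μ : Measure ℝ) (p : ℝ) : Prop where
  restrict_le : volume.restrict (Ioc 0 1) ≤ μ
  le_volume : μ ≤ volume
  lintegral_shift : ∀ g : ℝ → ℝ≥0∞, Measurable g → Function.Periodic g p →
    ∀ z, ∫⁻ x, g (x - z) ∂μ = ∫⁻ x, g x ∂μ
  integral_deriv : ∀ f f' : ℝ → ℝ, (∀ x, HasDerivAt f (f' x) x) → Continuous f' →
    Function.Periodic f p → Integrable f μ → Integrable f' μ → ∫ x, f' x ∂μ = 0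

/-- The `p`-periodic bounded continuous functions in `L²(μ)`, as pairs of a bounded continuous
function and its class in `L²(μ)`. -/
def boundedL2Submodule (μ : Measure ℝ) (p : ℝ) : Submodule ℝ ((ℝ →ᵇ ℝ) × Lp ℝ 2 μ) where
  carrier := {a | Function.Periodic a.1 p ∧ a.2 =ᵐ[μ] a.1}
  add_mem' := by
    rintro a b ⟨ha, ha'⟩ ⟨hb, hb'⟩
    refine ⟨fun x => ?_, ?_⟩
    · simp [ha x, hb x]
    · filter_upwards [ha', hb', Lp.coeFn_add a.2 b.2] with x h1 h2 h3
      rw [Prod.snd_add, h3, Pi.add_apply, h1, h2]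
      rfl
  zero_mem' := ⟨fun x => rfl, Lp.coeFn_zero ℝ 2 μ⟩
  smul_mem' := by
    rintro c a ⟨ha, ha'⟩
    refine ⟨fun x => ?_, ?_⟩
    · simp [ha x]
    · filter_upwards [ha', Lp.coeFn_smul c a.2] with x h1 h3
      rw [Prod.smul_snd, h3, Pi.smul_apply, h1]
      rfl

/-- The Banach space of `p`-periodic bounded continuous functions in `L²(μ)`. -/
def BoundedL2 (μ : Measure ℝ) (p : ℝ) : Type := boundedL2Submodule μ p

instance (μ : Measure ℝ) (p : ℝ) : NormedAddCommGroup (BoundedL2 μ p) :=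
  inferInstanceAs (NormedAddCommGroup (boundedL2Submodule μ p))

instance (μ : Measure ℝ) (p : ℝ) : NormedSpace ℝ (BoundedL2 μ p) :=
  inferInstanceAs (NormedSpace ℝ (boundedL2Submodule μ p))

namespace BoundedL2

variable {μ : Measure ℝ} {p : ℝ}

/-- The function underlying an element of `BoundedL2 μ p`. -/
def toFun (a : BoundedL2 μ p) : ℝ → ℝ := a.1.1

instance : CoeFun (BoundedL2 μ p) (fun _ => ℝ → ℝ) := ⟨toFun⟩

/-- Uniform limits are pointwise limits and `L²` limits are almost everywhere limits along a
subsequence, so the two components of a limit still agree. The resulting completeness is what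
Picard–Lindelöf and Bochner integrals need. -/
theorem isClosed_submodule : IsClosed (boundedL2Submodule μ p : Set ((ℝ →ᵇ ℝ) × Lp ℝ 2 μ)) := by
  refine IsSeqClosed.isClosed fun a b ha hab => ?_
  have h1 : Tendsto (fun n => (a n).1) atTop (𝓝 b.1) := (continuous_fst.tendsto b).comp hab
  have h2 : Tendsto (fun n => (a n).2) atTop (𝓝 b.2) := (continuous_snd.tendsto b).comp hab
  have h3 : ∀ x, Tendsto (fun n => (a n).1 x) atTop (𝓝 (b.1 x)) := fun x =>
    ((BoundedContinuousFunction.evalCLM ℝ x).continuous.tendsto b.1).comp h1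
  refine ⟨fun x => ?_, ?_⟩
  · refine tendsto_nhds_unique (h3 (x + p)) ?_
    simpa only [(ha _).1 x] using h3 x
  · obtain ⟨ns, hns, h4⟩ :=
      (tendstoInMeasure_of_tendsto_Lp h2).exists_seq_tendsto_ae
    filter_upwards [h4, ae_all_iff.2 fun n => (ha n).2] with x h5 h6
    refine tendsto_nhds_unique h5 ?_
    have h7 := (h3 x).comp hns.tendsto_atTop
    simpa only [h6, Function.comp_def] using h7

instance : CompleteSpace (BoundedL2 μ p) :=
  isClosed_submodule (μ := μ) (p := p) |>.completeSpace_coe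

-- The `L²` class is determined by the continuous function, so identities in the phase space can be
-- checked pointwise.
@[ext]
theorem ext {a b : BoundedL2 μ p} (h : ∀ x, a x = b x) : a = b := by
  have h1 : a.1.1 = b.1.1 := BoundedContinuousFunction.ext h
  refine Subtype.ext (Prod.ext h1 (Lp.ext ?_))
  filter_upwards [a.2.2, b.2.2] with x h2 h3
  rw [h2, h3, h1]

theorem continuous (a : BoundedL2 μ p) : Continuous a := a.1.1.continuous

theorem periodic (a : BoundedL2 μ p) : Function.Periodic a p := a.2.1

theorem memLp (a : BoundedL2 μ p) : MemLp a 2 μ := (memLp_congr_ae a.2.2).1 (Lp.memLp a.1.2)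

theorem abs_apply_le (a : BoundedL2 μ p) (x : ℝ) : |a x| ≤ ‖a‖ :=
  (a.1.1.norm_coe_le_norm x).trans (norm_fst_le a.1)

theorem norm_snd_eq (a : BoundedL2 μ p) : ‖a.1.2‖ = (eLpNorm a 2 μ).toReal := by
  rw [Lp.norm_def, eLpNorm_congr_ae a.2.2]
  rfl

theorem eLpNorm_le (a : BoundedL2 μ p) : eLpNorm a 2 μ ≤ ENNReal.ofReal ‖a‖ := by
  rw [← ENNReal.ofReal_toReal a.memLp.2.ne, ← norm_snd_eq]
  exact ENNReal.ofReal_le_ofReal (norm_snd_le a.1)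

theorem norm_le {a : BoundedL2 μ p} {C : ℝ} (hC : 0 ≤ C) (h1 : ∀ x, |a x| ≤ C)
    (h2 : eLpNorm a 2 μ ≤ ENNReal.ofReal C) : ‖a‖ ≤ C := by
  refine max_le ((BoundedContinuousFunction.norm_le hC).2 h1) ?_
  change ‖a.1.2‖ ≤ C
  rw [norm_snd_eq]
  exact ENNReal.toReal_le_of_le_ofReal hC h2

/-- The element of `BoundedL2 μ p` given by a function. -/
def mk (f : ℝ → ℝ) (hc : Continuous f) (C : ℝ) (hb : ∀ x, |f x| ≤ C) (hp : Function.Periodic f p)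
    (hf : MemLp f 2 μ) : BoundedL2 μ p :=
  ⟨(BoundedContinuousFunction.ofNormedAddCommGroup f hc C hb, hf.toLp f), hp, hf.coeFn_toLp⟩

@[simp] theorem add_apply (a b : BoundedL2 μ p) (x : ℝ) : (a + b) x = a x + b x := rfl
@[simp] theorem sub_apply (a b : BoundedL2 μ p) (x : ℝ) : (a - b) x = a x - b x := rfl
@[simp] theorem neg_apply (a : BoundedL2 μ p) (x : ℝ) : (-a) x = -a x := rfl
@[simp] theorem smul_apply (c : ℝ) (a : BoundedL2 μ p) (x : ℝ) : (c • a) x = c * a x := rfl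
@[simp] theorem zero_apply (x : ℝ) : (0 : BoundedL2 μ p) x = 0 := rfl

/-- Evaluation at a point. -/
def evalCLM (x : ℝ) : BoundedL2 μ p →L[ℝ] ℝ :=
  LinearMap.mkContinuous
    { toFun := fun a : BoundedL2 μ p => a x, map_add' := fun _ _ => rfl,
      map_smul' := fun _ _ => rfl } 1
    fun a => (a.abs_apply_le x).trans_eq (one_mul _).symm

@[simp] theorem evalCLM_apply (x : ℝ) (a : BoundedL2 μ p) : evalCLM x a = a x := rfl

/-- The class in `L²(μ)`. -/
def toLpCLM : BoundedL2 μ p →L[ℝ] Lp ℝ 2 μ :=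
  LinearMap.mkContinuous
    { toFun := fun a : BoundedL2 μ p => a.1.2, map_add' := fun _ _ => rfl,
      map_smul' := fun _ _ => rfl } 1 fun a => (norm_snd_le a.1).trans_eq (one_mul _).symm

theorem coeFn_toLpCLM (a : BoundedL2 μ p) : toLpCLM a =ᵐ[μ] a := a.2.2

theorem norm_toLpCLM (a : BoundedL2 μ p) : ‖toLpCLM a‖ = (eLpNorm a 2 μ).toReal := a.norm_snd_eq

theorem norm_toLpCLM_le (a : BoundedL2 μ p) : ‖toLpCLM a‖ ≤ ‖a‖ := norm_snd_le a.1

theorem inner_toLpCLM (a b : BoundedL2 μ p) :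
    inner ℝ (toLpCLM a) (toLpCLM b) = ∫ x, a x * b x ∂μ := by
  rw [L2.inner_def]
  refine integral_congr_ae ?_
  filter_upwards [coeFn_toLpCLM a, coeFn_toLpCLM b] with x h1 h2
  rw [h1, h2]
  simp [mul_comm]

theorem integrable_mul (a b : BoundedL2 μ p) : Integrable (fun x => a x * b x) μ :=
  MemLp.integrable_mul a.memLp b.memLp

/-- The pointwise product. -/
def mulFun (a b : BoundedL2 μ p) : BoundedL2 μ p :=
  mk (fun x => a x * b x) (a.continuous.mul b.continuous) (‖a‖ * ‖b‖)
    (fun x => by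
      rw [abs_mul]
      exact mul_le_mul (a.abs_apply_le x) (b.abs_apply_le x) (abs_nonneg _) (norm_nonneg _))
    (fun x => by simp only [a.periodic x, b.periodic x])
    (b.memLp.of_le_mul (c := ‖a‖) (a.continuous.mul b.continuous).aestronglyMeasurable
      (ae_of_all _ fun x => by
        rw [norm_mul]
        exact mul_le_mul_of_nonneg_right (a.abs_apply_le x) (norm_nonneg _)))

theorem norm_mulFun_le (a b : BoundedL2 μ p) : ‖mulFun a b‖ ≤ ‖a‖ * ‖b‖ := by
  refine norm_le (by positivity) (fun x => ?_) ?_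
  · change |a x * b x| ≤ _
    rw [abs_mul]
    exact mul_le_mul (a.abs_apply_le x) (b.abs_apply_le x) (abs_nonneg _) (norm_nonneg _)
  · have h := eLpNorm_le_mul_eLpNorm_of_ae_le_mul (μ := μ) (f := mulFun a b) (g := b) (c := ‖a‖)
      (ae_of_all _ fun x => by
        change ‖a x * b x‖ ≤ _
        rw [norm_mul]
        exact mul_le_mul_of_nonneg_right (a.abs_apply_le x) (norm_nonneg _)) 2
    refine h.trans ?_
    rw [ENNReal.ofReal_mul (norm_nonneg _)]
    gcongr
    exact b.eLpNorm_le

/-- The pointwise product, as a bounded bilinear map. -/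
def mulL : BoundedL2 μ p →L[ℝ] BoundedL2 μ p →L[ℝ] BoundedL2 μ p :=
  LinearMap.mkContinuous₂
    (LinearMap.mk₂ ℝ mulFun
      (fun a b c => by ext x; change (a x + b x) * c x = a x * c x + b x * c x; ring)
      (fun r a b => by ext x; change (r * a x) * b x = r * (a x * b x); ring)
      (fun a b c => by ext x; change a x * (b x + c x) = a x * b x + a x * c x; ring)
      (fun r a b => by ext x; change a x * (r * b x) = r * (a x * b x); ring)) 1
    (fun a b => by simpa using norm_mulFun_le a b)

@[simp] theorem mulL_apply (a b : BoundedL2 μ p) (x : ℝ) : mulL a b x = a x * b x := rfl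

theorem norm_mulL_le (a b : BoundedL2 μ p) : ‖mulL a b‖ ≤ ‖a‖ * ‖b‖ := norm_mulFun_le a b

end BoundedL2

end

section

theorem IsBBMDomain.sigmaFinite {μ : Measure ℝ} {p : ℝ} (h : IsBBMDomain μ p) : SigmaFinite μ :=
  Measure.sigmaFinite_of_le volume h.le_volume

/-! ### Averages over translates -/

section Average

variable (ν : Measure ℝ) [IsProbabilityMeasure ν] {f : ℝ → ℝ} {C : ℝ}

theorem integrable_translate (hc : Continuous f) (hb : ∀ x, |f x| ≤ C) (x : ℝ) :
    Integrable (fun z => f (x - z)) ν :=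
  Integrable.of_bound (by fun_prop) C (ae_of_all _ fun z => hb (x - z))

theorem continuous_average (hc : Continuous f) (hb : ∀ x, |f x| ≤ C) :
    Continuous fun x => ∫ z, f (x - z) ∂ν :=
  continuous_of_dominated (bound := fun _ => C) (fun x => by fun_prop)
    (fun x => ae_of_all _ fun z => hb (x - z)) (integrable_const C)
    (ae_of_all _ fun z => by fun_prop)

theorem abs_average_le (hb : ∀ x, |f x| ≤ C) (x : ℝ) : |∫ z, f (x - z) ∂ν| ≤ C := by
  have h := norm_integral_le_of_norm_le_const (μ := ν) (f := fun z => f (x - z)) (C := C)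
    (ae_of_all _ fun z => hb (x - z))
  simpa using h

/-- Jensen's inequality, in the form `L¹ ≤ L²` for a probability measure. -/
theorem enorm_average_sq_le (hc : Continuous f) (x : ℝ) :
    ‖∫ z, f (x - z) ∂ν‖ₑ ^ 2 ≤ ∫⁻ z, ‖f (x - z)‖ₑ ^ 2 ∂ν := by
  have h1 : ‖∫ z, f (x - z) ∂ν‖ₑ ≤ eLpNorm (fun z => f (x - z)) 2 ν := by
    refine (enorm_integral_le_lintegral_enorm _).trans ?_
    rw [← eLpNorm_one_eq_lintegral_enorm]
    exact eLpNorm_le_eLpNorm_of_exponent_le (by norm_num) (by fun_prop)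
  calc _ ≤ eLpNorm (fun z => f (x - z)) 2 ν ^ 2 := by gcongr
    _ = _ := by
      have := eLpNorm_nnreal_pow_eq_lintegral (μ := ν) (f := fun z => f (x - z)) (p := 2) (by simp)
      simpa using this

/-- Jensen at each point, then Tonelli, then translation invariance of the integral of a periodic
function. -/
theorem eLpNorm_average_le {μ : Measure ℝ} {p : ℝ} [hμ : IsBBMDomain μ p] (hc : Continuous f)
    (hp : Function.Periodic f p) :
    eLpNorm (fun x => ∫ z, f (x - z) ∂ν) 2 μ ≤ eLpNorm f 2 μ := by
  have := hμ.sigmaFinite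
  rw [← ENNReal.pow_le_pow_left_iff (n := 2) (by norm_num)]
  have h1 := eLpNorm_nnreal_pow_eq_lintegral (μ := μ) (f := fun x => ∫ z, f (x - z) ∂ν) (p := 2)
    (by simp)
  have h2 := eLpNorm_nnreal_pow_eq_lintegral (μ := μ) (f := f) (p := 2) (by simp)
  simp only [ENNReal.coe_ofNat, NNReal.coe_ofNat, ENNReal.rpow_ofNat] at h1 h2
  rw [h1, h2]
  calc _ ≤ ∫⁻ x, ∫⁻ z, ‖f (x - z)‖ₑ ^ 2 ∂ν ∂μ := lintegral_mono fun x => enorm_average_sq_le ν hc x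
    _ = ∫⁻ z, ∫⁻ x, ‖f (x - z)‖ₑ ^ 2 ∂μ ∂ν :=
      lintegral_lintegral_swap (by
        have := hc.measurable
        exact Measurable.aemeasurable (by fun_prop))
    _ = ∫⁻ z, ∫⁻ x, ‖f x‖ₑ ^ 2 ∂μ ∂ν := lintegral_congr fun z =>
      hμ.lintegral_shift (fun x => ‖f x‖ₑ ^ 2) (by fun_prop) (fun x => by simp only [hp x]) z
    _ = _ := by simp

variable {μ : Measure ℝ} {p : ℝ} [hμ : IsBBMDomain μ p]

/-- The average of the translates of a function with respect to a probability measure. -/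
def averageFun (a : BoundedL2 μ p) : BoundedL2 μ p :=
  BoundedL2.mk (fun x => ∫ z, a (x - z) ∂ν) (continuous_average ν a.continuous a.abs_apply_le) ‖a‖
    (abs_average_le ν a.abs_apply_le)
    (fun x => by
      refine integral_congr_ae (ae_of_all _ fun z => ?_)
      change a (x + p - z) = a (x - z)
      rw [add_sub_right_comm, a.periodic])
    ⟨(continuous_average ν a.continuous a.abs_apply_le).aestronglyMeasurable,
      (eLpNorm_average_le ν a.continuous a.periodic).trans_lt a.memLp.2⟩

/-- `averageFun` as a bounded operator. -/
def averageL : BoundedL2 μ p →L[ℝ] BoundedL2 μ p :=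
  LinearMap.mkContinuous
    { toFun := averageFun ν
      map_add' := fun a b => by
        ext x
        exact integral_add (integrable_translate ν a.continuous a.abs_apply_le x)
          (integrable_translate ν b.continuous b.abs_apply_le x)
      map_smul' := fun c a => by
        ext x
        exact integral_const_mul c _ } 1
    fun a => by
      rw [one_mul]
      exact BoundedL2.norm_le (norm_nonneg _) (abs_average_le ν a.abs_apply_le)
        ((eLpNorm_average_le ν a.continuous a.periodic).trans a.eLpNorm_le)

theorem norm_averageL_le (a : BoundedL2 μ p) : ‖averageL ν a‖ ≤ ‖a‖ :=
  BoundedL2.norm_le (norm_nonneg _) (abs_average_le ν a.abs_apply_le)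
    ((eLpNorm_average_le ν a.continuous a.periodic).trans a.eLpNorm_le)

end Average

/-! ### Derivatives -/

variable {μ : Measure ℝ} {p : ℝ}

/-- `b` is the derivative of `a`. -/
def IsDeriv (a b : BoundedL2 μ p) : Prop := ∀ x, HasDerivAt a (b x) x

namespace IsDeriv

variable {a b c d : BoundedL2 μ p}

theorem add (h : IsDeriv a b) (h' : IsDeriv c d) : IsDeriv (a + c) (b + d) :=
  fun x => (h x).add (h' x)

theorem sub (h : IsDeriv a b) (h' : IsDeriv c d) : IsDeriv (a - c) (b - d) :=
  fun x => (h x).sub (h' x)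

theorem smul (r : ℝ) (h : IsDeriv a b) : IsDeriv (r • a) (r • b) :=
  fun x => (h x).const_mul r

theorem mul (h : IsDeriv a b) (h' : IsDeriv c d) :
    IsDeriv (BoundedL2.mulL a c) (BoundedL2.mulL b c + BoundedL2.mulL a d) :=
  fun x => (h x).mul (h' x)

theorem unique (h : IsDeriv a b) (h' : IsDeriv a c) : b = c := by
  ext x
  exact (h x).unique (h' x)

theorem average [IsBBMDomain μ p] (ν : Measure ℝ) [IsProbabilityMeasure ν] (h : IsDeriv a b) :
    IsDeriv (averageL ν a) (averageL ν b) := fun x => by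
  have ha := a.continuous
  have hb := b.continuous
  refine (hasDerivAt_integral_of_dominated_loc_of_deriv_le (bound := fun _ => ‖b‖)
    (F' := fun x z => b (x - z)) univ_mem (Eventually.of_forall fun y => ?_)
    (integrable_translate ν a.continuous a.abs_apply_le x) ?_
    (ae_of_all _ fun z y _ => b.abs_apply_le _) (integrable_const _)
    (ae_of_all _ fun z y _ => ?_)).2
  · fun_prop
  · fun_prop
  · exact (h (y - z)).comp_sub_const y z

/-- Integration by parts. -/
theorem integral_add_eq_zero [hμ : IsBBMDomain μ p] (h : IsDeriv a b) (h' : IsDeriv c d) :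
    inner ℝ (BoundedL2.toLpCLM b) (BoundedL2.toLpCLM c)
      + inner ℝ (BoundedL2.toLpCLM a) (BoundedL2.toLpCLM d) = 0 := by
  rw [BoundedL2.inner_toLpCLM, BoundedL2.inner_toLpCLM,
    ← integral_add (b.integrable_mul c) (a.integrable_mul d)]
  have ha := a.continuous
  have hb := b.continuous
  have hc := c.continuous
  have hd := d.continuous
  exact hμ.integral_deriv (fun x => a x * c x) _ (fun x => (h x).mul (h' x)) (by fun_prop)
    (fun x => by simp only [a.periodic x, c.periodic x]) (a.integrable_mul c)
    ((b.integrable_mul c).add (a.integrable_mul d))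

end IsDeriv

/-- The Sobolev inequality in dimension one. -/
theorem sq_le_integral_sq_add [hμ : IsBBMDomain μ p] {f f' : ℝ → ℝ}
    (hf : ∀ x, HasDerivAt f (f' x) x) (hf' : Continuous f') (hp : Function.Periodic f p)
    (hp' : Function.Periodic f' p) (hL : MemLp f 2 μ) (hL' : MemLp f' 2 μ) (x : ℝ) :
    f x ^ 2 ≤ 2 * ∫ y, f y ^ 2 ∂μ + ∫ y, f' y ^ 2 ∂μ := by
  have hc : Continuous f := continuous_iff_continuousAt.2 fun y => (hf y).continuousAt
  set g : ℝ → ℝ := fun y => 2 * f y ^ 2 + f' y ^ 2 with hg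
  have hgi : Integrable g μ := (hL.integrable_sq.const_mul 2).add hL'.integrable_sq
  have hgc : Continuous g := by fun_prop
  have hg0 : ∀ y, 0 ≤ g y := fun y => by positivity
  have h1 : f x ^ 2 ≤ ∫ y in (0 : ℝ)..1, g (x + y) := by
    -- The weight `1 - y` is `1` at `0` and `0` at `1`, so integrating this derivative over the unit
    -- interval leaves only `-f(x)²`; the mixed term is then absorbed by `2|f f'| ≤ f² + f'²`.
    have h2 : ∀ y, HasDerivAt (fun y => (1 - y) * f (x + y) ^ 2)
        (-f (x + y) ^ 2 + (1 - y) * (2 * f (x + y) * f' (x + y))) y := fun y => by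
      have h3 := (hf (x + y)).comp_const_add x y
      refine (((hasDerivAt_id y).const_sub 1).mul (h3.pow 2)).congr_deriv ?_
      simp
    have h3 := intervalIntegral.integral_eq_sub_of_hasDerivAt (a := 0) (b := 1)
      (fun y _ => h2 y) (Continuous.intervalIntegrable (by fun_prop) _ _)
    have h4 : f x ^ 2 = ∫ y in (0 : ℝ)..1,
        -(-f (x + y) ^ 2 + (1 - y) * (2 * f (x + y) * f' (x + y))) := by
      rw [intervalIntegral.integral_neg, h3]
      simp
    rw [h4]
    refine intervalIntegral.integral_mono_on (by norm_num)
      (Continuous.intervalIntegrable (by fun_prop) _ _)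
      (Continuous.intervalIntegrable (by fun_prop) _ _) fun y hy => ?_
    have h5 : 0 ≤ 1 - y := by linarith [hy.2]
    have h6 : 1 - y ≤ 1 := by linarith [hy.1]
    simp only [hg]
    nlinarith [sq_nonneg (f (x + y) + f' (x + y)), sq_nonneg (f (x + y)), sq_nonneg (f' (x + y)),
      mul_nonneg h5 (sq_nonneg (f (x + y) + f' (x + y))),
      mul_nonneg hy.1 (sq_nonneg (f (x + y))), mul_nonneg hy.1 (sq_nonneg (f' (x + y)))]
  have h2 : ∫ y in (0 : ℝ)..1, g (x + y) ≤ ∫ y, g y ∂μ := by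
    have hi : Integrable (fun y => g (x + y)) (volume.restrict (Ioc 0 1)) := by
      have : IntervalIntegrable (fun y => g (x + y)) volume 0 1 :=
        Continuous.intervalIntegrable (by fun_prop) _ _
      exact this.1
    rw [intervalIntegral.integral_of_le (by norm_num),
      ← ENNReal.ofReal_le_ofReal_iff (integral_nonneg hg0),
      ofReal_integral_eq_lintegral_ofReal hi (ae_of_all _ fun y => hg0 _),
      ofReal_integral_eq_lintegral_ofReal hgi (ae_of_all _ hg0)]
    -- The unit interval fits inside the domain of integration, and a shift by `x` does not change
    -- the integral over that domain.
    refine (lintegral_mono' hμ.restrict_le le_rfl).trans_eq ?_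
    rw [← hμ.lintegral_shift (fun y => ENNReal.ofReal (g y)) (by fun_prop)
      (fun y => by simp only [hg, hp y, hp' y]) (-x)]
    simp only [sub_neg_eq_add, add_comm]
  refine (h1.trans h2).trans_eq ?_
  rw [← integral_const_mul, ← integral_add (hL.integrable_sq.const_mul 2) hL'.integrable_sq]

/-- The `H¹` norm controls the norm of the phase space. This turns the conserved energy into an a
priori bound, and `L²` continuity of all derivatives into continuity in the phase space. -/
theorem IsDeriv.norm_sq_le [IsBBMDomain μ p] {a b : BoundedL2 μ p} (h : IsDeriv a b) :
    ‖a‖ ^ 2 ≤ 2 * (‖BoundedL2.toLpCLM a‖ ^ 2 + ‖BoundedL2.toLpCLM b‖ ^ 2) := by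
  set E := 2 * (‖BoundedL2.toLpCLM a‖ ^ 2 + ‖BoundedL2.toLpCLM b‖ ^ 2) with hE
  have hE0 : 0 ≤ E := by positivity
  suffices ‖a‖ ≤ √E by
    rw [← Real.sq_sqrt hE0]
    gcongr
  refine BoundedL2.norm_le (Real.sqrt_nonneg _) (fun x => ?_) ?_
  · refine Real.abs_le_sqrt ((sq_le_integral_sq_add h b.continuous a.periodic b.periodic
      a.memLp b.memLp x).trans ?_)
    rw [hE, ← real_inner_self_eq_norm_sq, ← real_inner_self_eq_norm_sq, BoundedL2.inner_toLpCLM,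
      BoundedL2.inner_toLpCLM]
    have : 0 ≤ ∫ y, b y * b y ∂μ := integral_nonneg fun y => mul_self_nonneg _
    simp only [sq]
    linarith
  · rw [← ENNReal.ofReal_toReal a.memLp.2.ne, ← BoundedL2.norm_toLpCLM]
    refine ENNReal.ofReal_le_ofReal (Real.le_sqrt_of_sq_le ?_)
    rw [hE]
    nlinarith [sq_nonneg ‖BoundedL2.toLpCLM a‖, sq_nonneg ‖BoundedL2.toLpCLM b‖]

end

section

/-! ### The nonlinearity -/

section Flux

variable {μ : Measure ℝ} {p : ℝ}

/-- The polynomial `a + a² / 2`. -/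
def flux (a : BoundedL2 μ p) : BoundedL2 μ p := a + (2⁻¹ : ℝ) • BoundedL2.mulL a a

theorem flux_apply (a : BoundedL2 μ p) (x : ℝ) : flux a x = a x + 2⁻¹ * (a x * a x) := rfl

theorem continuous_flux : Continuous (flux : BoundedL2 μ p → BoundedL2 μ p) := by
  unfold flux
  fun_prop

theorem norm_flux_le (a : BoundedL2 μ p) : ‖flux a‖ ≤ ‖a‖ + ‖a‖ ^ 2 / 2 := by
  refine (norm_add_le _ _).trans ?_
  rw [norm_smul]
  have := BoundedL2.norm_mulL_le a a
  norm_num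
  linarith

theorem norm_flux_sub_le (a b : BoundedL2 μ p) :
    ‖flux a - flux b‖ ≤ (1 + (‖a‖ + ‖b‖) / 2) * ‖a - b‖ := by
  have h : flux a - flux b = (a - b) + (2⁻¹ : ℝ) • (BoundedL2.mulL (a + b) (a - b)) := by
    ext x
    simp only [flux_apply, BoundedL2.sub_apply, BoundedL2.add_apply, BoundedL2.smul_apply,
      BoundedL2.mulL_apply]
    ring
  rw [h]
  refine (norm_add_le _ _).trans ?_
  have h1 := BoundedL2.norm_mulL_le (a + b) (a - b)
  have h2 : ‖a + b‖ * ‖a - b‖ ≤ (‖a‖ + ‖b‖) * ‖a - b‖ := by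
    gcongr
    exact norm_add_le a b
  rw [norm_smul, Real.norm_of_nonneg (by norm_num)]
  linarith

end Flux

/-! ### The exponential averages and the operators `(1 - ∂²)⁻¹` and `-∂ (1 - ∂²)⁻¹` -/

/-- The exponential distribution on `(0, ∞)`. -/
def expRight : Measure ℝ :=
  (volume.restrict (Ioi 0)).withDensity fun z => ((Real.exp (-z)).toNNReal : ℝ≥0∞)

/-- The exponential distribution on `(-∞, 0)`. -/
def expLeft : Measure ℝ := expRight.map (fun z => -z)

instance : IsProbabilityMeasure expRight := by
  refine ⟨?_⟩
  rw [expRight, withDensity_apply _ MeasurableSet.univ, Measure.restrict_univ]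
  have h := ofReal_integral_eq_lintegral_ofReal (integrableOn_exp_neg_Ioi 0)
    (ae_of_all _ fun z => (Real.exp_pos (-z)).le)
  rw [integral_exp_neg_Ioi_zero, ENNReal.ofReal_one] at h
  exact h.symm

instance : IsProbabilityMeasure expLeft :=
  Measure.isProbabilityMeasure_map (by fun_prop)

variable {f : ℝ → ℝ} {C : ℝ}

/-- In this form the dependence on `x` sits in a factor and in an endpoint, so the fundamental
theorem of calculus applies and `f` need only be continuous. -/
theorem integral_expRight (f : ℝ → ℝ) (x : ℝ) :
    ∫ z, f (x - z) ∂expRight = Real.exp (-x) * ∫ y in Iic x, Real.exp y * f y := by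
  have h := integral_sub_left_eq_self
    ((Iio x).indicator fun y => Real.exp (-x) * (Real.exp y * f y)) volume x
  rw [integral_indicator measurableSet_Iio, ← integral_Iic_eq_integral_Iio,
    integral_const_mul] at h
  rw [expRight, integral_withDensity_eq_integral_smul (by fun_prop), ← integral_indicator
    measurableSet_Ioi, ← h]
  congr 1
  ext z
  by_cases hz : 0 < z
  · rw [indicator_of_mem (by exact hz), indicator_of_mem (by simpa using hz), ← mul_assoc,
      ← Real.exp_add, NNReal.smul_def, Real.coe_toNNReal _ (Real.exp_pos _).le, smul_eq_mul]
    congr 2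
    ring
  · rw [indicator_of_notMem (by exact hz), indicator_of_notMem (by simpa using hz)]

theorem hasDerivAt_integral_expRight (hc : Continuous f) (hb : ∀ x, |f x| ≤ C) (x : ℝ) :
    HasDerivAt (fun x => ∫ z, f (x - z) ∂expRight) (f x - ∫ z, f (x - z) ∂expRight) x := by
  have hi : ∀ x, IntegrableOn (fun y => Real.exp y * f y) (Iic x) := fun x =>
    (integrableOn_exp_Iic x).mul_bdd (c := C) (by fun_prop) (ae_of_all _ fun y => hb y)
  have h1 : ∀ x, ∫ y in Iic x, Real.exp y * f y
      = (∫ y in Iic 0, Real.exp y * f y) + ∫ y in (0 : ℝ)..x, Real.exp y * f y := fun x => by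
    rw [← intervalIntegral.integral_Iic_sub_Iic (hi 0) (hi x)]
    ring
  have h2 : HasDerivAt (fun x => (∫ y in Iic 0, Real.exp y * f y)
      + ∫ y in (0 : ℝ)..x, Real.exp y * f y) (Real.exp x * f x) x :=
    ((show Continuous fun y => Real.exp y * f y by fun_prop).integral_hasStrictDerivAt
      0 x).hasDerivAt.const_add _
  have h3 : (fun x => ∫ z, f (x - z) ∂expRight) = fun x => Real.exp (-x) *
      ((∫ y in Iic 0, Real.exp y * f y) + ∫ y in (0 : ℝ)..x, Real.exp y * f y) :=
    funext fun x => by rw [integral_expRight, h1]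
  rw [h3, integral_expRight, h1 x]
  refine ((hasDerivAt_neg x).exp.mul h2).congr_deriv ?_
  rw [← mul_assoc, ← Real.exp_add]
  simp
  ring

/-- Reflection reduces the left average to the right one. -/
theorem integral_expLeft (hc : Continuous f) (x : ℝ) :
    ∫ z, f (x - z) ∂expLeft = ∫ z, f (-(-x - z)) ∂expRight := by
  rw [expLeft, integral_map (by fun_prop) (by fun_prop)]
  congr 1
  ext z
  congr 1
  ring

theorem hasDerivAt_integral_expLeft (hc : Continuous f) (hb : ∀ x, |f x| ≤ C) (x : ℝ) :
    HasDerivAt (fun x => ∫ z, f (x - z) ∂expLeft) (∫ z, f (x - z) ∂expLeft - f x) x := by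
  simp only [integral_expLeft hc]
  have h := hasDerivAt_integral_expRight (f := fun y => f (-y)) (by fun_prop)
    (fun y => hb (-y)) (-x)
  refine (h.comp x (hasDerivAt_neg x)).congr_deriv ?_
  simp

variable {μ : Measure ℝ} {p : ℝ} [IsBBMDomain μ p]

/-- The operator `(1 - ∂²)⁻¹`. -/
def resolventL : BoundedL2 μ p →L[ℝ] BoundedL2 μ p :=
  (2⁻¹ : ℝ) • (averageL expRight + averageL expLeft)

/-- The operator `-∂ (1 - ∂²)⁻¹`. -/
def dispersionL : BoundedL2 μ p →L[ℝ] BoundedL2 μ p :=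
  (2⁻¹ : ℝ) • (averageL expRight - averageL expLeft)

theorem resolventL_apply (a : BoundedL2 μ p) :
    resolventL a = (2⁻¹ : ℝ) • (averageL expRight a + averageL expLeft a) := rfl

theorem dispersionL_apply (a : BoundedL2 μ p) :
    dispersionL a = (2⁻¹ : ℝ) • (averageL expRight a - averageL expLeft a) := rfl

theorem norm_dispersionL_le (a : BoundedL2 μ p) : ‖dispersionL a‖ ≤ ‖a‖ := by
  rw [dispersionL_apply, norm_smul]
  have h := norm_sub_le (averageL expRight a) (averageL expLeft a)
  have h1 := norm_averageL_le expRight a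
  have h2 := norm_averageL_le expLeft a
  norm_num
  linarith

/-- The right average inverts `1 + ∂` and the left one inverts `1 - ∂`. By partial fractions their
half sum is `(1 - ∂²)⁻¹` and their half difference is `-∂(1 - ∂²)⁻¹`. -/
theorem isDeriv_average_expRight (a : BoundedL2 μ p) :
    IsDeriv (averageL expRight a) (a - averageL expRight a) :=
  hasDerivAt_integral_expRight a.continuous a.abs_apply_le

theorem isDeriv_average_expLeft (a : BoundedL2 μ p) :
    IsDeriv (averageL expLeft a) (averageL expLeft a - a) :=
  hasDerivAt_integral_expLeft a.continuous a.abs_apply_le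

theorem isDeriv_resolventL (a : BoundedL2 μ p) : IsDeriv (resolventL a) (-dispersionL a) := by
  have h := ((isDeriv_average_expRight a).add (isDeriv_average_expLeft a)).smul 2⁻¹
  have h' : -dispersionL a = (2⁻¹ : ℝ) • (a - averageL expRight a + (averageL expLeft a - a)) := by
    rw [dispersionL_apply]
    module
  rw [h']
  exact h

theorem isDeriv_dispersionL (a : BoundedL2 μ p) : IsDeriv (dispersionL a) (a - resolventL a) := by
  have h := ((isDeriv_average_expRight a).sub (isDeriv_average_expLeft a)).smul 2⁻¹
  have h' : a - resolventL a
      = (2⁻¹ : ℝ) • (a - averageL expRight a - (averageL expLeft a - a)) := by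
    rw [resolventL_apply]
    module
  rw [h']
  exact h

namespace IsDeriv

variable {a b c : BoundedL2 μ p}

theorem resolvent (h : IsDeriv a b) : IsDeriv (resolventL a) (resolventL b) :=
  ((h.average expRight).add (h.average expLeft)).smul 2⁻¹

theorem dispersion (h : IsDeriv a b) : IsDeriv (dispersionL a) (dispersionL b) :=
  ((h.average expRight).sub (h.average expLeft)).smul 2⁻¹

/-- Averages commute with `∂`, so both sides are the derivative of `resolventL a`. -/
theorem resolventL_eq (h : IsDeriv a b) : resolventL b = -dispersionL a :=
  h.resolvent.unique (isDeriv_resolventL a)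

theorem dispersionL_eq (h : IsDeriv a b) : dispersionL b = a - resolventL a :=
  h.dispersion.unique (isDeriv_dispersionL a)

/-- `(1 - ∂²)⁻¹` is the inverse of `1 - ∂²`. -/
theorem resolventL_sub (h : IsDeriv a b) (h' : IsDeriv b c) : resolventL (a - c) = a := by
  rw [map_sub, h'.resolventL_eq, h.dispersionL_eq]
  abel

end IsDeriv

/-! ### The vector field -/

/-- The vector field of the BBM equation, `∂ₜ u = bbmField u`. -/
def bbmField (a : BoundedL2 μ p) : BoundedL2 μ p := dispersionL (flux a)

theorem continuous_bbmField : Continuous (bbmField : BoundedL2 μ p → BoundedL2 μ p) :=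
  dispersionL.continuous.comp continuous_flux

theorem norm_bbmField_le (a : BoundedL2 μ p) : ‖bbmField a‖ ≤ ‖a‖ + ‖a‖ ^ 2 / 2 :=
  (norm_dispersionL_le _).trans (norm_flux_le a)

/-- There is no loss of derivatives: the equation is an ordinary differential equation whose
Lipschitz constant grows linearly with the norm. -/
theorem norm_bbmField_sub_le (a b : BoundedL2 μ p) :
    ‖bbmField a - bbmField b‖ ≤ (1 + (‖a‖ + ‖b‖) / 2) * ‖a - b‖ := by
  rw [bbmField, bbmField, ← map_sub]
  exact (norm_dispersionL_le _).trans (norm_flux_sub_le a b)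

end

section

variable {μ : Measure ℝ} {p : ℝ}

/-! ### Integrals of curves and derivatives -/

/-- The functional `a ↦ ∫ₓʸ a`. -/
def intervalIntegralCLM (x y : ℝ) : BoundedL2 μ p →L[ℝ] ℝ :=
  LinearMap.mkContinuous
    { toFun := fun a : BoundedL2 μ p => ∫ z in x..y, a z
      map_add' := fun a b => intervalIntegral.integral_add
        (a.continuous.intervalIntegrable _ _) (b.continuous.intervalIntegrable _ _)
      map_smul' := fun c a => intervalIntegral.integral_const_mul c a } |y - x|
    fun a => by
      rw [mul_comm]
      exact intervalIntegral.norm_integral_le_of_norm_le_const fun z _ => a.abs_apply_le z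

theorem intervalIntegralCLM_apply (x y : ℝ) (a : BoundedL2 μ p) :
    intervalIntegralCLM x y a = ∫ z in x..y, a z := rfl

/-- Being a derivative is expressed through bounded functionals, which commute with Bochner
integrals in time. -/
theorem isDeriv_iff {a b : BoundedL2 μ p} :
    IsDeriv a b ↔
      ∀ x y, BoundedL2.evalCLM y a - BoundedL2.evalCLM x a = intervalIntegralCLM x y b := by
  refine ⟨fun h x y => ?_, fun h x => ?_⟩
  · exact (intervalIntegral.integral_eq_sub_of_hasDerivAt (fun z _ => h z)
      (b.continuous.intervalIntegrable _ _)).symm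
  · have h1 := ((b.continuous).integral_hasStrictDerivAt 0 x).hasDerivAt.const_add (a 0)
    have h2 : (fun y => a 0 + ∫ z in (0 : ℝ)..y, b z) = a := by
      ext y
      have := h 0 y
      rw [intervalIntegralCLM_apply, BoundedL2.evalCLM_apply, BoundedL2.evalCLM_apply] at this
      linarith
    rwa [h2] at h1

theorem IsDeriv.integral {U V : ℝ → BoundedL2 μ p} (hU : Continuous U) (hV : Continuous V)
    (h : ∀ t, IsDeriv (U t) (V t)) (s t : ℝ) : IsDeriv (∫ τ in s..t, U τ) (∫ τ in s..t, V τ) := by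
  refine isDeriv_iff.2 fun x y => ?_
  have hi := hU.intervalIntegrable (μ := volume) s t
  rw [← ContinuousLinearMap.intervalIntegral_comp_comm _ hi,
    ← ContinuousLinearMap.intervalIntegral_comp_comm _ hi,
    ← ContinuousLinearMap.intervalIntegral_comp_comm _ (hV.intervalIntegrable s t),
    ← intervalIntegral.integral_sub (Continuous.intervalIntegrable (by fun_prop) _ _)
      (Continuous.intervalIntegrable (by fun_prop) _ _)]
  exact intervalIntegral.integral_congr fun τ _ => isDeriv_iff.1 (h τ) x y

/-! ### Curves with derivatives in `x` -/

/-- `U` is a continuous curve with `k` continuous curves of derivatives in `x`. -/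
def Regular : ℕ → (ℝ → BoundedL2 μ p) → Prop
  | 0, U => Continuous U
  | k + 1, U => Continuous U ∧ ∃ V, Regular k V ∧ ∀ t, IsDeriv (U t) (V t)

namespace Regular

variable {k : ℕ} {U V : ℝ → BoundedL2 μ p}

theorem continuous (h : Regular k U) : Continuous U := by
  cases k with
  | zero => exact h
  | succ k => exact h.1

theorem of_succ (h : Regular (k + 1) U) : Regular k U := by
  induction k generalizing U with
  | zero => exact h.1
  | succ k ih =>
    obtain ⟨h1, V, h2, h3⟩ := h
    exact ⟨h1, V, ih h2, h3⟩

theorem add (hU : Regular k U) (hV : Regular k V) : Regular k fun t => U t + V t := by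
  induction k generalizing U V with
  | zero => exact Continuous.add hU hV
  | succ k ih =>
    obtain ⟨h1, U', h2, h3⟩ := hU
    obtain ⟨h4, V', h5, h6⟩ := hV
    exact ⟨h1.add h4, _, ih h2 h5, fun t => (h3 t).add (h6 t)⟩

theorem smul {c : ℝ → ℝ} (hc : Continuous c) (hU : Regular k U) :
    Regular k fun t => c t • U t := by
  induction k generalizing U with
  | zero => exact Continuous.smul hc hU
  | succ k ih =>
    obtain ⟨h1, U', h2, h3⟩ := hU
    exact ⟨hc.smul h1, _, ih h2, fun t => (h3 t).smul (c t)⟩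

theorem mul (hU : Regular k U) (hV : Regular k V) :
    Regular k fun t => BoundedL2.mulL (U t) (V t) := by
  induction k generalizing U V with
  | zero =>
    have hU : Continuous U := hU
    have hV : Continuous V := hV
    change Continuous _
    fun_prop
  | succ k ih =>
    have hU' := hU.of_succ
    have hV' := hV.of_succ
    obtain ⟨h1, U', h2, h3⟩ := hU
    obtain ⟨h4, V', h5, h6⟩ := hV
    exact ⟨by fun_prop, _, (ih h2 hV').add (ih hU' h5), fun t => (h3 t).mul (h6 t)⟩

theorem comp (hU : Regular k U) {c : ℝ → ℝ} (hc : Continuous c) : Regular k fun t => U (c t) := by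
  induction k generalizing U with
  | zero => exact Continuous.comp hU hc
  | succ k ih =>
    obtain ⟨h1, U', h2, h3⟩ := hU
    exact ⟨h1.comp hc, _, ih h2, fun t => h3 (c t)⟩

theorem integral (hU : Regular k U) (s : ℝ) : Regular k fun t => ∫ τ in s..t, U τ := by
  induction k generalizing U with
  | zero =>
    exact intervalIntegral.continuous_primitive
      (fun a b => Continuous.intervalIntegrable hU a b) s
  | succ k ih =>
    obtain ⟨h1, U', h2, h3⟩ := hU
    exact ⟨intervalIntegral.continuous_primitive (fun a b => h1.intervalIntegrable a b) s, _, ih h2,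
      fun t => IsDeriv.integral h1 h2.continuous h3 s t⟩

theorem flux (hU : Regular k U) : Regular k fun t => flux (U t) :=
  hU.add ((hU.mul hU).smul continuous_const)

variable [IsBBMDomain μ p]

theorem resolvent_dispersion (hU : Regular k U) :
    Regular k (fun t => resolventL (U t)) ∧ Regular k (fun t => dispersionL (U t)) := by
  induction k generalizing U with
  | zero => exact ⟨resolventL.continuous.comp hU, dispersionL.continuous.comp hU⟩
  | succ k ih =>
    obtain ⟨h1, U', h2, h3⟩ := hU
    exact ⟨⟨resolventL.continuous.comp h1, _, (ih h2).1, fun t => (h3 t).resolvent⟩,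
      ⟨dispersionL.continuous.comp h1, _, (ih h2).2, fun t => (h3 t).dispersion⟩⟩

/-- The gain of one derivative comes from `∂P = 1 - (1 - ∂²)⁻¹`, where the right side has order
zero. -/
theorem dispersion_succ (hU : Regular k U) : Regular (k + 1) fun t => dispersionL (U t) := by
  refine ⟨dispersionL.continuous.comp hU.continuous, fun t => U t + (-1 : ℝ) • resolventL (U t),
    hU.add (hU.resolvent_dispersion.1.smul continuous_const), fun t => ?_⟩
  have h := isDeriv_dispersionL (U t)
  rwa [sub_eq_add_neg, ← neg_one_smul ℝ] at h

/-- The integral equation propagates the regularity of the datum. -/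
theorem of_integral_eq {v : BoundedL2 μ p} (hv : ∀ k, Regular k fun _ => v) {c l : ℝ → ℝ}
    (hc : Continuous c) (hl : Continuous l) (hU : Continuous U)
    (h : ∀ t, U t = v + ∫ τ in (0 : ℝ)..c t, dispersionL (BBM.flux (l τ • U τ))) (k : ℕ) :
    Regular k U := by
  induction k with
  | zero => exact hU
  | succ k ih =>
    -- The right side of the integral equation is one derivative smoother than `U`. The scalar `l`
    -- depends on time only and the reparametrization `c` acts on time only, so neither costs
    -- regularity in `x`.
    rw [show U = _ from funext h]
    exact (hv (k + 1)).add (((ih.smul hl).flux.dispersion_succ.integral 0).comp hc)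

end Regular

/-- A sequence of curves, each one the derivative in `x` of the one before. -/
structure IsJet (J : ℕ → ℝ → BoundedL2 μ p) : Prop where
  continuous : ∀ k, Continuous (J k)
  isDeriv : ∀ k t, IsDeriv (J k t) (J (k + 1) t)

/-- `Regular` gives a separate chain of derivatives for each length. Uniqueness of derivatives
identifies the first members of these chains, so the derivative is again regular of every order and
the choice can be iterated. -/
theorem exists_isJet {U : ℝ → BoundedL2 μ p} (hU : ∀ k, Regular k U) :
    ∃ J : ℕ → ℝ → BoundedL2 μ p, IsJet J ∧ J 0 = U := by
  have step : ∀ U : {U : ℝ → BoundedL2 μ p // ∀ k, Regular k U},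
      ∃ V : {U : ℝ → BoundedL2 μ p // ∀ k, Regular k U}, ∀ t, IsDeriv (U.1 t) (V.1 t) := by
    rintro ⟨U, hU⟩
    obtain ⟨-, V, -, hV⟩ := hU 1
    refine ⟨⟨V, fun k => ?_⟩, hV⟩
    obtain ⟨-, W, hW, hW'⟩ := hU (k + 1)
    rwa [show V = W from funext fun t => (hV t).unique (hW' t)]
  choose d hd using step
  exact ⟨fun k => (d^[k] ⟨U, hU⟩).1, ⟨fun k => (d^[k] ⟨U, hU⟩).2 0, fun k t => by
    rw [Function.iterate_succ_apply']
    exact hd _ t⟩, rfl⟩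

namespace IsJet

variable {J : ℕ → ℝ → BoundedL2 μ p}

theorem regular (hJ : IsJet J) (j k : ℕ) : Regular k (J j) := by
  induction k generalizing j with
  | zero => exact hJ.continuous j
  | succ k ih => exact ⟨hJ.continuous j, _, ih (j + 1), hJ.isDeriv j⟩

theorem iteratedDeriv_eq (hJ : IsJet J) (k : ℕ) (t : ℝ) : iteratedDeriv k (J 0 t) = J k t := by
  induction k with
  | zero => rw [iteratedDeriv_zero]
  | succ k ih =>
    rw [iteratedDeriv_succ, ih]
    ext x
    exact (hJ.isDeriv k t x).deriv

theorem isSmoothL2 (hJ : IsJet J) (t : ℝ) : IsSmoothL2 μ (J 0 t) := by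
  refine ⟨contDiff_of_differentiable_iteratedDeriv fun k _ => ?_, fun k => ?_⟩
  · rw [hJ.iteratedDeriv_eq]
    exact fun x => (hJ.isDeriv k t x).differentiableAt
  · rw [hJ.iteratedDeriv_eq]
    exact (J k t).memLp

end IsJet

variable [hμ : IsBBMDomain μ p]

/-- Smooth functions with all derivatives in `L²` have bounded derivatives. -/
theorem exists_coe_eq_iteratedDeriv {v : ℝ → ℝ} (hv : IsSmoothL2 μ v)
    (hp : Function.Periodic v p) :
    ∃ a : ℕ → BoundedL2 μ p, (∀ k, a k = iteratedDeriv k v) ∧ ∀ k, IsDeriv (a k) (a (k + 1)) := by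
  have hd : ∀ k x, HasDerivAt (iteratedDeriv k v) (iteratedDeriv (k + 1) v x) x := fun k x => by
    rw [iteratedDeriv_succ]
    exact ((hv.1.differentiable_iteratedDeriv k
      (by exact_mod_cast WithTop.coe_lt_top _)) x).hasDerivAt
  have hc : ∀ k, Continuous (iteratedDeriv k v) := fun k =>
    hv.1.continuous_iteratedDeriv k (by exact_mod_cast le_top)
  have hper : ∀ k, Function.Periodic (iteratedDeriv k v) p := fun k => by
    induction k with
    | zero => simpa using hp
    | succ k ih =>
      intro x
      rw [iteratedDeriv_succ, ← deriv_comp_add_const, funext ih]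
  -- Each derivative is bounded because it and the next one are in `L²`.
  have h := fun k => fun x => Real.abs_le_sqrt
    (sq_le_integral_sq_add (hd k) (hc _) (hper k) (hper _) (hv.2 k) (hv.2 (k + 1)) x)
  exact ⟨fun k => BoundedL2.mk _ (hc k) _ (h k) (hper k) (hv.2 k), fun k => rfl, fun k => hd k⟩

theorem exists_regular_const {v : ℝ → ℝ} (hv : IsSmoothL2 μ v) (hp : Function.Periodic v p) :
    ∃ a : BoundedL2 μ p, a = v ∧ ∀ k, Regular k fun _ => a := by
  obtain ⟨a, h1, h2⟩ := exists_coe_eq_iteratedDeriv (p := p) hv hp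
  refine ⟨a 0, by rw [h1, iteratedDeriv_zero], fun k => ?_⟩
  exact IsJet.regular (J := fun k _ => a k) ⟨fun k => continuous_const, fun k _ => h2 k⟩ 0 k

end

/-! ### Truncation, conservation of energy and global existence -/

section

section Truncation

variable {E : Type*} [NormedAddCommGroup E] {R : ℝ}

/-- The factor that brings a vector into the ball of radius `R`. -/
def truncFactor (R : ℝ) (a : E) : ℝ := R / max R ‖a‖

theorem continuous_truncFactor (hR : 0 < R) : Continuous (truncFactor R : E → ℝ) :=
  continuous_const.div (by fun_prop) fun a => (lt_max_of_lt_left hR).ne'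

theorem truncFactor_of_norm_le (hR : 0 < R) {a : E} (ha : ‖a‖ ≤ R) : truncFactor R a = 1 := by
  rw [truncFactor, max_eq_left ha, div_self hR.ne']

end Truncation

/-! ### Curves on a compact interval -/

section Curves

variable {E : Type*} [NormedAddCommGroup E] [NormedSpace ℝ E] {T R : ℝ}

/-- The nearest point of `[0, T]`. -/
def clamp (T t : ℝ) : ℝ := max 0 (min T t)

theorem continuous_clamp (T : ℝ) : Continuous (clamp T) := by
  unfold clamp
  fun_prop

theorem clamp_of_mem {t : ℝ} (ht : t ∈ Icc 0 T) : clamp T t = t := by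
  rw [clamp, min_eq_right ht.2, max_eq_right ht.1]

theorem clamp_mem (hT : 0 < T) (t : ℝ) : clamp T t ∈ Icc 0 T :=
  ⟨le_max_left _ _, max_le hT.le (min_le_left _ _)⟩

theorem eq_add_integral_of_hasDerivWithinAt [CompleteSpace E] {α g : ℝ → E}
    (h : ∀ t ∈ Icc 0 T, HasDerivWithinAt α (g t) (Icc 0 T) t) (hg : ContinuousOn g (Icc 0 T))
    {t : ℝ} (ht : t ∈ Icc 0 T) : α t = α 0 + ∫ τ in (0 : ℝ)..t, g τ := by
  have hsub : Icc 0 t ⊆ Icc 0 T := Icc_subset_Icc le_rfl ht.2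
  rw [intervalIntegral.integral_eq_sub_of_hasDerivAt_of_le ht.1
    (fun τ hτ => ((h τ (hsub hτ)).continuousWithinAt).mono hsub)
    (fun τ hτ => (h τ ⟨hτ.1.le, hτ.2.le.trans ht.2⟩).hasDerivAt
      (Icc_mem_nhds hτ.1 (hτ.2.trans_le ht.2)))
    ((hg.mono (by rwa [uIcc_of_le ht.1])).intervalIntegrable)]
  abel

theorem hasDerivWithinAt_of_eq_add_integral [CompleteSpace E] {α g : ℝ → E} {c : E}
    (h : ∀ t ∈ Icc 0 T, α t = c + ∫ τ in (0 : ℝ)..t, g τ) (hg : Continuous g) {t : ℝ}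
    (ht : t ∈ Icc 0 T) : HasDerivWithinAt α (g t) (Icc 0 T) t :=
  ((hg.integral_hasStrictDerivAt 0 t).hasDerivAt.const_add c).hasDerivWithinAt.congr h (h t ht)

theorem HasDerivWithinAt.Ici_of_Icc {α : ℝ → E} {α' : E} {t : ℝ}
    (h : HasDerivWithinAt α α' (Icc 0 T) t) (ht : t ∈ Ico 0 T) :
    HasDerivWithinAt α α' (Ici t) t :=
  h.mono_of_mem_nhdsWithin (Icc_mem_nhdsGE_of_mem ht)

theorem norm_truncFactor_smul_le (hR : 0 < R) (a : E) : ‖truncFactor R a • a‖ ≤ R := by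
  have h : 0 < max R ‖a‖ := lt_max_of_lt_left hR
  rw [norm_smul, truncFactor, Real.norm_of_nonneg (by positivity), div_mul_eq_mul_div,
    div_le_iff₀ h]
  exact mul_le_mul_of_nonneg_left (le_max_right _ _) hR.le

/-- The difference splits into a change of vector at a fixed factor and a change of factor at a
fixed vector; each costs at most `‖a - b‖`. -/
theorem norm_truncFactor_smul_sub_le (hR : 0 < R) (a b : E) :
    ‖truncFactor R a • a - truncFactor R b • b‖ ≤ 2 * ‖a - b‖ := by
  have hma : 0 < max R ‖a‖ := lt_max_of_lt_left hR
  have hmb : 0 < max R ‖b‖ := lt_max_of_lt_left hR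
  have h : truncFactor R a • a - truncFactor R b • b
      = truncFactor R a • (a - b) + (truncFactor R a - truncFactor R b) • b := by module
  have h1 : ‖truncFactor R a‖ ≤ 1 := by
    rw [truncFactor, Real.norm_of_nonneg (by positivity), div_le_one hma]
    exact le_max_left _ _
  have h2 : ‖(truncFactor R a - truncFactor R b) • b‖ ≤ ‖a - b‖ := by
    have h3 : truncFactor R a - truncFactor R b
        = R / max R ‖a‖ * ((max R ‖b‖ - max R ‖a‖) / max R ‖b‖) := by
      rw [truncFactor, truncFactor]
      field_simp
    have h4 : |max R ‖b‖ - max R ‖a‖| ≤ ‖a - b‖ := by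
      refine (abs_max_sub_max_le_abs _ _ R |>.trans' ?_).trans
        ((abs_norm_sub_norm_le b a).trans_eq (norm_sub_rev b a))
      rw [max_comm R, max_comm R]
    rw [norm_smul, h3, norm_mul, norm_div _ (max R ‖b‖), Real.norm_of_nonneg hmb.le]
    calc ‖R / max R ‖a‖‖ * (‖max R ‖b‖ - max R ‖a‖‖ / max R ‖b‖) * ‖b‖
        = ‖R / max R ‖a‖‖ * ‖max R ‖b‖ - max R ‖a‖‖ * (‖b‖ / max R ‖b‖) := by ring
      _ ≤ 1 * ‖a - b‖ * 1 := by
        gcongr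
        · exact h1
        · exact h4
        · exact (div_le_one hmb).2 (le_max_right _ _)
      _ = ‖a - b‖ := by ring
  rw [h]
  refine (norm_add_le _ _).trans ?_
  rw [norm_smul]
  nlinarith [norm_nonneg (a - b)]

/-- Global existence for a bounded Lipschitz vector field. -/
theorem exists_hasDerivWithinAt_of_lipschitz [CompleteSpace E] {F : E → E} {K : ℝ≥0} {L : ℝ}
    (hF : LipschitzWith K F) (hL : ∀ a, ‖F a‖ ≤ L) (hT : 0 < T) (v : E) :
    ∃ α : ℝ → E, α 0 = v ∧ ∀ t ∈ Icc 0 T, HasDerivWithinAt α (F (α t)) (Icc 0 T) t := by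
  have hL0 : 0 ≤ L := (norm_nonneg _).trans (hL 0)
  -- With speed at most `L`, a solution cannot leave the ball of radius `L * T` before time `T`, so
  -- the local theorem covers the whole interval.
  have h : IsPicardLindelof (fun _ => F) (⟨0, ⟨le_rfl, hT.le⟩⟩ : Icc (0 : ℝ) T) v
      (L * T).toNNReal 0 L.toNNReal K :=
    IsPicardLindelof.of_time_independent
      (fun x _ => (hL x).trans_eq (Real.coe_toNNReal _ hL0).symm) hF.lipschitzOnWith (by
        simp [hT.le, hL0])
  exact h.exists_eq_forall_mem_Icc_hasDerivWithinAt₀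

end Curves

variable {μ : Measure ℝ} {p : ℝ} [IsBBMDomain μ p] {T : ℝ}

/-! ### The energy -/

/-- The `H¹` energy is conserved, also with the truncated nonlinearity. -/
theorem energy_identity {a a' : BoundedL2 μ p} (h : IsDeriv a a') (r : ℝ) :
    inner ℝ (BoundedL2.toLpCLM a) (BoundedL2.toLpCLM (dispersionL (flux (r • a))))
      + inner ℝ (BoundedL2.toLpCLM a')
        (BoundedL2.toLpCLM (flux (r • a) - resolventL (flux (r • a)))) = 0 := by
  -- Integration by parts cancels the `dispersionL f` term against the `resolventL f` term. What
  -- remains is the integral of `a' f`, and `a' f` is the derivative of `r a²/2 + r² a³/6` because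
  -- `r` does not depend on `x`.
  set f := flux (r • a)
  have h1 := h.integral_add_eq_zero (isDeriv_resolventL f)
  have h2 := h.integral_add_eq_zero h
  have h3 := h.integral_add_eq_zero (h.mul h)
  have h4 : inner ℝ (BoundedL2.toLpCLM a) (BoundedL2.toLpCLM (BoundedL2.mulL a' a))
      = inner ℝ (BoundedL2.toLpCLM a') (BoundedL2.toLpCLM (BoundedL2.mulL a a)) := by
    rw [BoundedL2.inner_toLpCLM, BoundedL2.inner_toLpCLM]
    congr 1
    ext x
    simp only [BoundedL2.mulL_apply]
    ring
  have h5 : BoundedL2.mulL a a' = BoundedL2.mulL a' a := by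
    ext x
    exact mul_comm _ _
  have h6 : f = r • a + (2⁻¹ * r ^ 2 : ℝ) • BoundedL2.mulL a a := by
    ext x
    simp only [f, flux_apply, BoundedL2.add_apply, BoundedL2.smul_apply, BoundedL2.mulL_apply]
    ring
  rw [real_inner_comm] at h2
  rw [map_neg, inner_neg_right] at h1
  rw [h5, map_add, inner_add_right, h4] at h3
  have h7 : inner ℝ (BoundedL2.toLpCLM a') (BoundedL2.toLpCLM f) = 0 := by
    rw [h6, map_add, map_smul, map_smul, inner_add_right, inner_smul_right, inner_smul_right]
    rw [real_inner_comm] at h2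
    linear_combination (r / 2) * h2 + (2⁻¹ * r ^ 2 / 3) * h3
  rw [map_sub, inner_sub_right, h7]
  linarith

/-- The bound follows from conservation of the `H¹` norm and the Sobolev inequality. It depends on
the datum alone and not on the factor `l`, so the truncation radius can be chosen before the
truncated equation is solved. -/
theorem norm_sq_le_of_integral_eq {v v' : BoundedL2 μ p}
    (hv' : IsDeriv v v') {U : ℝ → BoundedL2 μ p} {l : ℝ → ℝ} (hl : Continuous l)
    (hU : ∀ k, Regular k U)
    (h : ∀ t ∈ Icc 0 T, U t = v + ∫ τ in (0 : ℝ)..t, dispersionL (flux (l τ • U τ)))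
    {t : ℝ} (ht : t ∈ Icc 0 T) :
    ‖U t‖ ^ 2 ≤ 2 * (‖BoundedL2.toLpCLM v‖ ^ 2 + ‖BoundedL2.toLpCLM v'‖ ^ 2) := by
  set f : ℝ → BoundedL2 μ p := fun τ => flux (l τ • U τ) with hf
  have hfc : Continuous f := (((hU 0).smul hl).flux).continuous
  -- This is the derivative of `U` in `x`, written with its own integral equation so that it can be
  -- differentiated in time.
  set V : ℝ → BoundedL2 μ p := fun t => v' + ∫ τ in (0 : ℝ)..t, (f τ - resolventL (f τ)) with hV
  have hUV : ∀ t ∈ Icc 0 T, IsDeriv (U t) (V t) := fun t ht => by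
    rw [h t ht]
    exact hv'.add (IsDeriv.integral (dispersionL.continuous.comp hfc)
      (hfc.sub (resolventL.continuous.comp hfc)) (fun τ => isDeriv_dispersionL (f τ)) 0 t)
  have h1 : ∀ t ∈ Icc 0 T, HasDerivWithinAt U (dispersionL (f t)) (Icc 0 T) t := fun t ht =>
    hasDerivWithinAt_of_eq_add_integral h (dispersionL.continuous.comp hfc) ht
  have h2 : ∀ t ∈ Icc 0 T, HasDerivWithinAt V (f t - resolventL (f t)) (Icc 0 T) t := fun t ht =>
    hasDerivWithinAt_of_eq_add_integral (fun _ _ => rfl)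
      (hfc.sub (resolventL.continuous.comp hfc)) ht
  have h3 : ∀ t ∈ Icc 0 T, HasDerivWithinAt
      (fun t => ‖BoundedL2.toLpCLM (U t)‖ ^ 2 + ‖BoundedL2.toLpCLM (V t)‖ ^ 2) 0 (Icc 0 T) t := by
    intro t ht
    have h4 := (BoundedL2.toLpCLM.hasFDerivAt.comp_hasDerivWithinAt t (h1 t ht)).norm_sq
    have h5 := (BoundedL2.toLpCLM.hasFDerivAt.comp_hasDerivWithinAt t (h2 t ht)).norm_sq
    refine (h4.add h5).congr_deriv ?_
    rw [← mul_add]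
    exact mul_eq_zero_of_right _ (energy_identity (hUV t ht) (l t))
  have h6 := constant_of_has_deriv_right_zero (fun t ht => (h3 t ht).continuousWithinAt)
    (fun t ht => HasDerivWithinAt.Ici_of_Icc (h3 t ⟨ht.1, ht.2.le⟩) ht) t ht
  have h0 : (0 : ℝ) ∈ Icc 0 T := ⟨le_rfl, ht.1.trans ht.2⟩
  refine (hUV t ht).norm_sq_le.trans_eq ?_
  rw [h6, h 0 h0, hV]
  simp

/-! ### Global existence -/

/-- Global existence of smooth solutions, as an evolution equation in `BoundedL2 μ p`. -/
theorem exists_solution (hT : 0 < T) {v : BoundedL2 μ p} (hv : ∀ k, Regular k fun _ => v) :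
    ∃ U : ℝ → BoundedL2 μ p, U 0 = v ∧ (∀ k, Regular k U) ∧
      ∀ t ∈ Icc 0 T, HasDerivWithinAt U (bbmField (U t)) (Icc 0 T) t := by
  obtain ⟨-, v', -, hv'⟩ := hv 1
  replace hv' : IsDeriv v (v' 0) := hv' 0
  -- The a priori bound of the truncated problem, so that the truncation never acts on the solution;
  -- the added `1` keeps `R` positive for the zero datum.
  set R : ℝ := √(2 * (‖BoundedL2.toLpCLM v‖ ^ 2 + ‖BoundedL2.toLpCLM (v' 0)‖ ^ 2)) + 1 with hR
  have hR0 : 0 < R := by positivity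
  set F : BoundedL2 μ p → BoundedL2 μ p := fun a => bbmField (truncFactor R a • a) with hF
  have hFb : ∀ a, ‖F a‖ ≤ R + R ^ 2 / 2 := fun a => by
    have h := norm_truncFactor_smul_le hR0 a
    refine (norm_bbmField_le _).trans ?_
    gcongr
  have hFl : LipschitzWith ((1 + R) * 2).toNNReal F := by
    refine LipschitzWith.of_dist_le_mul fun a b => ?_
    rw [dist_eq_norm, dist_eq_norm, Real.coe_toNNReal _ (by positivity)]
    refine (norm_bbmField_sub_le _ _).trans ?_
    have h1 := norm_truncFactor_smul_le hR0 a
    have h2 := norm_truncFactor_smul_le hR0 b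
    have h3 := norm_truncFactor_smul_sub_le hR0 a b
    calc _ ≤ (1 + (R + R) / 2) * (2 * ‖a - b‖) := by gcongr
      _ = _ := by ring
  obtain ⟨α, hα0, hα⟩ := exists_hasDerivWithinAt_of_lipschitz hFl hFb hT v
  have hαc : ContinuousOn α (Icc 0 T) := fun t ht => (hα t ht).continuousWithinAt
  -- Freezing the solution outside `[0,T]` gives a curve that is continuous on all of `ℝ`, as
  -- `Regular` requires.
  set U : ℝ → BoundedL2 μ p := fun t => α (clamp T t) with hUdef
  have hUα : ∀ t ∈ Icc 0 T, U t = α t := fun t ht => by rw [hUdef]; simp only [clamp_of_mem ht]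
  have hUc : Continuous U :=
    hαc.comp_continuous (continuous_clamp T) (clamp_mem hT)
  have hlc : Continuous fun t => truncFactor R (U t) := (continuous_truncFactor hR0).comp hUc
  have hint : ∀ t ∈ Icc 0 T, U t = v + ∫ τ in (0 : ℝ)..t,
      dispersionL (flux (truncFactor R (U τ) • U τ)) := fun t ht => by
    rw [hUα t ht, eq_add_integral_of_hasDerivWithinAt hα
      (hFl.continuous.comp_continuousOn hαc) ht, hα0]
    congr 1
    refine intervalIntegral.integral_congr fun τ hτ => ?_
    rw [uIcc_of_le ht.1] at hτ
    simp only [hUα τ ⟨hτ.1, hτ.2.trans ht.2⟩]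
    rfl
  have hreg : ∀ k, Regular k U := Regular.of_integral_eq hv (continuous_clamp T) hlc hUc fun t => by
    rw [← hint _ (clamp_mem hT t)]
    simp only [hUdef, clamp_of_mem (clamp_mem hT t)]
  have hle : ∀ t ∈ Icc 0 T, ‖U t‖ ≤ R := fun t ht => by
    have h := Real.abs_le_sqrt (norm_sq_le_of_integral_eq hv' hlc hreg hint ht)
    rw [abs_norm] at h
    linarith
  refine ⟨U, ?_, hreg, fun t ht => ?_⟩
  · rw [hUα 0 ⟨le_rfl, hT.le⟩, hα0]
  · have h := (hα t ht).congr hUα (hUα t ht)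
    rw [← hUα t ht] at h
    simpa only [hF, truncFactor_of_norm_le hR0 (hle t ht), one_smul] using h

/-- Uniqueness for the evolution equation. -/
theorem solution_unique {U V : ℝ → BoundedL2 μ p}
    (hU : ∀ t ∈ Icc 0 T, HasDerivWithinAt U (bbmField (U t)) (Icc 0 T) t)
    (hV : ∀ t ∈ Icc 0 T, HasDerivWithinAt V (bbmField (V t)) (Icc 0 T) t) (h0 : U 0 = V 0) :
    EqOn U V (Icc 0 T) := by
  have hUc : ContinuousOn U (Icc 0 T) := fun t ht => (hU t ht).continuousWithinAt
  have hVc : ContinuousOn V (Icc 0 T) := fun t ht => (hV t ht).continuousWithinAt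
  obtain ⟨C, hC⟩ := isCompact_Icc.exists_bound_of_continuousOn hUc
  obtain ⟨D, hD⟩ := isCompact_Icc.exists_bound_of_continuousOn hVc
  set M := max 0 (max C D)
  refine ODE_solution_unique_of_mem_Icc_right (v := fun _ => bbmField)
    (s := fun _ => Metric.closedBall 0 M) (K := (1 + M).toNNReal) (fun t _ => ?_) hUc
    (fun t ht => HasDerivWithinAt.Ici_of_Icc (hU t ⟨ht.1, ht.2.le⟩) ht) (fun t ht => ?_) hVc
    (fun t ht => HasDerivWithinAt.Ici_of_Icc (hV t ⟨ht.1, ht.2.le⟩) ht) (fun t ht => ?_) h0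
  · refine LipschitzOnWith.of_dist_le_mul fun a ha b hb => ?_
    rw [mem_closedBall_zero_iff] at ha hb
    rw [dist_eq_norm, dist_eq_norm, Real.coe_toNNReal _ (by positivity)]
    refine (norm_bbmField_sub_le a b).trans ?_
    gcongr
    linarith
  · rw [mem_closedBall_zero_iff]
    exact (hC t ⟨ht.1, ht.2.le⟩).trans ((le_max_left C D).trans (le_max_right _ _))
  · rw [mem_closedBall_zero_iff]
    exact (hD t ⟨ht.1, ht.2.le⟩).trans ((le_max_right C D).trans (le_max_right _ _))

end

section

variable {μ : Measure ℝ} {p : ℝ} {T : ℝ}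

theorem IsDeriv.flux {a b : BoundedL2 μ p} (h : IsDeriv a b) :
    IsDeriv (flux a) (b + BoundedL2.mulL a b) := by
  have h1 := h.add ((h.mul h).smul 2⁻¹)
  have h2 : b + BoundedL2.mulL a b
      = b + (2⁻¹ : ℝ) • (BoundedL2.mulL b a + BoundedL2.mulL a b) := by
    ext x
    simp only [BoundedL2.add_apply, BoundedL2.smul_apply, BoundedL2.mulL_apply]
    ring
  rw [h2]
  exact h1

variable [IsBBMDomain μ p]

/-! ### From the evolution equation to classical solutions -/

/-- Differentiating the integral equation twice in `x` gives equations for `uₓ` and `uₓₓ`. With `f =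
u + u²/2` they yield `∂ₜu = P f` and `∂ₜuₓₓ = fₓ + P f`, whose difference is the BBM equation. -/
theorem isSmoothBBMSolution_of_hasDerivWithinAt {U : ℝ → BoundedL2 μ p}
    (hreg : ∀ k, Regular k U)
    (hU : ∀ t ∈ Icc 0 T, HasDerivWithinAt U (bbmField (U t)) (Icc 0 T) t) :
    IsSmoothBBMSolution μ T (fun t => U t) := by
  obtain ⟨J, hJ, rfl⟩ := exists_isJet hreg
  refine ⟨fun t _ => hJ.isSmoothL2 t, fun k t₀ _ => ?_, fun t ht x => ?_⟩
  · simp only [hJ.iteratedDeriv_eq]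
    have h1 : Tendsto (fun t => ENNReal.ofReal ‖J k t - J k t₀‖) (𝓝[Icc 0 T] t₀) (𝓝 0) := by
      have h2 : Continuous fun t => ENNReal.ofReal ‖J k t - J k t₀‖ := by
        have := hJ.continuous k
        exact ENNReal.continuous_ofReal.comp (by fun_prop)
      have h3 := h2.tendsto t₀
      simp only [sub_self, norm_zero, ENNReal.ofReal_zero] at h3
      exact h3.mono_left nhdsWithin_le_nhds
    exact tendsto_of_tendsto_of_tendsto_of_le_of_le tendsto_const_nhds h1 (fun _ => zero_le)
      fun t => (J k t - J k t₀).eLpNorm_le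
  · have hJ0 := hJ.continuous 0
    have hJ1 := hJ.continuous 1
    set f : ℝ → BoundedL2 μ p := fun τ => flux (J 0 τ) with hf
    set g : ℝ → BoundedL2 μ p := fun τ => J 1 τ + BoundedL2.mulL (J 0 τ) (J 1 τ) with hg
    have hfc : Continuous f := continuous_flux.comp hJ0
    have hgc : Continuous g := by fun_prop
    have hfg : ∀ τ, IsDeriv (f τ) (g τ) := fun τ => (hJ.isDeriv 0 τ).flux
    have hGc := (resolventL (μ := μ) (p := p)).continuous
    have hPc := (dispersionL (μ := μ) (p := p)).continuous
    have h0 : ∀ t ∈ Icc 0 T, J 0 t = J 0 0 + ∫ τ in (0 : ℝ)..t, dispersionL (f τ) := fun t ht =>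
      eq_add_integral_of_hasDerivWithinAt hU (continuous_bbmField.comp hJ0).continuousOn ht
    have h1 : ∀ t ∈ Icc 0 T, J 1 t = J 1 0 + ∫ τ in (0 : ℝ)..t, (f τ - resolventL (f τ)) :=
      fun t ht => by
        refine (hJ.isDeriv 0 t).unique ?_
        rw [h0 t ht]
        exact (hJ.isDeriv 0 0).add (IsDeriv.integral (hPc.comp hfc) (hfc.sub (hGc.comp hfc))
          (fun τ => isDeriv_dispersionL _) 0 t)
    have h2 : ∀ t ∈ Icc 0 T, J 2 t = J 2 0 + ∫ τ in (0 : ℝ)..t, (g τ - -dispersionL (f τ)) :=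
      fun t ht => by
        refine (hJ.isDeriv 1 t).unique ?_
        rw [h1 t ht]
        exact (hJ.isDeriv 1 0).add (IsDeriv.integral (hfc.sub (hGc.comp hfc))
          (hgc.sub (hPc.comp hfc).neg) (fun τ => (hfg τ).sub (isDeriv_resolventL _)) 0 t)
    have h3 := hasDerivWithinAt_of_eq_add_integral h2 (hgc.sub (hPc.comp hfc).neg) ht
    refine ⟨bbmField (J 0 t) x, (g t - -dispersionL (f t)) x,
      (BoundedL2.evalCLM x).hasFDerivAt.comp_hasDerivWithinAt t (hU t ht), ?_, ?_⟩
    · simp only [hJ.iteratedDeriv_eq]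
      exact (BoundedL2.evalCLM x).hasFDerivAt.comp_hasDerivWithinAt t h3
    · rw [(hJ.isDeriv 0 t x).deriv, ((hJ.isDeriv 0 t x).fun_pow 2).deriv]
      simp only [hg, hf, bbmField, BoundedL2.add_apply, BoundedL2.sub_apply, BoundedL2.neg_apply,
        BoundedL2.mulL_apply]
      norm_num
      ring

/-! ### From classical solutions to the evolution equation -/

/-- The classical equation says that `u - uₓₓ` has time derivative `-∂ₓ(u + u²/2)` at each `x`.
Integrating in time and applying `(1 - ∂²)⁻¹` gives the evolution equation in the phase space. -/
theorem exists_hasDerivWithinAt_of_isSmoothBBMSolution (hT : 0 < T) {w : ℝ → ℝ → ℝ}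
    (hp : ∀ t ∈ Icc 0 T, Function.Periodic (w t) p) (hw : IsSmoothBBMSolution μ T w) :
    ∃ W : ℝ → BoundedL2 μ p, Continuous W ∧ (∀ t ∈ Icc 0 T, (W t : ℝ → ℝ) = w t) ∧
      ∀ t ∈ Icc 0 T, HasDerivWithinAt W (bbmField (W t)) (Icc 0 T) t := by
  choose a ha ha' using fun t => exists_coe_eq_iteratedDeriv (p := p)
    (hw.smooth _ (clamp_mem hT t)) (hp _ (clamp_mem hT t))
  set J : ℕ → ℝ → BoundedL2 μ p := fun k t => a t k with hJdef
  have hJcoe : ∀ k, ∀ t ∈ Icc 0 T, (J k t : ℝ → ℝ) = iteratedDeriv k (w t) := fun k t ht => by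
    rw [hJdef]
    simp only [ha, clamp_of_mem ht]
  have hLp : ∀ k t₀, Tendsto (fun t => ‖BoundedL2.toLpCLM (J k t - J k t₀)‖) (𝓝 t₀) (𝓝 0) :=
    fun k t₀ => by
      have h1 : Tendsto (clamp T) (𝓝 t₀) (𝓝[Icc 0 T] (clamp T t₀)) :=
        tendsto_nhdsWithin_iff.2 ⟨(continuous_clamp T).tendsto t₀,
          Eventually.of_forall (clamp_mem hT)⟩
      have h2 := (ENNReal.tendsto_toReal ENNReal.zero_ne_top).comp
        ((hw.continuous k _ (clamp_mem hT t₀)).comp h1)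
      refine h2.congr fun t => ?_
      rw [BoundedL2.norm_toLpCLM]
      simp only [Function.comp_apply, ← ha]
      rfl
  -- Continuity in `L²` of the derivatives of orders `k` and `k + 1` gives continuity of the former
  -- in the phase space, by the Sobolev inequality.
  have hJ : IsJet J := by
    refine ⟨fun k => continuous_iff_continuousAt.2 fun t₀ => ?_, fun k t => ha' t k⟩
    rw [ContinuousAt, tendsto_iff_norm_sub_tendsto_zero]
    have h1 := (((hLp k t₀).pow 2).add ((hLp (k + 1) t₀).pow 2)).const_mul 2
    have h2 := h1.sqrt
    simp only [ne_eq, OfNat.ofNat_ne_zero, not_false_eq_true, zero_pow, add_zero, mul_zero,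
      Real.sqrt_zero] at h2
    refine squeeze_zero (fun t => norm_nonneg _) (fun t => ?_) h2
    exact Real.le_sqrt_of_sq_le ((ha' t k).sub (ha' t₀ k)).norm_sq_le
  have hJ0 := hJ.continuous 0
  have hJ1 := hJ.continuous 1
  have hJ2 := hJ.continuous 2
  set g : ℝ → BoundedL2 μ p := fun τ => J 1 τ + BoundedL2.mulL (J 0 τ) (J 1 τ) with hg
  have hgc : Continuous g := by fun_prop
  have hgn : Continuous fun τ => -g τ := hgc.neg
  have hpt : ∀ x, ∀ t ∈ Icc 0 T,
      HasDerivWithinAt (fun τ => (J 0 τ - J 2 τ) x) ((-g t) x) (Icc 0 T) t := fun x t ht => by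
    obtain ⟨ut, uxxt, h1, h2, h3⟩ := hw.solves t ht x
    have h4 := h1.sub h2
    have h5 : w t = J 0 t := by rw [hJcoe 0 t ht, iteratedDeriv_zero]
    rw [h5, (hJ.isDeriv 0 t x).deriv, ((hJ.isDeriv 0 t x).fun_pow 2).deriv] at h3
    have h6 : (-g t) x = ut - uxxt := by
      simp only [hg, BoundedL2.add_apply, BoundedL2.neg_apply, BoundedL2.mulL_apply]
      norm_num at h3
      linarith
    rw [h6]
    have h7 : ∀ τ ∈ Icc 0 T, (J 0 τ - J 2 τ) x
        = ((fun τ => w τ x) - fun τ => iteratedDeriv 2 (w τ) x) τ := fun τ hτ => by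
      rw [BoundedL2.sub_apply, hJcoe 0 τ hτ, hJcoe 2 τ hτ, iteratedDeriv_zero, Pi.sub_apply]
    exact h4.congr h7 (h7 t ht)
  -- The time derivative is known only for each fixed `x`; evaluation commutes with the Bochner
  -- integral, so the scalar identities combine into one in the phase space.
  have hZ : ∀ t ∈ Icc 0 T, J 0 t - J 2 t = (J 0 0 - J 2 0) + ∫ τ in (0 : ℝ)..t, -g τ :=
    fun t ht => by
      ext x
      have h1 := eq_add_integral_of_hasDerivWithinAt (hpt x)
        (((BoundedL2.evalCLM x).continuous.comp hgc.neg).continuousOn) ht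
      rw [BoundedL2.add_apply, h1, ← BoundedL2.evalCLM_apply x (∫ τ in (0 : ℝ)..t, -g τ),
        ← ContinuousLinearMap.intervalIntegral_comp_comm _ (hgn.intervalIntegrable _ _)]
      rfl
  have hint : ∀ t ∈ Icc 0 T, J 0 t = J 0 0 + ∫ τ in (0 : ℝ)..t, bbmField (J 0 τ) := fun t ht => by
    have h1 : ∀ t, resolventL (J 0 t - J 2 t) = J 0 t := fun t =>
      (hJ.isDeriv 0 t).resolventL_sub (hJ.isDeriv 1 t)
    rw [← h1 t, hZ t ht, map_add, h1,
      ← ContinuousLinearMap.intervalIntegral_comp_comm _ (hgn.intervalIntegrable _ _)]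
    congr 1
    refine intervalIntegral.integral_congr fun τ _ => ?_
    simp only [map_neg]
    rw [(hJ.isDeriv 0 τ).flux.resolventL_eq, neg_neg]
    rfl
  refine ⟨J 0, hJ0, fun t ht => by rw [hJcoe 0 t ht, iteratedDeriv_zero], fun t ht => ?_⟩
  exact hasDerivWithinAt_of_eq_add_integral hint (continuous_bbmField.comp hJ0) ht

/-! ### Well-posedness for smooth data -/

theorem exists_isSmoothBBMSolution (hT : 0 < T) {v : ℝ → ℝ} (hv : IsSmoothL2 μ v)
    (hp : Function.Periodic v p) :
    ∃ u : ℝ → ℝ → ℝ, ((∀ t, Function.Periodic (u t) p) ∧ IsSmoothBBMSolution μ T u ∧ u 0 = v) ∧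
      ∀ w : ℝ → ℝ → ℝ, (∀ t ∈ Icc 0 T, Function.Periodic (w t) p) → IsSmoothBBMSolution μ T w →
        w 0 = v → ∀ t ∈ Icc 0 T, w t = u t := by
  obtain ⟨a, rfl, ha⟩ := exists_regular_const (p := p) hv hp
  obtain ⟨U, hU0, hreg, hU⟩ := exists_solution hT ha
  refine ⟨fun t => U t, ⟨fun t => (U t).periodic, isSmoothBBMSolution_of_hasDerivWithinAt hreg hU,
    by simp only [hU0]⟩, fun w hwp hw hw0 t ht => ?_⟩
  obtain ⟨W, -, hWw, hW⟩ := exists_hasDerivWithinAt_of_isSmoothBBMSolution hT hwp hw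
  rw [← hWw t ht, solution_unique hW hU ?_ ht]
  ext x
  rw [hWw 0 ⟨le_rfl, hT.le⟩, hw0, hU0]

end

/-! ### Norm inflation from oscillating data, for an abstract negative Sobolev space -/

section

variable {μ : Measure ℝ} {p : ℝ} {T : ℝ}

/-- The `L²(μ)` pairing. -/
def pairing (a b : BoundedL2 μ p) : ℝ := inner ℝ (BoundedL2.toLpCLM a) (BoundedL2.toLpCLM b)

theorem pairing_eq_integral (a b : BoundedL2 μ p) : pairing a b = ∫ x, a x * b x ∂μ :=
  BoundedL2.inner_toLpCLM a b

theorem pairing_add_left (a b c : BoundedL2 μ p) :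
    pairing (a + b) c = pairing a c + pairing b c := by
  rw [pairing, map_add, inner_add_left]
  rfl

theorem pairing_smul_left (r : ℝ) (a b : BoundedL2 μ p) :
    pairing (r • a) b = r * pairing a b := by
  rw [pairing, map_smul, inner_smul_left]
  rfl

theorem abs_pairing_le (a b : BoundedL2 μ p) : |pairing a b| ≤ ‖a‖ * ‖b‖ :=
  (abs_real_inner_le_norm _ _).trans
    (mul_le_mul a.norm_toLpCLM_le b.norm_toLpCLM_le (norm_nonneg _) (norm_nonneg _))

/-- The summand `1` makes the right side at least `1` when `D` is nonnegative, as the short-time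
expansion requires. -/
theorem norm_add_smul_le_mul {v h : BoundedL2 μ p} {κ D : ℝ} (hκ : 1 ≤ κ) (hD : ‖h‖ ≤ D) :
    ‖v + κ • h‖ ≤ (‖v‖ + D + 1) * κ := by
  have hκ0 : 0 < κ := by linarith
  calc ‖v + κ • h‖ ≤ ‖v‖ + κ * ‖h‖ := by
        refine (norm_add_le _ _).trans_eq ?_
        rw [norm_smul, Real.norm_of_nonneg hκ0.le]
    _ ≤ ‖v‖ * κ + κ * D := by
        gcongr
        exact le_mul_of_one_le_right (norm_nonneg _) hκ
    _ ≤ (‖v‖ + D + 1) * κ := by nlinarith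

variable [IsBBMDomain μ p]

/-! ### Short-time expansion -/

/-- The first Picard iterate approximates the solution for short times. -/
theorem norm_sub_picard_le {U : ℝ → BoundedL2 μ p}
    (hU : ∀ t ∈ Icc 0 T, HasDerivWithinAt U (bbmField (U t)) (Icc 0 T) t) {M t : ℝ} (hM : 1 ≤ M)
    (h0 : ‖U 0‖ ≤ M) (ht : t ∈ Icc 0 T) (hMt : 5 * M * t ≤ 1) :
    ‖U t - U 0 - t • bbmField (U 0)‖ ≤ 13 * M ^ 3 * t ^ 2 := by
  have hder : ∀ τ ∈ Ico 0 t, HasDerivWithinAt U (bbmField (U τ)) (Ici τ) τ := fun τ hτ =>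
    HasDerivWithinAt.Ici_of_Icc (hU τ ⟨hτ.1, hτ.2.le.trans ht.2⟩) ⟨hτ.1, hτ.2.trans_le ht.2⟩
  have hcont : ContinuousOn U (Icc 0 t) := fun τ hτ =>
    ((hU τ ⟨hτ.1, hτ.2.trans ht.2⟩).continuousWithinAt).mono (Icc_subset_Icc le_rfl ht.2)
  have hτM : ∀ τ ≤ t, 5 * M ^ 2 * τ ≤ M := fun τ hτ => by nlinarith
  -- A continuity argument: while `‖U‖ ≤ 2M` the speed is at most `2M + 2M² ≤ 4M²`, strictly below
  -- `5M²`, and the restriction on `t` keeps the displacement below `M`.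
  have h1 : ∀ τ ∈ Icc 0 t, ‖U τ - U 0‖ ≤ 5 * M ^ 2 * τ := by
    refine image_norm_le_of_norm_deriv_right_lt_deriv_boundary (B' := fun _ => 5 * M ^ 2)
      (hcont.sub continuousOn_const) (fun τ hτ => (hder τ hτ).sub_const _) (by simp)
      (fun τ => by simpa using (hasDerivAt_id τ).const_mul (5 * M ^ 2)) fun τ hτ h => ?_
    have h : ‖U τ - U 0‖ = 5 * M ^ 2 * τ := h
    have h2 : ‖U τ‖ ≤ 2 * M := by
      have := norm_le_norm_add_norm_sub' (U τ) (U 0)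
      linarith [hτM τ hτ.2.le]
    have h3 : ‖U τ‖ ^ 2 ≤ (2 * M) ^ 2 := by gcongr
    refine (norm_bbmField_le _).trans_lt ?_
    nlinarith
  -- The Lipschitz constant is at most `1 + 3M/2 ≤ 5M/2` and the displacement at most `5M²t`; their
  -- product `25/2 M³t` is rounded up to `13 M³t`.
  have h2 := norm_image_sub_le_of_norm_deriv_right_le_segment
    (f := fun τ => U τ - τ • bbmField (U 0)) (f' := fun τ => bbmField (U τ) - bbmField (U 0))
    (a := 0) (b := t) (C := 13 * M ^ 3 * t) (hcont.sub (by fun_prop))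
    (fun τ hτ => by
      simpa using (hder τ hτ).fun_sub
        (((hasDerivAt_id τ).smul_const (bbmField (U 0))).hasDerivWithinAt))
    (fun τ hτ => by
      have h3 := h1 τ ⟨hτ.1, hτ.2.le⟩
      have h4 : ‖U τ‖ ≤ 2 * M := by
        have := norm_le_norm_add_norm_sub' (U τ) (U 0)
        linarith [hτM τ hτ.2.le]
      calc _ ≤ (1 + (‖U τ‖ + ‖U 0‖) / 2) * ‖U τ - U 0‖ := norm_bbmField_sub_le _ _
        _ ≤ (1 + (2 * M + M) / 2) * (5 * M ^ 2 * τ) := by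
          have := hτ.1
          gcongr
        _ ≤ (5 / 2 * M) * (5 * M ^ 2 * t) := by
          have := hτ.1
          have := hτ.2.le
          gcongr
          linarith
        _ = 25 / 2 * (M ^ 3 * t) := by ring
        _ ≤ 13 * M ^ 3 * t := by
          have : 0 ≤ M ^ 3 * t := mul_nonneg (by positivity) ht.1
          linarith) t ⟨ht.1, le_rfl⟩
  rw [zero_smul, sub_zero, sub_zero] at h2
  calc _ = ‖U t - t • bbmField (U 0) - U 0‖ := by congr 1; abel
    _ ≤ 13 * M ^ 3 * t * t := h2
    _ = _ := by ring

/-- Testing against `(1 - ∂²)η` removes the inverse in `P`, and the remaining derivative moves onto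
`η`. -/
theorem pairing_dispersionL {a b c : BoundedL2 μ p} (h : IsDeriv a b) (h' : IsDeriv b c)
    (f : BoundedL2 μ p) : pairing (dispersionL f) (a - c) = pairing f b := by
  have h1 := (isDeriv_dispersionL f).integral_add_eq_zero h'
  have h2 := (isDeriv_resolventL f).integral_add_eq_zero h
  rw [map_sub, inner_sub_left] at h1
  rw [map_neg, inner_neg_left] at h2
  rw [pairing, pairing, map_sub, inner_sub_right]
  linarith

/-- Among the terms of the flux of `v + κh` only `κ²h²/2` is quadratic in `κ`; all the others are
bounded by a multiple of `κ`. -/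
theorem pairing_bbmField {η η' η'' v h : BoundedL2 μ p} (hη : IsDeriv η η')
    (hη' : IsDeriv η' η'') {κ D : ℝ} (hκ : 1 ≤ κ) (hD : ‖h‖ ≤ D) :
    |pairing (bbmField (v + κ • h)) (η - η'') - κ ^ 2 / 2 * pairing (BoundedL2.mulL h h) η'|
      ≤ κ * (‖η'‖ * (‖v‖ + D + ‖v‖ ^ 2 / 2 + ‖v‖ * D)) := by
  have hκ0 : 0 ≤ κ := by linarith
  have hD0 : 0 ≤ D := (norm_nonneg h).trans hD
  have h0 : pairing (bbmField (v + κ • h)) (η - η'')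
      - κ ^ 2 / 2 * pairing (BoundedL2.mulL h h) η'
      = pairing (v + κ • h + (2⁻¹ : ℝ) • BoundedL2.mulL v v + κ • BoundedL2.mulL v h) η' := by
    rw [sub_eq_iff_eq_add, bbmField, pairing_dispersionL hη hη', ← pairing_smul_left,
      ← pairing_add_left]
    congr 1
    ext x
    simp only [flux_apply, BoundedL2.add_apply, BoundedL2.smul_apply, BoundedL2.mulL_apply]
    ring
  have h1 : ‖v + κ • h + (2⁻¹ : ℝ) • BoundedL2.mulL v v + κ • BoundedL2.mulL v h‖
      ≤ ‖v‖ + κ * D + 2⁻¹ * (‖v‖ * ‖v‖) + κ * (‖v‖ * D) := by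
    refine (norm_add_le _ _).trans (add_le_add ((norm_add_le _ _).trans (add_le_add
      ((norm_add_le _ _).trans (add_le_add le_rfl ?_)) ?_)) ?_)
    · rw [norm_smul, Real.norm_of_nonneg hκ0]
      exact mul_le_mul_of_nonneg_left hD hκ0
    · rw [norm_smul, Real.norm_of_nonneg (by norm_num)]
      exact mul_le_mul_of_nonneg_left (BoundedL2.norm_mulL_le v v) (by norm_num)
    · rw [norm_smul, Real.norm_of_nonneg hκ0]
      refine mul_le_mul_of_nonneg_left ((BoundedL2.norm_mulL_le v h).trans ?_) hκ0
      exact mul_le_mul_of_nonneg_left hD (norm_nonneg _)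
  rw [h0]
  refine (abs_pairing_le _ _).trans ?_
  calc _ ≤ (‖v‖ + κ * D + 2⁻¹ * (‖v‖ * ‖v‖) + κ * (‖v‖ * D)) * ‖η'‖ := by gcongr
    _ ≤ (κ * ‖v‖ + κ * D + κ * (2⁻¹ * (‖v‖ * ‖v‖)) + κ * (‖v‖ * D)) * ‖η'‖ := by
      have h2 : ‖v‖ ≤ κ * ‖v‖ := le_mul_of_one_le_left (norm_nonneg _) hκ
      have h3 : 2⁻¹ * (‖v‖ * ‖v‖) ≤ κ * (2⁻¹ * (‖v‖ * ‖v‖)) :=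
        le_mul_of_one_le_left (by positivity) hκ
      exact mul_le_mul_of_nonneg_right (by linarith) (norm_nonneg _)
    _ = _ := by ring

/-- Large oscillations in the datum force the low frequencies of the solution. -/
theorem abs_pairing_oscillation_le {η η' η'' v h : BoundedL2 μ p} (hη : IsDeriv η η')
    (hη' : IsDeriv η' η'') {U : ℝ → BoundedL2 μ p}
    (hU : ∀ t ∈ Icc 0 T, HasDerivWithinAt U (bbmField (U t)) (Icc 0 T) t) {κ D t : ℝ}
    (hκ : 1 ≤ κ) (hD : ‖h‖ ≤ D) (hU0 : U 0 = v + κ • h) (ht : t ∈ Icc 0 T)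
    (hMt : 5 * ((‖v‖ + D + 1) * κ) * t ≤ 1) :
    t * κ ^ 2 / 2 * |pairing (BoundedL2.mulL h h) η'| ≤
      |pairing (U t) (η - η'')| + |pairing (v + κ • h) (η - η'')|
        + 13 * ((‖v‖ + D + 1) * κ) ^ 3 * t ^ 2 * ‖η - η''‖
        + t * (κ * (‖η'‖ * (‖v‖ + D + ‖v‖ ^ 2 / 2 + ‖v‖ * D))) := by
  have ht0 : 0 ≤ t := ht.1
  have hD0 : 0 ≤ D := (norm_nonneg h).trans hD
  have hM : 1 ≤ (‖v‖ + D + 1) * κ := by nlinarith [norm_nonneg v]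
  have h1 := norm_sub_picard_le hU hM
    (by rw [hU0]; exact norm_add_smul_le_mul hκ hD) ht hMt
  rw [hU0] at h1
  have h2 : |pairing (U t - (v + κ • h) - t • bbmField (v + κ • h)) (η - η'')|
      ≤ 13 * ((‖v‖ + D + 1) * κ) ^ 3 * t ^ 2 * ‖η - η''‖ :=
    (abs_pairing_le _ _).trans (mul_le_mul_of_nonneg_right h1 (norm_nonneg _))
  have h3 : |t * (pairing (bbmField (v + κ • h)) (η - η'')
      - κ ^ 2 / 2 * pairing (BoundedL2.mulL h h) η')|
      ≤ t * (κ * (‖η'‖ * (‖v‖ + D + ‖v‖ ^ 2 / 2 + ‖v‖ * D))) := by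
    rw [abs_mul, abs_of_nonneg ht0]
    exact mul_le_mul_of_nonneg_left (pairing_bbmField hη hη' hκ hD) ht0
  have h4 : pairing (U t) (η - η'')
      = pairing (U t - (v + κ • h) - t • bbmField (v + κ • h)) (η - η'')
        + pairing (v + κ • h) (η - η'') + t * pairing (bbmField (v + κ • h)) (η - η'') := by
    rw [← pairing_smul_left, ← pairing_add_left, ← pairing_add_left]
    congr 1
    abel
  have h5 : t * κ ^ 2 / 2 * |pairing (BoundedL2.mulL h h) η'|
      = |t * (κ ^ 2 / 2 * pairing (BoundedL2.mulL h h) η')| := by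
    rw [abs_mul, abs_mul, abs_of_nonneg ht0, abs_of_nonneg (by positivity : 0 ≤ κ ^ 2 / 2)]
    ring
  rw [h5]
  rw [abs_le] at h2 h3
  have h6 := abs_le.1 (le_refl |pairing (U t) (η - η'')|)
  have h7 := abs_le.1 (le_refl |pairing (v + κ • h) (η - η'')|)
  rw [abs_le]
  constructor <;> linarith [h2.1, h2.2, h3.1, h3.2, h6.1, h6.2, h7.1, h7.2]

/-! ### Sobolev spaces of negative order -/

/-- The properties of a Sobolev space `H` of negative order that are used below. The space
`BoundedL2 μ p` embeds into `H` by `ι`, and `Rep f g` says that `f ∈ H` is given by the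
function `g`. -/
structure IsSobolevModel {H : Type*} [NormedAddCommGroup H] (ι : BoundedL2 μ p →+ H)
    (Rep : H → (ℝ → ℝ) → Prop) : Prop where
  continuous : Continuous ι
  injective : Function.Injective ι
  rep : ∀ a : BoundedL2 μ p, Rep (ι a) a
  eq_of_rep : ∀ (f : H) (a : BoundedL2 μ p), Rep f a → f = ι a
  dense : ∀ f : H, ∀ ε > 0, ∃ a, (∀ k, Regular k fun _ => a) ∧ ‖ι a - f‖ < ε
  /-- There are oscillating functions `h n` which tend to `0` in `H`, while their squares have a
  nonzero limit when they are tested against `η'`. -/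
  oscillation : ∃ (η η' η'' : BoundedL2 μ p) (h : ℕ → BoundedL2 μ p) (C D c : ℝ),
    IsDeriv η η' ∧ IsDeriv η' η'' ∧ (∀ a, |pairing a (η - η'')| ≤ C * ‖ι a‖) ∧
    (∀ n k, Regular k fun _ => h n) ∧ (∀ n, ‖h n‖ ≤ D) ∧ Tendsto (fun n => ι (h n)) atTop (𝓝 0) ∧
    c ≠ 0 ∧ Tendsto (fun n => pairing (BoundedL2.mulL (h n) (h n)) η') atTop (𝓝 c)

namespace IsSobolevModel

variable {H : Type*} [NormedAddCommGroup H] {ι : BoundedL2 μ p →+ H} {Rep : H → (ℝ → ℝ) → Prop}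

/-- The solutions are not bounded in `H` on any neighborhood of any datum. -/
theorem exists_norm_gt (hι : IsSobolevModel ι Rep) (hT : 0 < T) (f : H) {δ : ℝ} (hδ : 0 < δ)
    (B : ℝ) :
    ∃ U : ℝ → BoundedL2 μ p, (∀ k, Regular k U) ∧
      (∀ t ∈ Icc 0 T, HasDerivWithinAt U (bbmField (U t)) (Icc 0 T) t) ∧
      ‖ι (U 0) - f‖ < δ ∧ ∃ t ∈ Icc 0 T, B < ‖ι (U t)‖ := by
  obtain ⟨η, η', η'', h, C, D, c, hη, hη', hC, hreg, hD, hlim, hc, hpair⟩ := hι.oscillation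
  obtain ⟨v, hv, hvf⟩ := hι.dense f (δ / 2) (half_pos hδ)
  have hC' : ∀ a, |pairing a (η - η'')| ≤ |C| * ‖ι a‖ := fun a =>
    (hC a).trans (mul_le_mul_of_nonneg_right (le_abs_self C) (norm_nonneg _))
  have hD0 : 0 ≤ D := (norm_nonneg _).trans (hD 0)
  have hc0 : 0 < |c| := abs_pos.2 hc
  -- The quadratic term will contribute at least `A|c|/4`. A solution bounded by `B` would leave at
  -- most `|C||B| + |C|(‖f‖ + δ) + 1` on the other side, so the constant `2` produces a
  -- contradiction.
  obtain ⟨A, hA0, hAc⟩ : ∃ A, 0 < A ∧ A * |c| / 4 = |C| * |B| + |C| * (‖f‖ + δ) + 2 :=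
    ⟨(|C| * |B| + |C| * (‖f‖ + δ) + 2) * 4 / |c|, by positivity, by field_simp⟩
  obtain ⟨K, hK⟩ : ∃ K, K = ‖η'‖ * (‖v‖ + D + ‖v‖ ^ 2 / 2 + ‖v‖ * D) := ⟨_, rfl⟩
  have hK0 : 0 ≤ K := by rw [hK]; positivity
  obtain ⟨M, hM⟩ : ∃ M, M = ‖v‖ + D + 1 := ⟨_, rfl⟩
  have hM0 : 0 ≤ M := by rw [hM]; positivity
  -- The four lower bounds on `κ` ensure in turn `κ ≥ 1`, `t ≤ T`, the short-time condition, and a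
  -- total error of at most `1`. An integer `κ` is taken because `ι` is only assumed additive.
  obtain ⟨m, hm⟩ := exists_nat_ge
    (max 1 (max (A / T) (max (5 * M * A) (A * K + 13 * M ^ 3 * A ^ 2 * ‖η - η''‖))))
  obtain ⟨κ, hκ⟩ : ∃ κ : ℝ, κ = m := ⟨_, rfl⟩
  rw [← hκ] at hm
  obtain ⟨hκ1, hm⟩ := max_le_iff.1 hm
  obtain ⟨hκT, hm⟩ := max_le_iff.1 hm
  obtain ⟨hκM, hκK⟩ := max_le_iff.1 hm
  have hκ0 : 0 < κ := by linarith
  -- The frequency is chosen after the amplitude, so that `κ h n` is small in `H` however large `κ`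
  -- is.
  obtain ⟨n, hn1, hn2⟩ : ∃ n, ‖ι (κ • h n)‖ < δ / 2 ∧
      |c| / 2 < |pairing (BoundedL2.mulL (h n) (h n)) η'| := by
    have h1 : Tendsto (fun n => (m : ℝ) * ‖ι (h n)‖) atTop (𝓝 0) := by
      simpa using hlim.norm.const_mul (m : ℝ)
    obtain ⟨n, h3, h4⟩ := ((h1.eventually_lt_const (half_pos hδ)).and
      (hpair.abs.eventually_const_lt (half_lt_self hc0))).exists
    refine ⟨n, lt_of_le_of_lt ?_ h3, h4⟩
    rw [hκ, Nat.cast_smul_eq_nsmul, map_nsmul]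
    exact norm_nsmul_le
  obtain ⟨U, hU0, hUreg, hU⟩ := exists_solution hT
    (fun k => (hv k).add ((hreg n k).smul (c := fun _ => κ) continuous_const))
  have hwf : ‖ι (v + κ • h n) - f‖ < δ := by
    rw [map_add, add_sub_right_comm]
    linarith [norm_add_le (ι v - f) (ι (κ • h n))]
  -- On this time scale `tκ² = A` stays fixed, while `tκ = A/κ` and `κ³t² = A²/κ` are small.
  obtain ⟨t, ht⟩ : ∃ t, t = A / κ ^ 2 := ⟨_, rfl⟩
  have htκ : t * κ ^ 2 = A := by
    rw [ht]
    field_simp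
  have ht0 : 0 < t := by rw [ht]; positivity
  have htκ' : t * κ = A / κ := by
    rw [ht]
    field_simp
  have htT : t ∈ Icc 0 T := by
    refine ⟨ht0.le, (le_mul_of_one_le_right ht0.le hκ1).trans ?_⟩
    rw [htκ', div_le_iff₀ hκ0]
    rwa [div_le_iff₀ hT, mul_comm] at hκT
  have hMt : 5 * (M * κ) * t ≤ 1 := by
    rw [show 5 * (M * κ) * t = 5 * M * (t * κ) by ring, htκ', ← mul_div_assoc]
    exact (div_le_one hκ0).2 hκM
  have key := abs_pairing_oscillation_le hη hη' hU hκ1 (hD n) hU0 htT (by rwa [← hM])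
  rw [← hM, ← hK, htκ] at key
  refine ⟨U, hUreg, hU, by rwa [hU0], t, htT, ?_⟩
  by_contra! hB
  have h2 : |pairing (U t) (η - η'')| ≤ |C| * |B| :=
    (hC' _).trans (mul_le_mul_of_nonneg_left (hB.trans (le_abs_self B)) (abs_nonneg C))
  have h3 : |pairing (v + κ • h n) (η - η'')| ≤ |C| * (‖f‖ + δ) := by
    refine (hC' _).trans (mul_le_mul_of_nonneg_left ?_ (abs_nonneg C))
    linarith [norm_le_norm_add_norm_sub' (ι (v + κ • h n)) f]
  have h4 : t * (κ * K) = A * K / κ := by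
    rw [← mul_assoc, htκ']
    ring
  have h5 : 13 * (M * κ) ^ 3 * t ^ 2 * ‖η - η''‖ = 13 * M ^ 3 * A ^ 2 * ‖η - η''‖ / κ := by
    rw [ht]
    field_simp
  have h6 : A * |c| / 4 ≤ A / 2 * |pairing (BoundedL2.mulL (h n) (h n)) η'| := by
    nlinarith
  have h7 : A * K / κ + 13 * M ^ 3 * A ^ 2 * ‖η - η''‖ / κ ≤ 1 := by
    rwa [← add_div, div_le_one hκ0]
  linarith

/-- A map which extends the solution map is discontinuous everywhere. -/
theorem not_continuousAt (hι : IsSobolevModel ι Rep) (hT : 0 < T) {Φ : H → C(Icc (0 : ℝ) T, H)}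
    (hΦ : ∀ U : ℝ → BoundedL2 μ p, (∀ k, Regular k U) →
      (∀ t ∈ Icc 0 T, HasDerivWithinAt U (bbmField (U t)) (Icc 0 T) t) →
      ∀ t : Icc (0 : ℝ) T, Φ (ι (U 0)) t = ι (U t)) (f : H) : ¬ ContinuousAt Φ f := by
  intro hcont
  obtain ⟨δ, hδ, h⟩ := Metric.continuousAt_iff.1 hcont 1 one_pos
  obtain ⟨U, hreg, hU, hUf, t, ht, hB⟩ := hι.exists_norm_gt hT f hδ (‖Φ f‖ + 1)
  have h1 := h (show dist (ι (U 0)) f < δ by rwa [dist_eq_norm])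
  have h2 := (ContinuousMap.norm_coe_le_norm (Φ (ι (U 0))) ⟨t, ht⟩)
  rw [hΦ U hreg hU] at h2
  rw [dist_eq_norm] at h1
  linarith [norm_le_norm_add_norm_sub' (Φ (ι (U 0))) (Φ f)]

/-- The value at a datum is any solution starting there, and `0` if there is none. Injectivity of
`ι` and uniqueness for the evolution equation make the choice irrelevant. -/
theorem exists_solutionMap (hι : IsSobolevModel ι Rep) :
    ∃ Φ : H → C(Icc (0 : ℝ) T, H), ∀ W : ℝ → BoundedL2 μ p, Continuous W →
      (∀ t ∈ Icc 0 T, HasDerivWithinAt W (bbmField (W t)) (Icc 0 T) t) →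
      ∀ t : Icc (0 : ℝ) T, Φ (ι (W 0)) t = ι (W t) := by
  classical
  let IsSol : H → (ℝ → BoundedL2 μ p) → Prop := fun f W => Continuous W ∧
    (∀ t ∈ Icc 0 T, HasDerivWithinAt W (bbmField (W t)) (Icc 0 T) t) ∧ ι (W 0) = f
  refine ⟨fun f => if h : ∃ W, IsSol f W then
    ⟨fun t => ι (h.choose t), hι.continuous.comp (h.choose_spec.1.comp continuous_subtype_val)⟩
    else 0, fun W hW hW' t => ?_⟩
  have h : ∃ V, IsSol (ι (W 0)) V := ⟨W, hW, hW', rfl⟩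
  simp only [dif_pos h]
  change ι (h.choose t) = ι (W t)
  rw [solution_unique h.choose_spec.2.1 hW' (hι.injective h.choose_spec.2.2) t.2]

/-- Solution maps exist and are discontinuous everywhere. -/
theorem exists_and_not_continuousAt (hι : IsSobolevModel ι Rep) (hT : 0 < T) :
    (∃ Φ : H → C(Icc (0 : ℝ) T, H), ∀ u : ℝ → ℝ → ℝ,
      (∀ t ∈ Icc 0 T, Function.Periodic (u t) p) → IsSmoothBBMSolution μ T u →
      ∀ f, Rep f (u 0) → ∀ t : Icc (0 : ℝ) T, Rep (Φ f t) (u t)) ∧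
    ∀ Φ : H → C(Icc (0 : ℝ) T, H), (∀ u : ℝ → ℝ → ℝ,
      (∀ t ∈ Icc 0 T, Function.Periodic (u t) p) → IsSmoothBBMSolution μ T u →
      ∀ f, Rep f (u 0) → ∀ t : Icc (0 : ℝ) T, Rep (Φ f t) (u t)) →
      ∀ f, ¬ ContinuousAt Φ f := by
  refine ⟨?_, fun Φ hΦ f => hι.not_continuousAt hT (fun U hreg hU t => ?_) f⟩
  · obtain ⟨Φ, hΦ⟩ := hι.exists_solutionMap (T := T)
    refine ⟨Φ, fun u hup hu f hf t => ?_⟩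
    obtain ⟨W, hWc, hWu, hW⟩ := exists_hasDerivWithinAt_of_isSmoothBBMSolution hT hup hu
    rw [← hWu 0 ⟨le_rfl, hT.le⟩] at hf
    rw [hι.eq_of_rep f _ hf, hΦ W hWc hW, ← hWu t t.2]
    exact hι.rep _
  · exact hι.eq_of_rep _ _ (hΦ (fun t => U t) (fun t _ => (U t).periodic)
      (isSmoothBBMSolution_of_hasDerivWithinAt hreg hU) _ (hι.rep _) t)

end IsSobolevModel

end

/-! ### The circle: trigonometric functions and `H^s(𝕋)` -/

section

theorem norm_toLpCLM_averageL_le {μ : Measure ℝ} {p : ℝ} [IsBBMDomain μ p] (ν : Measure ℝ)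
    [IsProbabilityMeasure ν] (a : BoundedL2 μ p) :
    ‖BoundedL2.toLpCLM (averageL ν a)‖ ≤ ‖BoundedL2.toLpCLM a‖ := by
  rw [BoundedL2.norm_toLpCLM, BoundedL2.norm_toLpCLM]
  exact ENNReal.toReal_mono a.memLp.2.ne (eLpNorm_average_le ν a.continuous a.periodic)

/-- If `a` vanishes in `L²`, so do all its averages. Then `resolventL a` has zero `H¹` norm, hence
is zero as a function, and so are its derivative `-dispersionL a` and, one derivative further, `a`
itself. -/
theorem toLpCLM_injective {μ : Measure ℝ} {p : ℝ} [IsBBMDomain μ p] :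
    Function.Injective (BoundedL2.toLpCLM : BoundedL2 μ p → Lp ℝ 2 μ) := by
  refine (injective_iff_map_eq_zero _).2 fun a ha => ?_
  have h1 : ∀ (ν : Measure ℝ) [IsProbabilityMeasure ν],
      BoundedL2.toLpCLM (averageL ν a) = 0 := fun ν _ => by
    simpa [ha] using norm_toLpCLM_averageL_le ν a
  have h2 := (isDeriv_resolventL a).norm_sq_le
  rw [resolventL_apply, dispersionL_apply, map_neg, map_smul, map_smul, map_add, map_sub, h1, h1]
    at h2
  have h3 : resolventL a = 0 := by
    rw [resolventL_apply, ← norm_eq_zero]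
    simpa using h2
  have h4 : IsDeriv (resolventL a) (0 : BoundedL2 μ p) := by
    rw [h3]
    exact fun x => hasDerivAt_const x (0 : ℝ)
  have h5 : dispersionL a = 0 := neg_eq_zero.1 ((isDeriv_resolventL a).unique h4)
  have h6 : IsDeriv (dispersionL a) (0 : BoundedL2 μ p) := by
    rw [h5]
    exact fun x => hasDerivAt_const x (0 : ℝ)
  have h7 := (isDeriv_dispersionL a).unique h6
  rwa [h3, sub_zero] at h7

/-! ### The circle as a domain -/

/-- Lebesgue measure on a period. -/
abbrev torusMeasure : Measure ℝ := volume.restrict (Ioc 0 (2 * Real.pi))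

instance : IsBBMDomain torusMeasure (2 * Real.pi) where
  restrict_le := Measure.restrict_mono
    (Ioc_subset_Ioc_right (by linarith [Real.pi_gt_three])) le_rfl
  le_volume := Measure.restrict_le_self
  lintegral_shift g hg hp z := by
    have h1 := MeasurePreserving.setLIntegral_comp_preimage_emb
      (measurePreserving_sub_right volume z) (MeasurableEquiv.subRight z).measurableEmbedding g
      (Ioc (-z) (-z + 2 * Real.pi))
    have h2 : (fun x => x - z) ⁻¹' Ioc (-z) (-z + 2 * Real.pi) = Ioc 0 (2 * Real.pi) := by
      rw [Set.preimage_sub_const_Ioc]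
      simp
    rw [h2] at h1
    have h3 := (isAddFundamentalDomain_Ioc Real.two_pi_pos (-z)).setLIntegral_eq
      (isAddFundamentalDomain_Ioc Real.two_pi_pos 0) g (by
        rintro ⟨_, n, rfl⟩ x
        change g (n • (2 * Real.pi) + x) = g x
        rw [add_comm]
        exact hp.zsmul n x)
    rw [zero_add] at h3
    exact h1.trans h3
  integral_deriv f f' hf hf' hp _ _ := by
    rw [← intervalIntegral.integral_of_le Real.two_pi_pos.le,
      intervalIntegral.integral_eq_sub_of_hasDerivAt (fun x _ => hf x)
      (hf'.intervalIntegrable _ _), hp.eq, sub_self]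

/-! ### Trigonometric functions -/

/-- The square integrable periodic functions. -/
abbrev TorusL2 : Type := BoundedL2 torusMeasure (2 * Real.pi)

theorem memLp_torusMeasure {f : ℝ → ℝ} (hc : Continuous f) (hb : ∀ x, |f x| ≤ 1) :
    MemLp f 2 torusMeasure :=
  MemLp.of_bound hc.aestronglyMeasurable 1 (ae_of_all _ hb)

/-- `cos (m x)`. -/
def cosT (m : ℤ) : TorusL2 :=
  BoundedL2.mk (fun x => Real.cos (m * x)) (by fun_prop) 1 (fun x => Real.abs_cos_le_one _)
    (fun x => by
      change Real.cos (m * (x + 2 * Real.pi)) = Real.cos (m * x)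
      rw [mul_add]
      exact Real.cos_add_int_mul_two_pi _ m)
    (memLp_torusMeasure (by fun_prop) fun x => Real.abs_cos_le_one _)

/-- `sin (m x)`. -/
def sinT (m : ℤ) : TorusL2 :=
  BoundedL2.mk (fun x => Real.sin (m * x)) (by fun_prop) 1 (fun x => Real.abs_sin_le_one _)
    (fun x => by
      change Real.sin (m * (x + 2 * Real.pi)) = Real.sin (m * x)
      rw [mul_add]
      exact Real.sin_add_int_mul_two_pi _ m)
    (memLp_torusMeasure (by fun_prop) fun x => Real.abs_sin_le_one _)

@[simp] theorem cosT_apply (m : ℤ) (x : ℝ) : cosT m x = Real.cos (m * x) := rfl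

@[simp] theorem sinT_apply (m : ℤ) (x : ℝ) : sinT m x = Real.sin (m * x) := rfl

theorem isDeriv_sinT (m : ℤ) : IsDeriv (sinT m) ((m : ℝ) • cosT m) := fun x => by
  have h := ((hasDerivAt_id x).const_mul (m : ℝ)).sin
  rw [mul_one, mul_comm] at h
  exact h

theorem isDeriv_cosT (m : ℤ) : IsDeriv (cosT m) ((-m : ℝ) • sinT m) := fun x => by
  have h := ((hasDerivAt_id x).const_mul (m : ℝ)).cos
  rw [mul_one, mul_comm, mul_neg, ← neg_mul] at h
  exact h

theorem regular_cosT_sinT (m : ℤ) (k : ℕ) :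
    (Regular k fun _ => cosT m) ∧ Regular k fun _ => sinT m := by
  induction k with
  | zero => exact ⟨continuous_const, continuous_const⟩
  | succ k ih =>
    exact ⟨⟨continuous_const, _, ih.2.smul (c := fun _ => (-m : ℝ)) continuous_const,
      fun _ => isDeriv_cosT m⟩, ⟨continuous_const, _,
      ih.1.smul (c := fun _ => (m : ℝ)) continuous_const, fun _ => isDeriv_sinT m⟩⟩

theorem exists_norm_cosT_le : ∃ D : ℝ, ∀ m, ‖cosT m‖ ≤ D := by
  refine ⟨max 1 (√(2 * Real.pi)), fun m => BoundedL2.norm_le (by positivity)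
    (fun x => (Real.abs_cos_le_one _).trans (le_max_left _ _)) ?_⟩
  refine (eLpNorm_le_of_ae_bound (C := 1)
    (ae_of_all _ fun x => Real.abs_cos_le_one _)).trans ?_
  rw [Measure.restrict_apply_univ, Real.volume_Ioc, sub_zero, ENNReal.ofReal_one, mul_one,
    ENNReal.toReal_ofNat, ENNReal.ofReal_rpow_of_nonneg Real.two_pi_pos.le (by norm_num),
    Real.sqrt_eq_rpow]
  norm_num

/-! ### Fourier coefficients -/

/-- The Fourier coefficients of a periodic function. -/
def torusCoeff (f : ℝ → ℝ) (n : ℤ) : ℂ :=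
  (1 / (2 * Real.pi) : ℂ) * ∫ x in (0 : ℝ)..(2 * Real.pi),
    Complex.exp (-(Complex.I * n * x)) * (f x : ℂ)

theorem integral_exp_int (k : ℤ) : ∫ x in (0 : ℝ)..(2 * Real.pi), Complex.exp (Complex.I * k * x)
    = if k = 0 then (2 * Real.pi : ℂ) else 0 := by
  split_ifs with hk
  · simp [hk]
  · have hk' : Complex.I * k ≠ 0 := mul_ne_zero Complex.I_ne_zero (by exact_mod_cast hk)
    rw [integral_exp_mul_complex hk']
    have h : Complex.I * k * ((2 * Real.pi : ℝ) : ℂ) = k * (2 * Real.pi * Complex.I) := by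
      push_cast
      ring
    rw [h, Complex.exp_int_mul_two_pi_mul_I]
    simp

theorem torusCoeff_cosT (m n : ℤ) : torusCoeff (cosT m) n
    = ((if m = n then 1 else 0) + if m = -n then 1 else 0) / 2 := by
  have h1 : ∀ x : ℝ, Complex.exp (-(Complex.I * n * x)) * ((cosT m x : ℝ) : ℂ)
      = 2⁻¹ * (Complex.exp (Complex.I * (m - n : ℤ) * x)
        + Complex.exp (Complex.I * (-m - n : ℤ) * x)) := fun x => by
    rw [cosT_apply, Complex.ofReal_cos, Complex.cos, mul_div_assoc', mul_add, ← Complex.exp_add,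
      ← Complex.exp_add, div_eq_inv_mul]
    push_cast
    congr 4 <;> ring
  simp only [torusCoeff, h1]
  rw [intervalIntegral.integral_const_mul, intervalIntegral.integral_add
    (Continuous.intervalIntegrable (by fun_prop) _ _)
    (Continuous.intervalIntegrable (by fun_prop) _ _), integral_exp_int, integral_exp_int]
  have hpi : (Real.pi : ℂ) ≠ 0 := by exact_mod_cast Real.pi_ne_zero
  simp only [sub_eq_zero, neg_eq_iff_eq_neg]
  split_ifs <;> field_simp <;> norm_num

theorem torusCoeff_sinT (m n : ℤ) : torusCoeff (sinT m) n
    = ((if m = -n then 1 else 0) - if m = n then 1 else 0) * Complex.I / 2 := by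
  have h1 : ∀ x : ℝ, Complex.exp (-(Complex.I * n * x)) * ((sinT m x : ℝ) : ℂ)
      = (Complex.I / 2) * (Complex.exp (Complex.I * (-m - n : ℤ) * x)
        - Complex.exp (Complex.I * (m - n : ℤ) * x)) := fun x => by
    rw [sinT_apply, Complex.ofReal_sin, Complex.sin, mul_div_assoc', ← mul_assoc, mul_sub,
      ← Complex.exp_add, ← Complex.exp_add, mul_comm _ Complex.I, mul_div_right_comm]
    push_cast
    congr 3 <;> ring
  simp only [torusCoeff, h1]
  rw [intervalIntegral.integral_const_mul, intervalIntegral.integral_sub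
    (Continuous.intervalIntegrable (by fun_prop) _ _)
    (Continuous.intervalIntegrable (by fun_prop) _ _), integral_exp_int, integral_exp_int]
  have hpi : (Real.pi : ℂ) ≠ 0 := by exact_mod_cast Real.pi_ne_zero
  simp only [sub_eq_zero, neg_eq_iff_eq_neg]
  split_ifs <;> field_simp <;> norm_num

theorem torusCoeff_add (a b : TorusL2) (n : ℤ) :
    torusCoeff (a + b : TorusL2) n = torusCoeff a n + torusCoeff b n := by
  have ha := a.continuous
  have hb := b.continuous
  simp only [torusCoeff, BoundedL2.add_apply, Complex.ofReal_add, mul_add]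
  rw [intervalIntegral.integral_add (Continuous.intervalIntegrable (by fun_prop) _ _)
    (Continuous.intervalIntegrable (by fun_prop) _ _), mul_add]

theorem torusCoeff_smul (r : ℝ) (a : TorusL2) (n : ℤ) :
    torusCoeff (r • a : TorusL2) n = r * torusCoeff a n := by
  simp only [torusCoeff, BoundedL2.smul_apply, Complex.ofReal_mul]
  simp only [mul_left_comm _ (r : ℂ)]
  rw [intervalIntegral.integral_const_mul, mul_left_comm]

theorem torusCoeff_neg_index (f : ℝ → ℝ) (n : ℤ) :
    torusCoeff f (-n) = conj (torusCoeff f n) := by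
  rw [torusCoeff, torusCoeff, map_mul, intervalIntegral.integral_of_le Real.two_pi_pos.le,
    intervalIntegral.integral_of_le Real.two_pi_pos.le, ← integral_conj]
  congr 1
  · simp [Complex.conj_ofNat]
  · congr 1
    ext x
    rw [map_mul, ← Complex.exp_conj]
    simp

theorem fourierCoeffOn_eq_torusCoeff (f : ℝ → ℝ) (n : ℤ) :
    fourierCoeffOn Real.two_pi_pos (fun x => (f x : ℂ)) n = torusCoeff f n := by
  rw [fourierCoeffOn_eq_integral, torusCoeff, sub_zero, Complex.real_smul]
  congr 1
  · push_cast
    rfl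
  · refine intervalIntegral.integral_congr fun x _ => ?_
    simp only [smul_eq_mul]
    congr 1
    have h := fourier_coe_apply (T := 2 * Real.pi) (n := -n) (x := x)
    refine h.trans ?_
    congr 1
    have hpi : (Real.pi : ℂ) ≠ 0 := by exact_mod_cast Real.pi_ne_zero
    push_cast
    field_simp

/-- Parseval's identity. -/
theorem hasSum_sq_torusCoeff (a : TorusL2) :
    HasSum (fun n => ‖torusCoeff a n‖ ^ 2) ((2 * Real.pi)⁻¹ * ‖BoundedL2.toLpCLM a‖ ^ 2) := by
  have h := hasSum_sq_fourierCoeffOn Real.two_pi_pos (f := fun x => (a x : ℂ)) a.memLp.ofReal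
  simp only [fourierCoeffOn_eq_torusCoeff, sub_zero, smul_eq_mul, Complex.norm_real,
    Real.norm_eq_abs, sq_abs] at h
  rw [intervalIntegral.integral_of_le Real.two_pi_pos.le] at h
  rw [← real_inner_self_eq_norm_sq, BoundedL2.inner_toLpCLM]
  simpa only [sq] using h

theorem eq_of_torusCoeff_eq {a b : TorusL2} (h : ∀ n, torusCoeff a n = torusCoeff b n) :
    a = b := by
  apply toLpCLM_injective
  rw [← sub_eq_zero, ← map_sub]
  have h1 := hasSum_sq_torusCoeff (a - b)
  have h2 : ∀ n, torusCoeff (a - b : TorusL2) n = 0 := fun n => by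
    rw [sub_eq_add_neg, ← neg_one_smul ℝ, torusCoeff_add, torusCoeff_smul, h n]
    simp
  simp only [h2, norm_zero, ne_eq, OfNat.ofNat_ne_zero, not_false_eq_true, zero_pow] at h1
  have h3 := h1.unique hasSum_zero
  simpa [Real.pi_ne_zero] using h3

theorem torusCoeff_one (a : TorusL2) : 2 * Real.pi * torusCoeff a 1
    = ∫ x in (0 : ℝ)..(2 * Real.pi), Complex.exp (-(Complex.I * x)) * (a x : ℂ) := by
  have hpi : (Real.pi : ℂ) ≠ 0 := by exact_mod_cast Real.pi_ne_zero
  rw [torusCoeff]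
  field_simp
  simp

theorem pairing_cosT_one (a : TorusL2) :
    pairing a (cosT 1) = 2 * Real.pi * (torusCoeff a 1).re := by
  have ha := a.continuous
  have h := congrArg Complex.reCLM (torusCoeff_one a)
  rw [← ContinuousLinearMap.intervalIntegral_comp_comm _
    (Continuous.intervalIntegrable (by fun_prop) _ _)] at h
  rw [pairing_eq_integral, ← intervalIntegral.integral_of_le Real.two_pi_pos.le]
  have h1 : ∀ x : ℝ, Complex.reCLM (Complex.exp (-(Complex.I * x)) * (a x : ℂ))
      = a x * cosT 1 x := fun x => by
    rw [Complex.reCLM_apply, Complex.re_mul_ofReal, Complex.exp_re]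
    simp [mul_comm]
  simp only [h1] at h
  rw [← h]
  simp

theorem pairing_sinT_one (a : TorusL2) :
    pairing a (sinT 1) = -(2 * Real.pi * (torusCoeff a 1).im) := by
  have ha := a.continuous
  have h := congrArg Complex.imCLM (torusCoeff_one a)
  rw [← ContinuousLinearMap.intervalIntegral_comp_comm _
    (Continuous.intervalIntegrable (by fun_prop) _ _)] at h
  rw [pairing_eq_integral, ← intervalIntegral.integral_of_le Real.two_pi_pos.le]
  have h1 : ∀ x : ℝ, Complex.imCLM (Complex.exp (-(Complex.I * x)) * (a x : ℂ))
      = -(a x * sinT 1 x) := fun x => by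
    rw [Complex.imCLM_apply, Complex.im_mul_ofReal, Complex.exp_im]
    simp [mul_comm]
  simp only [h1, intervalIntegral.integral_neg] at h
  rw [← neg_eq_iff_eq_neg, ← h]
  simp

/-! ### The Sobolev spaces of negative order on the circle -/

variable {s : ℝ}

theorem norm_weight_smul_le (hs : s < 0) (n : ℤ) (z : ℂ) :
    ‖((1 + (n : ℝ) ^ 2) ^ (s / 2)) • z‖ ≤ ‖z‖ := by
  rw [norm_smul, Real.norm_of_nonneg (by positivity)]
  exact mul_le_of_le_one_left (norm_nonneg _)
    (Real.rpow_le_one_of_one_le_of_nonpos (by nlinarith [sq_nonneg (n : ℝ)]) (by linarith))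

/-- The embedding of the square integrable functions into `H^s(𝕋)` for `s < 0`. -/
def toSobolevTorus (hs : s < 0) : TorusL2 →+ SobolevTorus s where
  toFun a := ⟨torusCoeff a, torusCoeff_neg_index a, by
    refine memℓp_gen ?_
    simp only [ENNReal.toReal_ofNat, Real.rpow_ofNat]
    exact (hasSum_sq_torusCoeff a).summable.of_nonneg_of_le (fun n => by positivity) fun n =>
      pow_le_pow_left₀ (norm_nonneg _) (norm_weight_smul_le hs n _) 2⟩
  map_zero' := by
    apply Subtype.ext
    funext n
    have h := torusCoeff_smul 0 0 n
    rw [zero_smul, Complex.ofReal_zero, zero_mul] at h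
    exact h
  map_add' a b := by
    apply Subtype.ext
    funext n
    exact torusCoeff_add a b n

theorem coeff_toSobolevTorus (hs : s < 0) (a : TorusL2) (n : ℤ) :
    (toSobolevTorus hs a).coeff n = torusCoeff a n := rfl

theorem SobolevTorus.ext {f g : SobolevTorus s} (h : ∀ n, f.coeff n = g.coeff n) : f = g :=
  Subtype.ext (funext h)

theorem norm_sobolevTorus (f : SobolevTorus s) : ‖f‖ = ‖SobolevTorus.toL2 s f‖ := rfl

theorem norm_weight_coeff_le (f : SobolevTorus s) (n : ℤ) :
    ‖((1 + (n : ℝ) ^ 2) ^ (s / 2)) • f.coeff n‖ ≤ ‖f‖ :=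
  lp.norm_apply_le_norm (by norm_num) (SobolevTorus.toL2 s f) n

theorem norm_toSobolevTorus_le (hs : s < 0) (a : TorusL2) : ‖toSobolevTorus hs a‖ ≤ ‖a‖ := by
  rw [norm_sobolevTorus]
  refine lp.norm_le_of_tsum_le (by norm_num) (norm_nonneg a) ?_
  simp only [ENNReal.toReal_ofNat, Real.rpow_ofNat]
  have h := hasSum_sq_torusCoeff a
  have h1 : ∀ n, ‖(SobolevTorus.toL2 s (toSobolevTorus hs a)) n‖ ^ 2 ≤ ‖torusCoeff a n‖ ^ 2 :=
    fun n => pow_le_pow_left₀ (norm_nonneg _) (norm_weight_smul_le hs n _) 2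
  refine (Summable.tsum_le_tsum h1 (h.summable.of_nonneg_of_le (fun n => by positivity) h1)
    h.summable).trans ?_
  rw [h.tsum_eq]
  have h2 : (2 * Real.pi)⁻¹ ≤ 1 := inv_le_one_of_one_le₀ (by linarith [Real.pi_gt_three])
  calc (2 * Real.pi)⁻¹ * ‖BoundedL2.toLpCLM a‖ ^ 2 ≤ 1 * ‖a‖ ^ 2 := by
        gcongr
        exact a.norm_toLpCLM_le
    _ = ‖a‖ ^ 2 := one_mul _

/-- The trigonometric polynomial with the given coefficients. -/
def trigPoly (c : ℤ → ℂ) (S : Finset ℤ) : TorusL2 :=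
  ∑ m ∈ S, ((c m).re • cosT m + (-(c m).im) • sinT m)

theorem regular_trigPoly (c : ℤ → ℂ) (S : Finset ℤ) (k : ℕ) :
    Regular k fun _ => trigPoly c S := by
  classical
  induction S using Finset.induction_on with
  | empty =>
    simpa [trigPoly] using (regular_cosT_sinT 0 k).1.smul (c := fun _ => 0) continuous_const
  | insert m S hm ih =>
    simp only [trigPoly, Finset.sum_insert hm]
    exact (((regular_cosT_sinT m k).1.smul (c := fun _ => (c m).re) continuous_const).add
      ((regular_cosT_sinT m k).2.smul (c := fun _ => -(c m).im) continuous_const)).add ih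

/-- The summand of index `m` puts half of `c m` at frequency `m` and half of its conjugate at `-m`.
The symmetry of `S` and of `c` reunites the two halves. -/
theorem torusCoeff_trigPoly {c : ℤ → ℂ} (hc : ∀ n, c (-n) = conj (c n)) {S : Finset ℤ}
    (hS : ∀ n, -n ∈ S ↔ n ∈ S) (n : ℤ) :
    torusCoeff (trigPoly c S) n = if n ∈ S then c n else 0 := by
  have h1 : torusCoeff (trigPoly c S) n
      = ∑ m ∈ S, ((c m).re * torusCoeff (cosT m) n - (c m).im * torusCoeff (sinT m) n) := by
    have h3 : ∀ f : TorusL2 →+ ℂ, f (trigPoly c S) = ∑ m ∈ S,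
        f ((c m).re • cosT m + (-(c m).im) • sinT m) := fun f => map_sum f _ S
    refine (h3 ⟨⟨fun a => torusCoeff a n, ?_⟩, fun a b => torusCoeff_add a b n⟩).trans ?_
    · simpa using torusCoeff_smul 0 0 n
    · refine Finset.sum_congr rfl fun m _ => ?_
      change torusCoeff ((c m).re • cosT m + (-(c m).im) • sinT m : TorusL2) n = _
      rw [torusCoeff_add, torusCoeff_smul, torusCoeff_smul]
      push_cast
      ring
  rw [h1]
  simp only [torusCoeff_cosT, torusCoeff_sinT]
  have h2 : ∀ m, ((c m).re : ℂ) * (((if m = n then 1 else 0) + if m = -n then 1 else 0) / 2)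
      - (c m).im * (((if m = -n then 1 else 0) - if m = n then 1 else 0) * Complex.I / 2)
      = (if m = n then c m / 2 else 0) + if m = -n then conj (c m) / 2 else 0 := fun m => by
    have h3 := Complex.re_add_im (c m)
    have h4 : conj (c m) = (c m).re - (c m).im * Complex.I :=
      Complex.ext (by simp) (by simp)
    split_ifs
    · rw [h4]
      nth_rw 3 [← h3]
      ring
    · nth_rw 3 [← h3]
      ring
    · rw [h4]
      ring
    · ring
  simp only [h2, Finset.sum_add_distrib, Finset.sum_ite_eq', hS, hc, Complex.conj_conj]
  split_ifs <;> ring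

/-- Finite truncations of the weighted coefficient sequence converge in `ℓ²`. The set of frequencies
is symmetrized so that the truncation is a real trigonometric polynomial. -/
theorem exists_norm_toSobolevTorus_sub_lt (hs : s < 0) (f : SobolevTorus s) {ε : ℝ} (hε : 0 < ε) :
    ∃ a, (∀ k, Regular k fun _ => a) ∧ ‖toSobolevTorus hs a - f‖ < ε := by
  have h1 := lp.hasSum_single ENNReal.ofNat_ne_top (SobolevTorus.toL2 s f)
  obtain ⟨S₀, hS₀⟩ := (Metric.tendsto_atTop.1 h1) ε hε
  classical
  set S : Finset ℤ := S₀ ∪ S₀.image Neg.neg with hS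
  have hS' : ∀ n, -n ∈ S ↔ n ∈ S := fun n => by
    simp only [hS, Finset.mem_union, Finset.mem_image, neg_inj, exists_eq_right]
    constructor
    · rintro (h | h)
      · exact Or.inr ⟨-n, h, neg_neg n⟩
      · exact Or.inl h
    · rintro (h | ⟨m, h, rfl⟩)
      · exact Or.inr h
      · exact Or.inl (by rwa [neg_neg])
  refine ⟨trigPoly f.coeff S, regular_trigPoly _ _, ?_⟩
  have h2 := hS₀ S Finset.subset_union_left
  rw [dist_eq_norm] at h2
  rw [norm_sobolevTorus, map_sub]
  refine lt_of_eq_of_lt (congrArg (fun a => ‖a - SobolevTorus.toL2 s f‖) ?_) h2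
  apply lp.ext
  funext n
  rw [lp.coeFn_sum, Finset.sum_apply]
  simp only [lp.single_apply, Pi.single_apply]
  rw [Finset.sum_ite_eq]
  have h3 := torusCoeff_trigPoly (c := f.coeff) f.2.1 hS' n
  change ((1 + (n : ℝ) ^ 2) ^ (s / 2)) • torusCoeff (trigPoly f.coeff S) n = _
  rw [h3]
  split_ifs
  · rfl
  · exact smul_zero _

theorem norm_toSobolevTorus_cosT_le (hs : s < 0) (m : ℤ) :
    ‖toSobolevTorus hs (cosT m)‖ ≤ (1 + (m : ℝ) ^ 2) ^ (s / 2) := by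
  set w : ℝ := (1 + (m : ℝ) ^ 2) ^ (s / 2) with hw
  have hw0 : 0 ≤ w := by positivity
  have h1 : SobolevTorus.toL2 s (toSobolevTorus hs (cosT m))
      = lp.single 2 m ((w : ℂ) / 2) + lp.single 2 (-m) ((w : ℂ) / 2) := by
    apply lp.ext
    funext n
    rw [lp.coeFn_add, Pi.add_apply, lp.single_apply, lp.single_apply, Pi.single_apply,
      Pi.single_apply]
    change ((1 + (n : ℝ) ^ 2) ^ (s / 2)) • torusCoeff (cosT m) n = _
    have h3 : n = -m ↔ m = -n := by lia
    simp only [torusCoeff_cosT, Complex.real_smul, h3, eq_comm (a := n) (b := m)]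
    have h2 : (m = n ∨ m = -n) → (1 + (n : ℝ) ^ 2) ^ (s / 2) = w := by
      rintro (rfl | h)
      · rfl
      · rw [hw, h]
        simp
    split_ifs with h3 h4 h4
    · rw [h2 (Or.inl h3)]
      ring
    · rw [h2 (Or.inl h3)]
      ring
    · rw [h2 (Or.inr h4)]
      ring
    · simp
  rw [norm_sobolevTorus, h1]
  refine (norm_add_le _ _).trans ?_
  rw [lp.norm_single (by norm_num), lp.norm_single (by norm_num), norm_div, Complex.norm_real,
    Real.norm_of_nonneg hw0, Complex.norm_ofNat, add_halves]

theorem tendsto_toSobolevTorus_cosT (hs : s < 0) {m : ℕ → ℤ} (hm : Tendsto m atTop atTop) :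
    Tendsto (fun n => toSobolevTorus hs (cosT (m n))) atTop (𝓝 0) := by
  refine squeeze_zero_norm (fun n => norm_toSobolevTorus_cosT_le hs (m n)) ?_
  have h1 : Tendsto (fun x : ℝ => x ^ (s / 2)) atTop (𝓝 0) := by
    simpa using tendsto_rpow_neg_atTop (y := -(s / 2)) (by linarith)
  refine h1.comp (tendsto_atTop_add_const_left _ _ ((tendsto_pow_atTop two_ne_zero).comp
    (tendsto_intCast_atTop_atTop.comp hm)))

/-- A sum of two consecutive oscillations. -/
def beat (n : ℕ) : TorusL2 := cosT (n + 1) + cosT (n + 2)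

theorem mulL_beat (n : ℕ) : BoundedL2.mulL (beat n) (beat n) = cosT 0 + cosT 1
    + ((1 / 2 : ℝ) • cosT (2 * n + 2) + (1 / 2 : ℝ) • cosT (2 * n + 4)) + cosT (2 * n + 3) := by
  ext x
  simp only [BoundedL2.mulL_apply, beat, BoundedL2.add_apply, BoundedL2.smul_apply, cosT_apply]
  push_cast
  have h1 : ((2 * n + 2 : ℝ)) * x = 2 * ((n + 1) * x) := by ring
  have h2 : ((2 * n + 4 : ℝ)) * x = 2 * ((n + 2) * x) := by ring
  have h3 : ((2 * n + 3 : ℝ)) * x = (n + 1) * x + (n + 2) * x := by ring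
  have h4 : (1 : ℝ) * x = (n + 2) * x - (n + 1) * x := by ring
  rw [h1, h2, h3, h4, Real.cos_two_mul, Real.cos_two_mul, Real.cos_add, Real.cos_sub, zero_mul,
    Real.cos_zero]
  ring

/-- In the square, the difference of the two frequencies is `1` for every `n`. The other frequencies
are `0` or at least `2`, so only `cos x` survives the pairing. -/
theorem pairing_mulL_beat (n : ℕ) :
    pairing (BoundedL2.mulL (beat n) (beat n)) (cosT 1) = Real.pi := by
  have h0 : ∀ m : ℤ, m ≠ 1 → m ≠ -1 → torusCoeff (cosT m) 1 = 0 := fun m h h' => by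
    rw [torusCoeff_cosT, if_neg h, if_neg h', add_zero, zero_div]
  have h1 : torusCoeff (cosT 1) 1 = 1 / 2 := by
    rw [torusCoeff_cosT, if_pos rfl, if_neg (by lia), add_zero]
  have h2 : torusCoeff (BoundedL2.mulL (beat n) (beat n)) 1 = 1 / 2 := by
    rw [mulL_beat, torusCoeff_add, torusCoeff_add, torusCoeff_add, torusCoeff_add,
      torusCoeff_smul, torusCoeff_smul, h1, h0 _ (by lia) (by lia), h0 _ (by lia) (by lia),
      h0 _ (by lia) (by lia), h0 _ (by lia) (by lia)]
    simp
  rw [pairing_cosT_one, h2]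
  norm_num
  ring

/-- The test function is `(1 - ∂²) sin x = 2 sin x`, so the pairing reads off a single Fourier
coefficient, whose weight in `H^s` is `2^(s/2)`. -/
theorem abs_pairing_two_smul_sinT_le (hs : s < 0) (a : TorusL2) :
    |pairing a (sinT 1 - (-1 : ℝ) • sinT 1)|
      ≤ 4 * Real.pi * ((2 : ℝ) ^ (s / 2))⁻¹ * ‖toSobolevTorus hs a‖ := by
  have h1 : pairing a (sinT 1 - (-1 : ℝ) • sinT 1) = 2 * pairing a (sinT 1) := by
    rw [pairing, pairing, map_sub, map_smul, inner_sub_right, inner_smul_right]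
    ring
  have h2 := norm_weight_coeff_le (toSobolevTorus hs a) 1
  rw [coeff_toSobolevTorus, norm_smul, Real.norm_of_nonneg (by positivity)] at h2
  have h3 : (1 : ℝ) + ((1 : ℤ) : ℝ) ^ 2 = 2 := by norm_num
  rw [h3, ← le_inv_mul_iff₀ (by positivity)] at h2
  rw [h1, pairing_sinT_one, abs_mul, abs_neg, abs_mul, abs_of_pos Real.two_pi_pos, abs_two]
  calc 2 * (2 * Real.pi * |(torusCoeff a 1).im|)
      = 4 * Real.pi * |(torusCoeff a 1).im| := by ring
    _ ≤ 4 * Real.pi * (((2 : ℝ) ^ (s / 2))⁻¹ * ‖toSobolevTorus hs a‖) := by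
        gcongr
        exact (Complex.abs_im_le_norm _).trans h2
    _ = _ := by ring

theorem isSobolevModel_torus (hs : s < 0) :
    IsSobolevModel (toSobolevTorus hs) SobolevTorus.Represents where
  continuous := AddMonoidHomClass.continuous_of_bound (toSobolevTorus hs) 1 fun a => by
    rw [one_mul]
    exact norm_toSobolevTorus_le hs a
  injective a b h := eq_of_torusCoeff_eq fun n => congrArg (fun f => f.coeff n) h
  rep a n := rfl
  eq_of_rep f a h := SobolevTorus.ext h
  dense f ε hε := exists_norm_toSobolevTorus_sub_lt hs f hε
  oscillation := by
    obtain ⟨D, hD⟩ := exists_norm_cosT_le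
    have h1 := isDeriv_sinT 1
    have h2 := isDeriv_cosT 1
    rw [Int.cast_one] at h1 h2
    rw [one_smul] at h1
    have h3 : ∀ j : ℤ, Tendsto (fun n : ℕ => (n : ℤ) + j) atTop atTop := fun j =>
      tendsto_atTop_add_const_right _ _ tendsto_natCast_atTop_atTop
    refine ⟨sinT 1, cosT 1, (-1 : ℝ) • sinT 1, beat, _, D + D, Real.pi, h1, h2,
      abs_pairing_two_smul_sinT_le hs, fun n k => ?_, fun n => ?_, ?_, Real.pi_ne_zero, ?_⟩
    · exact (regular_cosT_sinT _ k).1.add (regular_cosT_sinT _ k).1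
    · exact (norm_add_le _ _).trans (add_le_add (hD _) (hD _))
    · simpa [beat] using (tendsto_toSobolevTorus_cosT hs (h3 1)).add
        (tendsto_toSobolevTorus_cosT hs (h3 2))
    · simp only [pairing_mulL_beat]
      exact tendsto_const_nhds

end

/-! ### The line: Fourier analysis and `H^s(ℝ)` -/

section

open FourierTransform

/-! ### The line as a domain -/

instance : IsBBMDomain volume 0 where
  restrict_le := Measure.restrict_le_self
  le_volume := le_rfl
  lintegral_shift g _ _ z := lintegral_sub_right_eq_self g z
  integral_deriv _ _ hf _ _ hi hi' := integral_eq_zero_of_hasDerivAt_of_integrable hf hi' hi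

/-- The bounded continuous square integrable functions on the line. -/
abbrev LineL2 : Type := BoundedL2 volume 0

/-- The class in `L²(ℝ, ℂ)`. -/
def complexL2 (a : LineL2) : Lp ℂ 2 (volume : Measure ℝ) :=
  (a.memLp.ofReal (K := ℂ)).toLp fun x => (a x : ℂ)

theorem coeFn_complexL2 (a : LineL2) : complexL2 a =ᵐ[volume] fun x => (a x : ℂ) :=
  MemLp.coeFn_toLp _

theorem complexL2_add (a b : LineL2) : complexL2 (a + b) = complexL2 a + complexL2 b := by
  ext1
  filter_upwards [coeFn_complexL2 (a + b), coeFn_complexL2 a, coeFn_complexL2 b,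
    Lp.coeFn_add (complexL2 a) (complexL2 b)] with x h1 h2 h3 h4
  rw [h1, h4, Pi.add_apply, h2, h3, BoundedL2.add_apply, Complex.ofReal_add]

theorem norm_complexL2 (a : LineL2) : ‖complexL2 a‖ = ‖BoundedL2.toLpCLM a‖ := by
  rw [BoundedL2.norm_toLpCLM, complexL2, Lp.norm_toLp]
  congr 1
  exact eLpNorm_congr_norm_ae (ae_of_all _ fun x => Complex.norm_real _)

theorem complexL2_apply (a : LineL2) (φ : 𝓢(ℝ, ℂ)) :
    (complexL2 a : 𝓢'(ℝ, ℂ)) φ = ∫ x, φ x * (a x : ℂ) := by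
  rw [Lp.toTemperedDistribution_apply]
  refine integral_congr_ae ?_
  filter_upwards [coeFn_complexL2 a] with x h
  rw [h, smul_eq_mul]

/-- The symbol of `⟨D⟩^s`. -/
def besselSymbol (s : ℝ) (ξ : ℝ) : ℂ := ((1 + ‖ξ‖ ^ 2) ^ (s / 2) : ℝ)

@[fun_prop]
theorem hasTemperateGrowth_besselSymbol (s : ℝ) : (besselSymbol s).HasTemperateGrowth := by
  unfold besselSymbol
  fun_prop

theorem norm_besselSymbol (s ξ : ℝ) : ‖besselSymbol s ξ‖ = (1 + ‖ξ‖ ^ 2) ^ (s / 2) := by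
  rw [besselSymbol, Complex.norm_real, Real.norm_of_nonneg (by positivity)]

variable {s : ℝ}

theorem norm_besselSymbol_le (hs : s < 0) (ξ : ℝ) : ‖besselSymbol s ξ‖ ≤ 1 := by
  rw [norm_besselSymbol]
  exact Real.rpow_le_one_of_one_le_of_nonpos (by simp [sq_nonneg]) (by linarith)

/-! ### The Sobolev spaces of negative order on the line -/

/-- The embedding of the square integrable functions into `H^s(ℝ)` for `s < 0`. -/
def toSobolevLine (hs : s < 0) : LineL2 →+ SobolevLine s where
  toFun a := ⟨(complexL2 a : 𝓢'(ℝ, ℂ)), MemSobolev.mono hs.le (memSobolev_zero_iff.2 ⟨_, rfl⟩),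
    fun φ hφ => by
      rw [complexL2_apply]
      have h : ∀ x, φ x * (a x : ℂ) = (((φ x).re * a x : ℝ) : ℂ) := fun x =>
        Complex.ext (by simp) (by simp [hφ x])
      simp only [h]
      rw [integral_complex_ofReal, Complex.ofReal_im]⟩
  map_zero' := by
    apply Subtype.ext
    ext φ
    change (complexL2 0 : 𝓢'(ℝ, ℂ)) φ = 0
    rw [complexL2_apply]
    simp
  map_add' a b := by
    apply Subtype.ext
    change Lp.toTemperedDistributionCLM ℂ volume 2 (complexL2 (a + b))
      = Lp.toTemperedDistributionCLM ℂ volume 2 (complexL2 a)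
        + Lp.toTemperedDistributionCLM ℂ volume 2 (complexL2 b)
    rw [complexL2_add, map_add]

theorem toDistribution_toSobolevLine (hs : s < 0) (a : LineL2) :
    (toSobolevLine hs a).toDistribution = (complexL2 a : 𝓢'(ℝ, ℂ)) := rfl

theorem SobolevLine.ext {f g : SobolevLine s}
    (h : ∀ φ, f.toDistribution φ = g.toDistribution φ) : f = g :=
  Subtype.ext (ContinuousLinearMap.ext h)

theorem norm_sobolevLine (f : SobolevLine s) : ‖f‖ = ‖SobolevLine.toL2 s f‖ := rfl

/-- Plancherel: the Sobolev norm can be computed on the Fourier side from any `L²` representative.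
-/
theorem norm_sobolevLine_eq_of_fourier {f : SobolevLine s} {v : Lp ℂ 2 (volume : Measure ℝ)}
    (h : smulLeftCLM ℂ (besselSymbol s) (𝓕 f.toDistribution) = (v : 𝓢'(ℝ, ℂ))) :
    ‖f‖ = ‖v‖ := by
  have h1 : 𝓕 (SobolevLine.toL2 s f) = v := by
    apply Lp_toTemperedDistribution_injective
    change Lp.toTemperedDistribution (𝓕 (SobolevLine.toL2 s f)) = _
    rw [← Lp.fourier_toTemperedDistribution_eq, ← f.toL2_spec,
      fourier_besselPotential_eq_smulLeftCLM_fourier_apply]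
    exact h
  rw [norm_sobolevLine, ← Lp.norm_fourier_eq, h1]

theorem norm_toSobolevLine_le (hs : s < 0) (a : LineL2) : ‖toSobolevLine hs a‖ ≤ ‖a‖ := by
  have hg : MemLp (besselSymbol s) ∞ (volume : Measure ℝ) := memLp_top_of_bound
    (hasTemperateGrowth_besselSymbol s).1.continuous.aestronglyMeasurable 1
    (ae_of_all _ (norm_besselSymbol_le hs))
  have h1 : ‖toSobolevLine hs a‖
      = ‖(hg.toLp (besselSymbol s) • 𝓕 (complexL2 a) : Lp ℂ 2 volume)‖ := by
    apply norm_sobolevLine_eq_of_fourier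
    rw [Lp.toTemperedDistribution_smul_eq (by fun_prop), toDistribution_toSobolevLine,
      Lp.fourier_toTemperedDistribution_eq]
  rw [h1]
  refine (Lp.norm_smul_le _ _).trans ?_
  rw [Lp.norm_fourier_eq, norm_complexL2]
  have h2 : ‖hg.toLp (besselSymbol s)‖ ≤ 1 := by
    rw [Lp.norm_toLp]
    refine ENNReal.toReal_le_of_le_ofReal zero_le_one ?_
    rw [eLpNorm_exponent_top]
    exact eLpNormEssSup_le_of_ae_bound (ae_of_all _ (norm_besselSymbol_le hs))
  exact (mul_le_of_le_one_left (norm_nonneg _) h2).trans a.norm_toLpCLM_le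

theorem toSobolevLine_injective (hs : s < 0) : Function.Injective (toSobolevLine hs) := by
  refine (injective_iff_map_eq_zero _).2 fun a ha => toLpCLM_injective ?_
  have h1 : complexL2 a = 0 := by
    apply Lp_toTemperedDistribution_injective
    change (complexL2 a : 𝓢'(ℝ, ℂ)) = Lp.toTemperedDistributionCLM ℂ volume 2 0
    rw [map_zero]
    exact congrArg SobolevLine.toDistribution ha
  rw [map_zero, ← norm_eq_zero, ← norm_complexL2, h1, norm_zero]

/-- An element of `H^s(ℝ)` is controlled by its norm when it is tested against a Schwartz
function. -/
theorem exists_norm_toDistribution_le (φ : 𝓢(ℝ, ℂ)) :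
    ∃ C : ℝ, ∀ f : SobolevLine s, ‖f.toDistribution φ‖ ≤ C * ‖f‖ := by
  -- The transpose of `⟨D⟩^(-s)` applied to `φ`. Testing `f` against `φ` is testing `⟨D⟩^s f`
  -- against `θ`, and Cauchy–Schwarz in `L²` concludes.
  set θ : 𝓢(ℝ, ℂ) := 𝓕 (SchwartzMap.smulLeftCLM ℂ (besselSymbol (-s)) (𝓕⁻ φ)) with hθ
  refine ⟨‖(θ.postcompCLM (Complex.conjCLE : ℂ →L[ℝ] ℂ)).toLp 2‖, fun f => ?_⟩
  have h1 : f.toDistribution = besselPotential ℝ ℂ (-s) (SobolevLine.toL2 s f : 𝓢'(ℝ, ℂ)) := by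
    rw [← f.toL2_spec]
    simp
  have h2 : f.toDistribution φ = (SobolevLine.toL2 s f : 𝓢'(ℝ, ℂ)) θ := by
    rw [h1]
    rfl
  rw [h2, Lp.toTemperedDistribution_apply, norm_sobolevLine]
  refine le_trans (le_of_eq ?_) (norm_inner_le_norm (𝕜 := ℂ) _ _)
  rw [L2.inner_def]
  congr 1
  refine integral_congr_ae ?_
  filter_upwards [SchwartzMap.coeFn_toLp (θ.postcompCLM (Complex.conjCLE : ℂ →L[ℝ] ℂ)) 2 volume]
    with x hx
  rw [hx]
  simp [mul_comm]

end

section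

open FourierTransform

variable {s : ℝ}

/-! ### Schwartz functions -/

/-- A real Schwartz function as a square integrable function. -/
def ofSchwartz (φ : 𝓢(ℝ, ℝ)) : LineL2 :=
  BoundedL2.mk φ φ.continuous (SchwartzMap.seminorm ℝ 0 0 φ) (SchwartzMap.norm_le_seminorm ℝ φ)
    (fun x => by rw [add_zero]) (φ.memLp 2)

@[simp] theorem ofSchwartz_apply (φ : 𝓢(ℝ, ℝ)) (x : ℝ) : ofSchwartz φ x = φ x := rfl

theorem isDeriv_ofSchwartz (φ : 𝓢(ℝ, ℝ)) :
    IsDeriv (ofSchwartz φ) (ofSchwartz (SchwartzMap.derivCLM ℝ ℝ φ)) := fun x => by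
  rw [ofSchwartz_apply, SchwartzMap.derivCLM_apply]
  exact φ.differentiableAt.hasDerivAt

theorem regular_ofSchwartz (φ : 𝓢(ℝ, ℝ)) (k : ℕ) : Regular k fun _ => ofSchwartz φ := by
  induction k generalizing φ with
  | zero => exact continuous_const
  | succ k ih => exact ⟨continuous_const, _, ih _, fun _ => isDeriv_ofSchwartz φ⟩

/-- A real Schwartz function as a complex one. -/
def complexify (φ : 𝓢(ℝ, ℝ)) : 𝓢(ℝ, ℂ) := φ.postcompCLM Complex.ofRealCLM

@[simp] theorem complexify_apply (φ : 𝓢(ℝ, ℝ)) (x : ℝ) : complexify φ x = (φ x : ℂ) := rfl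

/-- The complex conjugate of a Schwartz function. -/
def conjS (φ : 𝓢(ℝ, ℂ)) : 𝓢(ℝ, ℂ) := φ.postcompCLM (Complex.conjCLE : ℂ →L[ℝ] ℂ)

@[simp] theorem conjS_apply (φ : 𝓢(ℝ, ℂ)) (x : ℝ) : conjS φ x = conj (φ x) := rfl

/-- The real part of a Schwartz function. -/
def reS (φ : 𝓢(ℝ, ℂ)) : 𝓢(ℝ, ℝ) := φ.postcompCLM Complex.reCLM

@[simp] theorem reS_apply (φ : 𝓢(ℝ, ℂ)) (x : ℝ) : reS φ x = (φ x).re := rfl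

/-- The transpose of `⟨D⟩^s`. -/
def besselTranspose (s : ℝ) (φ : 𝓢(ℝ, ℂ)) : 𝓢(ℝ, ℂ) :=
  𝓕 (SchwartzMap.smulLeftCLM ℂ (besselSymbol s) (𝓕⁻ φ))

theorem besselPotential_apply (s : ℝ) (f : 𝓢'(ℝ, ℂ)) (φ : 𝓢(ℝ, ℂ)) :
    besselPotential ℝ ℂ s f φ = f (besselTranspose s φ) := rfl

theorem fourier_conjS (φ : 𝓢(ℝ, ℂ)) : 𝓕 (conjS φ) = conjS (𝓕⁻ φ) := by
  ext x
  rw [conjS_apply, SchwartzMap.fourier_coe, SchwartzMap.fourierInv_coe, Real.fourier_eq,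
    Real.fourierInv_eq, ← integral_conj]
  refine integral_congr_ae (ae_of_all _ fun y => ?_)
  simp [Circle.smul_def]

theorem fourierInv_conjS (φ : 𝓢(ℝ, ℂ)) : 𝓕⁻ (conjS φ) = conjS (𝓕 φ) := by
  have h := fourier_conjS (𝓕 φ)
  rw [fourierInv_fourier_eq] at h
  rw [← h, fourierInv_fourier_eq]

theorem fourierInv_apply_eq_neg (φ : 𝓢(ℝ, ℂ)) (x : ℝ) : 𝓕⁻ φ x = 𝓕 φ (-x) := by
  rw [SchwartzMap.fourier_coe, SchwartzMap.fourierInv_coe, Real.fourierInv_eq_fourier_neg]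

/-- The symbol is real and even, so the operator commutes with complex conjugation. -/
theorem conjS_besselTranspose (s : ℝ) (φ : 𝓢(ℝ, ℂ)) :
    conjS (besselTranspose s φ) = besselTranspose s (conjS φ) := by
  have h1 : conjS (SchwartzMap.smulLeftCLM ℂ (besselSymbol s) (𝓕⁻ φ))
      = SchwartzMap.smulLeftCLM ℂ (besselSymbol s) (𝓕 (conjS φ)) := by
    ext x
    rw [fourier_conjS, conjS_apply, SchwartzMap.smulLeftCLM_apply_apply (by fun_prop),
      SchwartzMap.smulLeftCLM_apply_apply (by fun_prop), smul_eq_mul, map_mul, besselSymbol,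
      Complex.conj_ofReal]
    rfl
  rw [besselTranspose, ← fourierInv_conjS, h1]
  ext x
  rw [besselTranspose, SchwartzMap.fourierInv_coe, SchwartzMap.fourier_coe,
    Real.fourierInv_eq_fourier_comp_neg]
  refine congrFun (congrArg 𝓕 (funext fun y => ?_)) x
  rw [SchwartzMap.smulLeftCLM_apply_apply (by fun_prop),
    SchwartzMap.smulLeftCLM_apply_apply (by fun_prop), fourierInv_apply_eq_neg, besselSymbol,
    besselSymbol, norm_neg]

/-- Reality is assumed on real test functions only; splitting into real and imaginary parts extends
it to complex ones. -/
theorem conj_toDistribution (f : SobolevLine s) (φ : 𝓢(ℝ, ℂ)) :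
    conj (f.toDistribution (conjS φ)) = f.toDistribution φ := by
  have h1 : φ = complexify (reS φ) + Complex.I • complexify (reS (-Complex.I • φ)) := by
    ext x
    simp [Complex.re_add_im, mul_comm Complex.I]
  have h2 : conjS φ = complexify (reS φ) - Complex.I • complexify (reS (-Complex.I • φ)) := by
    ext x
    exact Complex.ext (by simp) (by simp)
  have h3 : ∀ ψ : 𝓢(ℝ, ℝ), conj (f.toDistribution (complexify ψ))
      = f.toDistribution (complexify ψ) := fun ψ =>
    Complex.conj_eq_iff_im.2 (f.2.2 _ fun x => Complex.ofReal_im _)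
  rw [h2]
  conv_rhs => rw [h1]
  rw [map_sub, map_add, map_smul, map_sub, smul_eq_mul, map_mul, h3, h3, Complex.conj_I]
  ring

theorem toTemperedDistribution_star (g : Lp ℂ 2 (volume : Measure ℝ)) (φ : 𝓢(ℝ, ℂ)) :
    Lp.toTemperedDistribution (star g) φ = conj ((g : 𝓢'(ℝ, ℂ)) (conjS φ)) := by
  rw [Lp.toTemperedDistribution_apply, Lp.toTemperedDistribution_apply, ← integral_conj]
  refine integral_congr_ae ?_
  filter_upwards [Lp.coeFn_star g] with x hx
  rw [hx]
  simp

theorem norm_star_lp (g : Lp ℂ 2 (volume : Measure ℝ)) : ‖star g‖ = ‖g‖ := by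
  rw [Lp.norm_def, Lp.norm_def]
  congr 1
  refine eLpNorm_congr_norm_ae ?_
  filter_upwards [Lp.coeFn_star g] with x hx
  rw [hx, Pi.star_apply, norm_star]

theorem integral_reS (Φ φ : 𝓢(ℝ, ℂ)) : ∫ x, φ x * ((reS Φ x : ℝ) : ℂ)
    = (1 / 2 : ℂ) * ((Φ : 𝓢'(ℝ, ℂ)) φ + conj ((Φ : 𝓢'(ℝ, ℂ)) (conjS φ))) := by
  have h1 : Integrable fun x => φ x * Φ x :=
    (SchwartzMap.smulLeftCLM ℂ φ Φ).integrable.congr (ae_of_all _ fun x =>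
      SchwartzMap.smulLeftCLM_apply_apply φ.hasTemperateGrowth Φ x)
  have h2 : Integrable fun x => φ x * conj (Φ x) :=
    (SchwartzMap.smulLeftCLM ℂ φ (conjS Φ)).integrable.congr (ae_of_all _ fun x =>
      SchwartzMap.smulLeftCLM_apply_apply φ.hasTemperateGrowth (conjS Φ) x)
  have h3 : ∀ θ : 𝓢(ℝ, ℂ), (Φ : 𝓢'(ℝ, ℂ)) θ = ∫ x, θ x * Φ x := fun θ =>
    SchwartzMap.toTemperedDistributionCLM_apply_apply volume Φ θ
  rw [h3, h3, ← integral_conj]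
  simp only [conjS_apply, map_mul, Complex.conj_conj]
  rw [← integral_add h1 h2, ← integral_const_mul]
  refine integral_congr_ae (ae_of_all _ fun x => ?_)
  simp only [reS_apply, Complex.re_eq_add_conj]
  ring

/-- A Schwartz function close to `⟨D⟩^s f` in `L²` is pulled back by `⟨D⟩^(-s)`. The result may be
complex, and its real part is used. -/
theorem exists_norm_toSobolevLine_sub_lt (hs : s < 0) (f : SobolevLine s) {ε : ℝ} (hε : 0 < ε) :
    ∃ a, (∀ k, Regular k fun _ => a) ∧ ‖toSobolevLine hs a - f‖ < ε := by
  obtain ⟨Ψ, hΨ⟩ := (SchwartzMap.denseRange_toLpCLM (F := ℂ) (μ := (volume : Measure ℝ))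
    (p := 2) ENNReal.ofNat_ne_top).exists_dist_lt (SobolevLine.toL2 s f) hε
  set Φ : 𝓢(ℝ, ℂ) := SchwartzMap.fourierMultiplierCLM ℂ (besselSymbol (-s)) Ψ with hΦ
  have h1 : besselPotential ℝ ℂ s (Φ : 𝓢'(ℝ, ℂ)) = (Ψ : 𝓢'(ℝ, ℂ)) := by
    rw [← besselPotential_neg_apply_eq_iff]
    exact fourierMultiplierCLM_toTemperedDistributionCLM_eq
      (hasTemperateGrowth_besselSymbol (-s)) Ψ
  set D : Lp ℂ 2 (volume : Measure ℝ) := Ψ.toLp 2 volume - SobolevLine.toL2 s f with hD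
  have hD' : ‖D‖ < ε := by
    rw [hD, ← norm_sub_rev, ← dist_eq_norm]
    exact hΨ
  have h2 : ∀ φ, (D : 𝓢'(ℝ, ℂ)) φ = (Φ : 𝓢'(ℝ, ℂ)) (besselTranspose s φ)
      - f.toDistribution (besselTranspose s φ) := fun φ => by
    rw [← besselPotential_apply, ← besselPotential_apply, h1, f.toL2_spec,
      ← Lp.toTemperedDistribution_toLp_eq (p := 2) (μ := volume),
      ← Lp.toTemperedDistributionCLM_apply, hD, map_sub]
    rfl
  refine ⟨ofSchwartz (reS Φ), regular_ofSchwartz _, ?_⟩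
  -- As `f` is real and `⟨D⟩^s` commutes with conjugation, passing to the real part replaces the
  -- error `D` by its own real part, which is no larger.
  have h3 : SobolevLine.toL2 s (toSobolevLine hs (ofSchwartz (reS Φ)) - f)
      = (1 / 2 : ℂ) • (D + star D) := by
    apply Lp_toTemperedDistribution_injective
    ext φ
    change (SobolevLine.toL2 s (toSobolevLine hs (ofSchwartz (reS Φ)) - f) : 𝓢'(ℝ, ℂ)) φ
      = Lp.toTemperedDistributionCLM ℂ volume 2 ((1 / 2 : ℂ) • (D + star D)) φ
    rw [map_smul, map_add, ← SobolevLine.toL2_spec, besselPotential_apply]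
    change (complexL2 (ofSchwartz (reS Φ)) : 𝓢'(ℝ, ℂ)) (besselTranspose s φ)
      - f.toDistribution (besselTranspose s φ)
      = (1 / 2 : ℂ) * ((D : 𝓢'(ℝ, ℂ)) φ + Lp.toTemperedDistribution (star D) φ)
    rw [toTemperedDistribution_star, h2, h2, ← conjS_besselTranspose, map_sub,
      conj_toDistribution, complexL2_apply]
    simp only [ofSchwartz_apply]
    rw [integral_reS]
    ring
  rw [norm_sobolevLine, h3, norm_smul]
  have h4 := norm_add_le D (star D)
  rw [norm_star_lp] at h4
  have h5 : ‖(1 / 2 : ℂ)‖ = 1 / 2 := by simp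
  rw [h5]
  linarith

end

section

open FourierTransform

variable {s : ℝ}

/-! ### Oscillating functions on the line -/

/-- A smooth bump function. -/
def bump : ContDiffBump (0 : ℝ) := ⟨1, 2, zero_lt_one, one_lt_two⟩

/-- A smooth bump function, as a Schwartz function. -/
def bumpS : 𝓢(ℝ, ℝ) := bump.hasCompactSupport.toSchwartzMap bump.contDiff

/-- A modulated bump function. -/
def wave (c : ℝ) : 𝓢(ℝ, ℝ) :=
  HasCompactSupport.toSchwartzMap (f := fun x => Real.cos (2 * Real.pi * c * x) * bump x)
    bump.hasCompactSupport.mul_left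
    ((Real.contDiff_cos.comp (contDiff_const.mul contDiff_id)).mul bump.contDiff)

theorem bumpS_apply (x : ℝ) : bumpS x = bump x := rfl

theorem wave_apply (c x : ℝ) : wave c x = Real.cos (2 * Real.pi * c * x) * bumpS x := rfl

theorem fourier_wave (c ξ : ℝ) : 𝓕 (complexify (wave c)) ξ
    = 2⁻¹ * (𝓕 (complexify bumpS) (ξ - c) + 𝓕 (complexify bumpS) (ξ + c)) := by
  simp only [SchwartzMap.fourier_coe, Real.fourier_eq]
  rw [← integral_add ((Real.fourierIntegral_convergent_iff _).2 (complexify bumpS).integrable)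
    ((Real.fourierIntegral_convergent_iff _).2 (complexify bumpS).integrable),
    ← integral_const_mul]
  refine integral_congr_ae (ae_of_all _ fun x => ?_)
  simp only [complexify_apply, wave_apply, Circle.smul_def, Real.fourierChar_apply, smul_eq_mul,
    Complex.ofReal_mul, Complex.ofReal_cos, Complex.cos]
  rw [← add_mul, ← mul_assoc, ← mul_assoc, mul_div_assoc', mul_add, ← Complex.exp_add,
    ← Complex.exp_add, div_eq_inv_mul]
  congr 4 <;> simp <;> ring

theorem norm_toSobolevLine_ofSchwartz (hs : s < 0) (φ : 𝓢(ℝ, ℝ)) :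
    ‖toSobolevLine hs (ofSchwartz φ)‖
      = (eLpNorm (fun ξ => besselSymbol s ξ * 𝓕 (complexify φ) ξ) 2 volume).toReal := by
  have h1 : ‖toSobolevLine hs (ofSchwartz φ)‖
      = ‖(SchwartzMap.smulLeftCLM ℂ (besselSymbol s) (𝓕 (complexify φ))).toLp 2 volume‖ := by
    apply norm_sobolevLine_eq_of_fourier
    have h2 : (toSobolevLine hs (ofSchwartz φ)).toDistribution = (complexify φ : 𝓢'(ℝ, ℂ)) := by
      ext θ
      rw [toDistribution_toSobolevLine, complexL2_apply]
      exact (SchwartzMap.toTemperedDistributionCLM_apply_apply volume (complexify φ) θ).symm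
    rw [h2, fourier_toTemperedDistributionCLM_eq, Lp.toTemperedDistribution_toLp_eq]
    ext θ
    rw [smulLeftCLM_apply_apply]
    refine (SchwartzMap.toTemperedDistributionCLM_apply_apply volume _ _).trans
      (Eq.trans ?_ (SchwartzMap.toTemperedDistributionCLM_apply_apply volume _ _).symm)
    refine integral_congr_ae (ae_of_all _ fun x => ?_)
    simp only []
    rw [SchwartzMap.smulLeftCLM_apply_apply (by fun_prop),
      SchwartzMap.smulLeftCLM_apply_apply (by fun_prop)]
    simp only [smul_eq_mul]
    ring
  rw [h1, SchwartzMap.norm_toLp, SchwartzMap.smulLeftCLM_apply (by fun_prop)]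
  rfl

/-- Dominated convergence: the symbol is at most `1` and, since `s < 0`, tends to `0` at each point
as the shift escapes to infinity. -/
theorem tendsto_eLpNorm_besselSymbol_mul (hs : s < 0) (v : 𝓢(ℝ, ℂ)) {c : ℕ → ℝ}
    (hc : Tendsto (fun n => |c n|) atTop atTop) :
    Tendsto (fun n => eLpNorm (fun ξ => besselSymbol s (ξ + c n) * v ξ) 2 volume) atTop (𝓝 0) := by
  have hg := (hasTemperateGrowth_besselSymbol s).1.continuous
  have h1 : Tendsto (fun n => ∫⁻ ξ, ‖besselSymbol s (ξ + c n) * v ξ‖ₑ ^ (2 : ℝ)) atTop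
      (𝓝 (∫⁻ _ : ℝ, 0)) := by
    refine tendsto_lintegral_of_dominated_convergence (fun ξ => ‖v ξ‖ₑ ^ (2 : ℝ))
      (fun n => ?_) (fun n => ae_of_all _ fun ξ => ?_) ?_ (ae_of_all _ fun ξ => ?_)
    · exact (Continuous.measurable (by fun_prop)).enorm.pow_const _
    · refine ENNReal.rpow_le_rpow ?_ zero_le_two
      rw [enorm_mul]
      exact mul_le_of_le_one_left zero_le (by
        rw [← ofReal_norm]
        exact ENNReal.ofReal_le_one.2 (norm_besselSymbol_le hs _))
    · have h2 := (eLpNorm_lt_top_iff_lintegral_rpow_enorm_lt_top two_ne_zero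
        ENNReal.ofNat_ne_top).1 (v.memLp 2 volume).2
      simpa using h2.ne
    · have h3 : Tendsto (fun n => besselSymbol s (ξ + c n) * v ξ) atTop (𝓝 0) := by
        rw [← zero_mul (v ξ)]
        refine Tendsto.mul_const _ (tendsto_zero_iff_norm_tendsto_zero.2 ?_)
        simp only [norm_besselSymbol]
        have h4 : Tendsto (fun x : ℝ => x ^ (s / 2)) atTop (𝓝 0) := by
          simpa using tendsto_rpow_neg_atTop (y := -(s / 2)) (by linarith)
        refine h4.comp (tendsto_atTop_add_const_left _ _ ((tendsto_pow_atTop two_ne_zero).comp ?_))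
        refine tendsto_atTop_mono (fun n => ?_) (tendsto_atTop_add_const_right _ (-|ξ|) hc)
        rw [Real.norm_eq_abs, ← sub_eq_add_neg, sub_le_iff_le_add]
        calc |c n| = |(ξ + c n) + -ξ| := by ring_nf
          _ ≤ |ξ + c n| + |ξ| := by simpa using abs_add_le (ξ + c n) (-ξ)
      have h5 := ((ENNReal.continuous_rpow_const (y := 2)).tendsto 0).comp
        ((continuous_enorm.tendsto (0 : ℂ)).comp h3 |>.trans_eq (by simp))
      simpa [Function.comp_def] using h5
  have h6 := ((ENNReal.continuous_rpow_const (y := 1 / 2)).tendsto _).comp h1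
  simpa [eLpNorm_eq_lintegral_rpow_enorm_toReal two_ne_zero ENNReal.ofNat_ne_top,
    Function.comp_def] using h6

theorem tendsto_toSobolevLine_wave (hs : s < 0) :
    Tendsto (fun n : ℕ => toSobolevLine hs (ofSchwartz (wave n))) atTop (𝓝 0) := by
  obtain ⟨v, hv⟩ : ∃ v, 𝓕 (complexify bumpS) = v := ⟨_, rfl⟩
  have hg := (hasTemperateGrowth_besselSymbol s).1.continuous
  have hm : ∀ c d : ℝ, AEStronglyMeasurable (fun ξ => besselSymbol s (ξ + c) * v (ξ + d)) volume :=
    fun c d => ((hg.comp (continuous_add_const c)).mul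
      (v.continuous.comp (continuous_add_const d))).aestronglyMeasurable
  -- Modulation translates the fixed Fourier profile; a change of variable moves the translation
  -- onto the symbol, where it makes the norm decay.
  have h1 : ∀ c : ℝ, eLpNorm (fun ξ => besselSymbol s ξ * v (ξ + c)) 2 volume
      = eLpNorm (fun ξ => besselSymbol s (ξ + -c) * v ξ) 2 volume := fun c => by
    rw [← eLpNorm_comp_measurePreserving (f := fun ξ : ℝ => ξ + c)
      (g := fun ξ => besselSymbol s (ξ + -c) * v ξ) (by simpa using hm (-c) 0)
      (measurePreserving_add_right volume c)]
    simp [Function.comp_def]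
  have h2 : ∀ n : ℕ, eLpNorm (fun ξ => besselSymbol s ξ * 𝓕 (complexify (wave n)) ξ) 2 volume
      ≤ eLpNorm (fun ξ => besselSymbol s (ξ + (n : ℝ)) * v ξ) 2 volume
        + eLpNorm (fun ξ => besselSymbol s (ξ + -(n : ℝ)) * v ξ) 2 volume := fun n => by
    have h3 := h1 (-n)
    rw [neg_neg] at h3
    rw [← h3, ← h1 n]
    have hm' : ∀ d : ℝ, AEStronglyMeasurable (fun ξ => besselSymbol s ξ * v (ξ + d)) volume :=
      fun d => by simpa using hm 0 d
    refine le_trans (eLpNorm_mono (g := (fun ξ => besselSymbol s ξ * v (ξ + -(n : ℝ)))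
      + fun ξ => besselSymbol s ξ * v (ξ + n)) fun ξ => ?_)
      (eLpNorm_add_le (hm' _) (hm' _) one_le_two)
    rw [fourier_wave, hv, Pi.add_apply, ← mul_add, norm_mul, norm_mul, norm_mul,
      ← sub_eq_add_neg]
    refine mul_le_mul_of_nonneg_left (mul_le_of_le_one_left (norm_nonneg _) ?_) (norm_nonneg _)
    norm_num
  have h3 : Tendsto (fun n : ℕ => |(n : ℝ)|) atTop atTop :=
    tendsto_abs_atTop_atTop.comp tendsto_natCast_atTop_atTop
  have h4 := (tendsto_eLpNorm_besselSymbol_mul hs v h3).add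
    (tendsto_eLpNorm_besselSymbol_mul hs v (c := fun n => -(n : ℝ)) (by simpa using h3))
  rw [add_zero] at h4
  have h5 := tendsto_of_tendsto_of_tendsto_of_le_of_le tendsto_const_nhds h4
    (fun n => zero_le) h2
  refine tendsto_zero_iff_norm_tendsto_zero.2 ?_
  simp only [norm_toSobolevLine_ofSchwartz]
  exact (ENNReal.tendsto_toReal ENNReal.zero_ne_top).comp h5

theorem exists_norm_wave_le : ∃ D : ℝ, ∀ c, ‖ofSchwartz (wave c)‖ ≤ D := by
  have h : ∀ c x, ‖ofSchwartz (wave c) x‖ ≤ ‖ofSchwartz bumpS x‖ := fun c x => by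
    rw [ofSchwartz_apply, wave_apply, norm_mul]
    exact mul_le_of_le_one_left (norm_nonneg _) (Real.abs_cos_le_one _)
  exact ⟨‖ofSchwartz bumpS‖, fun c => BoundedL2.norm_le (norm_nonneg _)
    (fun x => (h c x).trans ((ofSchwartz bumpS).abs_apply_le x))
    ((eLpNorm_mono (h c)).trans (ofSchwartz bumpS).eLpNorm_le)⟩

/-- The product of two Schwartz functions. -/
def mulS (φ ψ : 𝓢(ℝ, ℝ)) : 𝓢(ℝ, ℝ) := SchwartzMap.smulLeftCLM ℝ φ ψ

@[simp] theorem mulS_apply (φ ψ : 𝓢(ℝ, ℝ)) (x : ℝ) : mulS φ ψ x = φ x * ψ x :=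
  SchwartzMap.smulLeftCLM_apply_apply φ.hasTemperateGrowth ψ x

/-- Since `cos² = (1 + cos 2·)/2`, the square is half the squared bump plus a term of frequency
`2n`, which the Riemann–Lebesgue lemma removes. -/
theorem tendsto_pairing_wave (φ : 𝓢(ℝ, ℝ)) :
    Tendsto (fun n : ℕ => pairing (BoundedL2.mulL (ofSchwartz (wave n)) (ofSchwartz (wave n)))
      (ofSchwartz φ)) atTop (𝓝 (2⁻¹ * ∫ x, mulS (mulS bumpS bumpS) φ x)) := by
  set θ := mulS (mulS bumpS bumpS) φ with hθ
  have h1 : ∀ n : ℕ, pairing (BoundedL2.mulL (ofSchwartz (wave n)) (ofSchwartz (wave n)))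
      (ofSchwartz φ) = (2⁻¹ * ∫ x, θ x) + 2⁻¹ * (𝓕 (complexify θ) (2 * n)).re := fun n => by
    have h2 : (𝓕 (complexify θ) (2 * n)).re
        = ∫ x, Real.cos (2 * (2 * Real.pi * n * x)) * θ x := by
      rw [SchwartzMap.fourier_coe, Real.fourier_eq, ← Complex.reCLM_apply,
        ← ContinuousLinearMap.integral_comp_comm _
        ((Real.fourierIntegral_convergent_iff _).2 (complexify θ).integrable)]
      refine integral_congr_ae (ae_of_all _ fun x => ?_)
      simp only [complexify_apply, Circle.smul_def, Real.fourierChar_apply, smul_eq_mul,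
        Complex.reCLM_apply, Complex.re_mul_ofReal, Complex.exp_ofReal_mul_I_re]
      congr 1
      rw [← Real.cos_neg]
      congr 1
      simp
      ring
    have h3 : Integrable fun x => Real.cos (2 * (2 * Real.pi * n * x)) * θ x :=
      θ.integrable.bdd_mul (c := 1) (Continuous.aestronglyMeasurable (by fun_prop))
        (ae_of_all _ fun x => Real.abs_cos_le_one _)
    rw [h2, pairing_eq_integral, ← mul_add, ← integral_add θ.integrable h3, ← integral_const_mul]
    refine integral_congr_ae (ae_of_all _ fun x => ?_)
    simp only [BoundedL2.mulL_apply, ofSchwartz_apply, wave_apply, hθ, mulS_apply, Real.cos_two_mul]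
    ring
  have h2 : Tendsto (fun n : ℕ => 𝓕 (complexify θ) (2 * (n : ℝ))) atTop (𝓝 0) :=
    (Real.zero_at_infty_fourier (complexify θ)).comp
      ((tendsto_natCast_atTop_atTop.const_mul_atTop two_pos).mono_right atTop_le_cocompact)
  have h3 := (((Complex.continuous_re.tendsto 0).comp h2).const_mul 2⁻¹).const_add
    (2⁻¹ * ∫ x, θ x)
  simp only [h1]
  simpa [Function.comp_def] using h3

/-- With `q` the squared bump, the integral of `q q''` is minus that of `q'²`. It could vanish only
for constant `q`, but `q` is `1` at `0` and `0` at `3`. -/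
theorem integral_mulS_deriv_deriv_bumpS_ne_zero :
    ∫ x, mulS (mulS bumpS bumpS) (SchwartzMap.derivCLM ℝ ℝ
      (SchwartzMap.derivCLM ℝ ℝ (mulS bumpS bumpS))) x ≠ 0 := by
  set q := mulS bumpS bumpS with hq
  have h1 := (isDeriv_ofSchwartz q).integral_add_eq_zero
    (isDeriv_ofSchwartz (SchwartzMap.derivCLM ℝ ℝ q))
  rw [real_inner_self_eq_norm_sq, BoundedL2.inner_toLpCLM] at h1
  intro h2
  simp only [mulS_apply] at h2
  simp only [ofSchwartz_apply, h2, add_zero, ne_eq, OfNat.ofNat_ne_zero, not_false_eq_true,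
    pow_eq_zero_iff, norm_eq_zero] at h1
  have h3 : ofSchwartz (SchwartzMap.derivCLM ℝ ℝ q) = 0 :=
    toLpCLM_injective (h1.trans (map_zero _).symm)
  have h4 : ∀ x, deriv q x = 0 := fun x => by
    rw [← SchwartzMap.derivCLM_apply ℝ, ← ofSchwartz_apply, h3, BoundedL2.zero_apply]
  have h5 := is_const_of_deriv_eq_zero q.differentiable h4 0 3
  have h6 : bump 0 = 1 := bump.one_of_mem_closedBall (by simp [bump])
  have h7 : bump 3 = 0 := bump.zero_of_le_dist (by norm_num [bump])
  rw [hq, mulS_apply, mulS_apply, bumpS_apply, bumpS_apply, h6, h7] at h5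
  norm_num at h5

theorem pairing_ofSchwartz (hs : s < 0) (a : LineL2) (φ : 𝓢(ℝ, ℝ)) :
    ((pairing a (ofSchwartz φ) : ℝ) : ℂ) = (toSobolevLine hs a).toDistribution (complexify φ) := by
  rw [toDistribution_toSobolevLine, complexL2_apply, pairing_eq_integral, ← integral_complex_ofReal]
  refine integral_congr_ae (ae_of_all _ fun x => ?_)
  simp [mul_comm]

theorem isSobolevModel_line (hs : s < 0) :
    IsSobolevModel (toSobolevLine hs) SobolevLine.Represents where
  continuous := AddMonoidHomClass.continuous_of_bound (toSobolevLine hs) 1 fun a => by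
    rw [one_mul]
    exact norm_toSobolevLine_le hs a
  injective := toSobolevLine_injective hs
  rep a φ := complexL2_apply a φ
  eq_of_rep f a h := SobolevLine.ext fun φ => (h φ).trans (complexL2_apply a φ).symm
  dense f ε hε := exists_norm_toSobolevLine_sub_lt hs f hε
  oscillation := by
    -- With `η = q'`, the weak limit `q/2` of the squares is tested against `η' = q''`, which gives
    -- a nonzero constant.
    set q' := SchwartzMap.derivCLM ℝ ℝ (mulS bumpS bumpS)
    have hη := isDeriv_ofSchwartz q'
    have hη' := isDeriv_ofSchwartz (SchwartzMap.derivCLM ℝ ℝ q')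
    obtain ⟨C, hC⟩ := exists_norm_toDistribution_le (s := s) (complexify
      (q' - SchwartzMap.derivCLM ℝ ℝ (SchwartzMap.derivCLM ℝ ℝ q')))
    obtain ⟨D, hD⟩ := exists_norm_wave_le
    refine ⟨_, _, _, fun n => ofSchwartz (wave n), C, D, _, hη, hη', fun a => ?_,
      fun n => regular_ofSchwartz _, fun n => hD n, tendsto_toSobolevLine_wave hs,
      mul_ne_zero (by norm_num) integral_mulS_deriv_deriv_bumpS_ne_zero, tendsto_pairing_wave _⟩
    have h := hC (toSobolevLine hs a)
    rwa [← pairing_ofSchwartz, Complex.norm_real] at h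

end

end BBM

end

/-! ### The two domains put together -/

theorem corollary1p4 (s : ℝ) (hs : s < 0) (T : ℝ) (hT : 0 < T) :
    -- the real line
    ((∀ v : ℝ → ℝ, SmoothDatumLine v →
        ∃ u : ℝ → ℝ → ℝ, (SmoothSolutionLine T u ∧ u 0 = v) ∧
          ∀ w : ℝ → ℝ → ℝ, SmoothSolutionLine T w ∧ w 0 = v → ∀ t ∈ Set.Icc 0 T, w t = u t) ∧
      (∃ Φ : SobolevLine s → C(Set.Icc (0 : ℝ) T, SobolevLine s), IsSolutionMapLine Φ) ∧
      ∀ Φ : SobolevLine s → C(Set.Icc (0 : ℝ) T, SobolevLine s), IsSolutionMapLine Φ →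
        ∀ u₀ : SobolevLine s, ¬ ContinuousAt Φ u₀) ∧
    -- the torus
    ((∀ v : ℝ → ℝ, SmoothDatumTorus v →
        ∃ u : ℝ → ℝ → ℝ, (SmoothSolutionTorus T u ∧ u 0 = v) ∧
          ∀ w : ℝ → ℝ → ℝ, SmoothSolutionTorus T w ∧ w 0 = v → ∀ t ∈ Set.Icc 0 T, w t = u t) ∧
      (∃ Φ : SobolevTorus s → C(Set.Icc (0 : ℝ) T, SobolevTorus s), IsSolutionMapTorus Φ) ∧
      ∀ Φ : SobolevTorus s → C(Set.Icc (0 : ℝ) T, SobolevTorus s), IsSolutionMapTorus Φ →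
        ∀ u₀ : SobolevTorus s, ¬ ContinuousAt Φ u₀) := by
  -- The line is the domain of period `0`, where periodicity is no condition.
  have h0 : ∀ f : ℝ → ℝ, Function.Periodic f 0 := fun f x => by rw [add_zero]
  refine ⟨⟨fun v hv => ?_, ?_, fun Φ hΦ => ?_⟩, fun v hv => ?_, ?_, fun Φ hΦ => ?_⟩
  · obtain ⟨u, ⟨_, hu, hu0⟩, huniq⟩ := BBM.exists_isSmoothBBMSolution hT hv (h0 v)
    exact ⟨u, ⟨hu, hu0⟩, fun w hw => huniq w (fun t _ => h0 _) hw.1 hw.2⟩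
  · obtain ⟨Φ, hΦ⟩ := ((BBM.isSobolevModel_line hs).exists_and_not_continuousAt hT).1
    exact ⟨Φ, fun u hu => hΦ u (fun t _ => h0 _) hu⟩
  · exact ((BBM.isSobolevModel_line hs).exists_and_not_continuousAt hT).2 Φ fun u _ hu => hΦ u hu
  · obtain ⟨u, ⟨hup, hu, hu0⟩, huniq⟩ := BBM.exists_isSmoothBBMSolution hT hv.2 hv.1
    exact ⟨u, ⟨⟨fun t _ => hup t, hu⟩, hu0⟩, fun w hw => huniq w hw.1.1 hw.1.2 hw.2⟩
  · obtain ⟨Φ, hΦ⟩ := ((BBM.isSobolevModel_torus hs).exists_and_not_continuousAt hT).1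
    exact ⟨Φ, fun u hu => hΦ u hu.1 hu.2⟩
  · exact ((BBM.isSobolevModel_torus hs).exists_and_not_continuousAt hT).2 Φ
      fun u hup hu => hΦ u ⟨hup, hu⟩
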